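/- Let $F$ be a commutative ring. All operads are unital symmetric operads in differential graded $F$-modules (graded by all integers, upper grading, Koszul sign rule), and algebras are algebras in dg-modules. A weak equivalence (respectively, a fibration) of algebras is an algebra morphism which induces an isomorphism in cohomology (respectively, which is surjective in all degrees). A path object of a $\mathcal{P}$-algebra $A$ is a $\mathcal{P}$-algebra $\tilde{A}$ together with morphisms of $\mathcal{P}$-algebras $s_0 : A \to \tilde{A}$ and $d_0, d_1 : \tilde{A} \to A$ such that $s_0$ is a weak equivalence, $(d_0,d_1) : \tilde{A} \to A \times A$ is a fibration and $d_0 s_0 = d_1 s_0 = 1_A$. Let $\mathcal{E}$ be the Barratt-Eccles operad: $\mathcal{E}(r)$ is the normalized homogeneous bar complex of $\Sigma_r$, generated in degree $d$ by the sequences $(w_0,\ldots,w_d)$ of permutations (which are zero if $w_i = w_{i+1}$ for some $i$), with the diagonal action of $\Sigma_r$ and the composition product $u \circ_k v = \sum \pm (u_{x_0}\circ_k v_{y_0}, \ldots, u_{x_{d+e}}\circ_k v_{y_{d+e}})$, where the sum ranges over the lattice paths from $(0,0)$ to $(d,e)$ and the sign is the signature of the associated shuffle. The normalized cochain complex $N^*(\Delta^n)$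 is an $\mathcal{E}$-algebra: the action is dual to the cooperations $AW(TR(w)) : N_*(\Delta^n) \to N_*(\Delta^n)^{\otimes r}$, where $TR$ is the table reduction morphism from $\mathcal{E}$ to the surjection operad and $AW(u)$ is the interval cut operation associated to a surjection $u$. For an operad $\mathcal{P}$, let $\mathcal{E}\otimes\mathcal{P}$ be the operad with $(\mathcal{E}\otimes\mathcal{P})(r) = \mathcal{E}(r)\otimes\mathcal{P}(r)$, together with the augmentation $\mathcal{E}\otimes\mathcal{P}\to\mathcal{P}$ induced by the augmentations $\mathcal{E}(r)\to F$. Assume that this augmentation has a section $\sigma : \mathcal{P}\to\mathcal{E}\otimes\mathcal{P}$ in the category of dg-operads. Let $A$ be a $\mathcal{P}$-algebra. Then, for $n = 0, 1$, the dg-module $N^*(\Delta^n)\otimes A$ has a unique family of operations of $\mathcal{E}\otimes\mathcal{P}$ such that, for homogeneous elements, $$(e\otimes p)(k_1\otimes a_1,\ldots,k_r\otimes a_r) = \pm\, e(k_1,\ldots,k_r)\otimes p(a_1,\ldots,a_r)$$ (with the Koszul sign of the permutation of $p, k_1, a_1, \ldots, k_r, a_r$). These operations make $N^*(\Delta^n)\otimes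 A$ into an $\mathcal{E}\otimes\mathcal{P}$-algebra and hence, by restriction through $\sigma$, into a $\mathcal{P}$-algebra. The canonical isomorphism $N^*(\Delta^0)\otimes A = F\otimes A = A$ is an isomorphism of $\mathcal{P}$-algebras. With this identification, $\tilde{A} = N^*(\Delta^1)\otimes A$ together with the maps $$A = N^*(\Delta^0)\otimes A \xrightarrow{\ s_0\otimes A\ } N^*(\Delta^1)\otimes A \overset{d_0\otimes A}{\underset{d_1\otimes A}{\rightrightarrows}} N^*(\Delta^0)\otimes A = A,$$ induced by $\Delta^1\to\Delta^0$ and by the two maps $d^0, d^1 : \Delta^0\to\Delta^1$ (where $d^i$ omits the vertex $i$), is a path object of $A$. -/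

import Mathlib

open scoped TensorProduct

universe u v w w'

noncomputable section

/-! ## Differential graded modules -/

/-- A dg-module over `F`: a module which is the internal direct sum of its homogeneous components
(upper grading by all the integers), with a differential of degree `1`. -/
structure DGModule (F : Type u) [CommRing F] where
  carrier : Type v
  [addCommGroup : AddCommGroup carrier]
  [module : Module F carrier]
  gr : ℤ → Submodule F carrier
  isInternal : DirectSum.IsInternal gr
  d : carrier →ₗ[F] carrier
  d_mem : ∀ (n : ℤ) (x : carrier), x ∈ gr n → d x ∈ gr (n + 1)
  d_d : ∀ x : carrier, d (d x) = 0

attribute [instance] DGModule.addCommGroup DGModule.module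

instance {F : Type u} [CommRing F] : CoeSort (DGModule.{u, v} F) (Type v) :=
  ⟨DGModule.carrier⟩

/-- A criterion for internal direct sums: there is a linear map which computes components. -/
theorem isInternal_of_components {F : Type u} [CommRing F] {V : Type v} [AddCommGroup V]
    [Module F V] (gr : ℤ → Submodule F V) (c : V →ₗ[F] (ℤ →₀ V))
    (h₁ : ∀ n, ∀ x ∈ gr n, c x = Finsupp.single n x)
    (h₂ : ∀ x, x ∈ ⨆ n, gr n) : DirectSum.IsInternal gr := by
  classical
  constructor
  · intro x y hxy
    have key : ∀ z : DirectSum ℤ (fun n => gr n), ∀ n : ℤ,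
        c (DirectSum.coeAddMonoidHom gr z) n = (z n : V) := by
      intro z n
      induction z using DirectSum.induction_on with
      | zero => simp
      | of i a =>
        rw [DirectSum.coeAddMonoidHom_of, h₁ i _ a.2, DirectSum.coe_of_apply]
        by_cases h : i = n
        · subst h; simp
        · simp [h]
      | add a b ha hb => simp [map_add, ha, hb]
    refine DFinsupp.ext fun n => Subtype.ext ?_
    have h1 := key x n
    rw [hxy] at h1
    exact h1.symm.trans (key y n)
  · intro x
    have hx := h₂ x
    induction hx using Submodule.iSup_induction' with
    | mem i x hx => exact ⟨DirectSum.of (fun n => gr n) i ⟨x, hx⟩, by simp⟩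
    | zero => exact ⟨0, map_zero _⟩
    | add x y _ _ hx hy =>
      obtain ⟨a, rfl⟩ := hx
      obtain ⟨b, rfl⟩ := hy
      exact ⟨a + b, map_add _ _ _⟩

namespace DGModule

variable {F : Type u} [CommRing F]

theorem coe_bijective (V : DGModule.{u, v} F) :
    Function.Bijective (DirectSum.coeLinearMap V.gr) := V.isInternal

/-- The linear map on `V` which is the family of maps `f n` on the components of degree `n`. -/
def onComponents (V : DGModule.{u, v} F) {M : Type w} [AddCommGroup M] [Module F M]
    (f : ℤ → (V →ₗ[F] M)) : V →ₗ[F] M :=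
  (DirectSum.toModule F ℤ M fun n => (f n) ∘ₗ (V.gr n).subtype) ∘ₗ
    (LinearEquiv.ofBijective (DirectSum.coeLinearMap V.gr) V.coe_bijective).symm.toLinearMap

theorem onComponents_of_mem (V : DGModule.{u, v} F) {M : Type w} [AddCommGroup M] [Module F M]
    (f : ℤ → (V →ₗ[F] M)) {n : ℤ} {x : V} (hx : x ∈ V.gr n) : V.onComponents f x = f n x := by
  classical
  have : (LinearEquiv.ofBijective (DirectSum.coeLinearMap V.gr) V.coe_bijective).symm x
      = DirectSum.lof F ℤ (fun n => V.gr n) n ⟨x, hx⟩ := by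
    rw [LinearEquiv.symm_apply_eq, LinearEquiv.ofBijective_apply, DirectSum.coeLinearMap_lof]
  simp [onComponents, this]

theorem mem_iSup (V : DGModule.{u, v} F) (x : V) : x ∈ ⨆ n, V.gr n := by
  rw [V.isInternal.submodule_iSup_eq_top]; trivial

/-- The sign operator `x ↦ (-1)^|x| x`. -/
def sgn (V : DGModule.{u, v} F) : V →ₗ[F] V :=
  V.onComponents fun n => n.negOnePow • LinearMap.id

/-- The projection on the components of even degree. -/
def evenPart (V : DGModule.{u, v} F) : V →ₗ[F] V :=
  V.onComponents fun n => if Even n then LinearMap.id else 0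

/-- The projection on the components of odd degree. -/
def oddPart (V : DGModule.{u, v} F) : V →ₗ[F] V :=
  V.onComponents fun n => if Even n then 0 else LinearMap.id

theorem sgn_of_mem (V : DGModule.{u, v} F) {n : ℤ} {x : V} (hx : x ∈ V.gr n) :
    V.sgn x = n.negOnePow • x := by
  rw [sgn, onComponents_of_mem _ _ hx]; rfl

/-! ### Tensor products -/

/-- The homogeneous component of degree `n` of `V ⊗ W`: the sum of the images of the
`V^p ⊗ W^q` with `p + q = n`. -/
def tensorGr (V : DGModule.{u, v} F) (W : DGModule.{u, w} F) (n : ℤ) : Submodule F (V ⊗[F] W) :=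
  Submodule.span F {x | ∃ (p q : ℤ) (a : V) (b : W),
    p + q = n ∧ a ∈ V.gr p ∧ b ∈ W.gr q ∧ x = a ⊗ₜ[F] b}

theorem tmul_mem_tensorGr (V : DGModule.{u, v} F) (W : DGModule.{u, w} F) {p q : ℤ} {a : V} {b : W}
    (ha : a ∈ V.gr p) (hb : b ∈ W.gr q) : a ⊗ₜ[F] b ∈ tensorGr V W (p + q) :=
  Submodule.subset_span ⟨p, q, a, b, rfl, ha, hb, rfl⟩

theorem mem_iSup_tensorGr (V : DGModule.{u, v} F) (W : DGModule.{u, w} F) (x : V ⊗[F] W) :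
    x ∈ ⨆ n, tensorGr V W n := by
  induction x using TensorProduct.induction_on with
  | zero => exact Submodule.zero_mem _
  | add x y hx hy => exact Submodule.add_mem _ hx hy
  | tmul a b =>
    induction V.mem_iSup a using Submodule.iSup_induction' with
    | zero => rw [TensorProduct.zero_tmul]; exact Submodule.zero_mem _
    | add x y _ _ hx hy => rw [TensorProduct.add_tmul]; exact Submodule.add_mem _ hx hy
    | mem p a ha =>
      induction W.mem_iSup b using Submodule.iSup_induction' with
      | zero => rw [TensorProduct.tmul_zero]; exact Submodule.zero_mem _
      | add x y _ _ hx hy => rw [TensorProduct.tmul_add]; exact Submodule.add_mem _ hx hy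
      | mem q b hb => exact Submodule.mem_iSup_of_mem (p + q) (tmul_mem_tensorGr V W ha hb)

theorem tensorGr_isInternal (V : DGModule.{u, v} F) (W : DGModule.{u, w} F) :
    DirectSum.IsInternal (tensorGr V W) := by
  classical
  let cV : V →ₗ[F] (ℤ →₀ V) := V.onComponents fun n => Finsupp.lsingle n
  let cW : W →ₗ[F] (ℤ →₀ W) := W.onComponents fun n => Finsupp.lsingle n
  refine isInternal_of_components _
    ((Finsupp.lmapDomain (V ⊗[F] W) F fun z : ℤ × ℤ => z.1 + z.2) ∘ₗ
      (finsuppTensorFinsupp F F V W ℤ ℤ).toLinearMap ∘ₗ TensorProduct.map cV cW) ?_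
      (mem_iSup_tensorGr V W)
  intro n x hx
  induction hx using Submodule.span_induction with
  | zero => simp
  | add x y _ _ hx hy => rw [map_add, hx, hy, Finsupp.single_add]
  | smul r x _ hx => rw [map_smul, hx, Finsupp.smul_single]
  | mem x hx =>
    obtain ⟨p, q, a, b, rfl, ha, hb, rfl⟩ := hx
    simp [cV, cW, onComponents_of_mem _ _ ha, onComponents_of_mem _ _ hb,
      Finsupp.mapDomain_single]

/-- The differential `δ(a ⊗ b) = δ(a) ⊗ b + (-1)^|a| a ⊗ δ(b)`. -/
def tensorD (V : DGModule.{u, v} F) (W : DGModule.{u, w} F) : V ⊗[F] W →ₗ[F] V ⊗[F] W :=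
  TensorProduct.map V.d LinearMap.id + TensorProduct.map V.sgn W.d

theorem tensorD_tmul (V : DGModule.{u, v} F) (W : DGModule.{u, w} F) {p : ℤ} {a : V}
    (ha : a ∈ V.gr p) (b : W) :
    tensorD V W (a ⊗ₜ[F] b) = V.d a ⊗ₜ[F] b + p.negOnePow • (a ⊗ₜ[F] W.d b) := by
  rcases Int.units_eq_one_or p.negOnePow with h | h <;>
    simp [tensorD, sgn_of_mem _ ha, h, TensorProduct.neg_tmul]

/-- The tensor product of dg-modules. -/
def tensor (V : DGModule.{u, v} F) (W : DGModule.{u, w} F) : DGModule.{u, max v w} F where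
  carrier := V ⊗[F] W
  gr := tensorGr V W
  isInternal := tensorGr_isInternal V W
  d := tensorD V W
  d_mem := by
    intro n x hx
    induction hx using Submodule.span_induction with
    | zero => rw [map_zero]; exact Submodule.zero_mem _
    | add x y _ _ hx hy => rw [map_add]; exact Submodule.add_mem _ hx hy
    | smul r x _ hx => rw [map_smul]; exact Submodule.smul_mem _ _ hx
    | mem x hx =>
      obtain ⟨p, q, a, b, rfl, ha, hb, rfl⟩ := hx
      rw [tensorD_tmul V W ha]
      refine Submodule.add_mem _ ?_ ?_
      · have := tmul_mem_tensorGr V W (V.d_mem _ _ ha) hb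
        rwa [show p + 1 + q = p + q + 1 by ring] at this
      · have := tmul_mem_tensorGr V W ha (W.d_mem _ _ hb)
        rw [← add_assoc] at this
        rcases Int.units_eq_one_or p.negOnePow with h | h <;> rw [h]
        · simpa using this
        · simpa using this
  d_d := by
    intro x
    induction mem_iSup_tensorGr V W x using Submodule.iSup_induction' with
    | zero => simp
    | add x y _ _ hx hy => rw [map_add, map_add, hx, hy, add_zero]
    | mem n x hx =>
      induction hx using Submodule.span_induction with
      | zero => simp
      | add x y _ _ hx hy => rw [map_add, map_add, hx, hy, add_zero]
      | smul r x _ hx => rw [map_smul, map_smul, hx, smul_zero]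
      | mem x hx =>
        obtain ⟨p, q, a, b, rfl, ha, hb, rfl⟩ := hx
        rw [tensorD_tmul V W ha, map_add, tensorD_tmul V W (V.d_mem _ _ ha), V.d_d,
          Int.negOnePow_succ]
        rcases Int.units_eq_one_or p.negOnePow with h | h <;>
          simp [h, tensorD_tmul V W ha, W.d_d]

/-- The product of two dg-modules. -/
def prod (V : DGModule.{u, v} F) (W : DGModule.{u, w} F) : DGModule.{u, max v w} F where
  carrier := V × W
  gr n := (V.gr n).prod (W.gr n)
  isInternal := by
    classical
    let cV : V →ₗ[F] (ℤ →₀ V × W) :=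
      V.onComponents fun n => Finsupp.lsingle n ∘ₗ LinearMap.inl F V W
    let cW : W →ₗ[F] (ℤ →₀ V × W) :=
      W.onComponents fun n => Finsupp.lsingle n ∘ₗ LinearMap.inr F V W
    refine isInternal_of_components _ (cV.coprod cW) ?_ ?_
    · rintro n ⟨a, b⟩ ⟨ha, hb⟩
      simp only [cV, cW, LinearMap.coprod_apply, onComponents_of_mem _ _ ha,
        onComponents_of_mem _ _ hb]
      simp [← Finsupp.single_add]
    · rintro ⟨a, b⟩
      have h1 : ((a, 0) : V × W) ∈ ⨆ n, (V.gr n).prod (W.gr n) := by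
        induction V.mem_iSup a using Submodule.iSup_induction' with
        | zero => exact Submodule.zero_mem _
        | add x y _ _ hx hy => simpa using Submodule.add_mem _ hx hy
        | mem n x hx => exact Submodule.mem_iSup_of_mem n ⟨hx, Submodule.zero_mem _⟩
      have h2 : ((0, b) : V × W) ∈ ⨆ n, (V.gr n).prod (W.gr n) := by
        induction W.mem_iSup b using Submodule.iSup_induction' with
        | zero => exact Submodule.zero_mem _
        | add x y _ _ hx hy => simpa using Submodule.add_mem _ hx hy
        | mem n x hx => exact Submodule.mem_iSup_of_mem n ⟨Submodule.zero_mem _, hx⟩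
      simpa using Submodule.add_mem _ h1 h2
  d := V.d.prodMap W.d
  d_mem := fun _ _ hx => ⟨V.d_mem _ _ hx.1, W.d_mem _ _ hx.2⟩
  d_d := fun x => by
    ext
    · exact V.d_d x.1
    · exact W.d_d x.2

/-! ### Morphisms, cohomology, weak equivalences, fibrations -/

/-- Morphisms of dg-modules: maps of degree `0` which commute with the differentials. -/
structure IsHom {V : DGModule.{u, v} F} {W : DGModule.{u, w} F} (f : V →ₗ[F] W) : Prop where
  map_mem : ∀ (n : ℤ) (x : V), x ∈ V.gr n → f x ∈ W.gr n
  map_d : ∀ x : V, f (V.d x) = W.d (f x)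

/-- The cocycles of degree `n`. -/
def cocycles (V : DGModule.{u, v} F) (n : ℤ) : Submodule F V := V.gr n ⊓ LinearMap.ker V.d

/-- The coboundaries of degree `n`. -/
def coboundaries (V : DGModule.{u, v} F) (n : ℤ) : Submodule F V := (V.gr (n - 1)).map V.d

/-- The cohomology module of degree `n`. -/
abbrev Cohomology (V : DGModule.{u, v} F) (n : ℤ) : Type v :=
  V.cocycles n ⧸ (V.coboundaries n).submoduleOf (V.cocycles n)

theorem IsHom.map_cocycles {V : DGModule.{u, v} F} {W : DGModule.{u, w} F} {f : V →ₗ[F] W}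
    (hf : IsHom f) (n : ℤ) : ∀ x ∈ V.cocycles n, f x ∈ W.cocycles n := by
  rintro x ⟨hx, hd⟩
  refine ⟨hf.map_mem n x hx, ?_⟩
  change V.d x = 0 at hd
  change W.d (f x) = 0
  rw [← hf.map_d, hd, map_zero]

/-- The map induced in cohomology. -/
def IsHom.cohomologyMap {V : DGModule.{u, v} F} {W : DGModule.{u, w} F} {f : V →ₗ[F] W}
    (hf : IsHom f) (n : ℤ) : V.Cohomology n →ₗ[F] W.Cohomology n :=
  Submodule.mapQ _ _ (f.restrict (hf.map_cocycles n)) (by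
    rintro ⟨x, hx⟩ ⟨y, hy, hyx⟩
    exact ⟨f y, hf.map_mem _ y hy, by rw [← hf.map_d, hyx]; rfl⟩)

/-- Weak equivalences: morphisms which induce an isomorphism in cohomology. -/
def IsWeakEquivalence {V : DGModule.{u, v} F} {W : DGModule.{u, w} F} (f : V →ₗ[F] W) : Prop :=
  ∃ hf : IsHom f, ∀ n : ℤ, Function.Bijective (hf.cohomologyMap n)

/-- Fibrations: morphisms which are surjective in all degrees. -/
def IsFibration {V : DGModule.{u, v} F} {W : DGModule.{u, w} F} (f : V →ₗ[F] W) : Prop :=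
  IsHom f ∧ ∀ n : ℤ, ∀ y ∈ W.gr n, ∃ x ∈ V.gr n, f x = y

/-! ### Graded modules with a basis -/

/-- A free module on a set of homogeneous generators is graded. -/
theorem isInternal_supported {B : Type w} (deg : B → ℤ) :
    DirectSum.IsInternal fun n : ℤ => Finsupp.supported F F {b | deg b = n} := by
  classical
  refine isInternal_of_components _
    (Finsupp.linearCombination F fun b => Finsupp.single (deg b) (Finsupp.single b (1 : F))) ?_ ?_
  · intro n x hx
    rw [Finsupp.mem_supported] at hx
    rw [Finsupp.linearCombination_apply]
    conv_rhs => rw [← Finsupp.sum_single x, Finsupp.sum, ← Finsupp.singleAddHom_apply, map_sum]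
    refine Finset.sum_congr rfl fun b hb => ?_
    have : deg b = n := hx hb
    simp [this, Finsupp.smul_single]
  · intro x
    induction x using Finsupp.induction_linear with
    | zero => exact Submodule.zero_mem _
    | add x y hx hy => exact Submodule.add_mem _ hx hy
    | single b c =>
      exact Submodule.mem_iSup_of_mem (deg b) (Finsupp.single_mem_supported F c rfl)

end DGModule

/-! ## The normalized bar complex of a set -/

section BarComplex

variable (F : Type u) [CommRing F] {α : Type}

/-- The non-degenerate simplices `(w₀, …, w_d)` of the contractible simplicial set on `α`:
non-empty sequences without consecutive repetitions. -/
abbrev NDSeq (α : Type) : Type := {l : List α // l ≠ [] ∧ l.IsChain (· ≠ ·)}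

open Classical in
/-- The class of a sequence in the normalized complex: degenerate sequences are zero (and the empty
sequence, which does not represent a simplex, is discarded). -/
def normSeq (l : List α) : NDSeq α →₀ F :=
  if h : l ≠ [] ∧ l.IsChain (· ≠ ·) then Finsupp.single ⟨l, h⟩ 1 else 0

/-- The alternate sum of faces `∑ i, (-1)^i (w₀, …, ŵ_i, …, w_d)`, as a formal sum of sequences:
the face `0` omits the head, and the other faces keep it. -/
def seqFaces : List α → (List α →₀ F)
  | [] => 0
  | a :: l => Finsupp.single l 1 - Finsupp.mapDomain (List.cons a) (seqFaces l)

/-- The differential of the normalized complex. -/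
def barD (α : Type) : (NDSeq α →₀ F) →ₗ[F] (NDSeq α →₀ F) :=
  Finsupp.linearCombination F fun l =>
    Finsupp.linearCombination F (normSeq F) (seqFaces F l.1)

/-- The (upper) degree of a simplex `(w₀, …, w_d)`, which is `-d`. -/
def barDeg (l : NDSeq α) : ℤ := 1 - (l.1.length : ℤ)

theorem seqFaces_length (l : List α) :
    seqFaces F l ∈ Finsupp.supported F F {k : List α | k.length + 1 = l.length} := by
  induction l with
  | nil => exact Submodule.zero_mem _
  | cons a l ih =>
    refine Submodule.sub_mem _ (Finsupp.single_mem_supported F 1 (by simp)) ?_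
    have := Submodule.mem_map_of_mem (f := Finsupp.lmapDomain F F (List.cons a)) ih
    rw [Finsupp.lmapDomain_supported] at this
    refine Finsupp.supported_mono ?_ this
    rintro _ ⟨k, hk, rfl⟩
    simpa using hk

theorem normSeq_mem (l : List α) :
    normSeq F l ∈ Finsupp.supported F F {k : NDSeq α | barDeg k = 1 - (l.length : ℤ)} := by
  unfold normSeq
  split_ifs with h
  · exact Finsupp.single_mem_supported F 1 (by simp [barDeg])
  · exact Submodule.zero_mem _

theorem barD_mem (n : ℤ) (x : NDSeq α →₀ F)
    (hx : x ∈ Finsupp.supported F F {b : NDSeq α | barDeg b = n}) :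
    barD F α x ∈ Finsupp.supported F F {b : NDSeq α | barDeg b = n + 1} := by
  rw [barD, Finsupp.linearCombination_apply]
  refine Submodule.sum_mem _ fun l hl => Submodule.smul_mem _ _ ?_
  have hl' : barDeg l = n := hx hl
  rw [Finsupp.linearCombination_apply]
  refine Submodule.sum_mem _ fun k hk => Submodule.smul_mem _ _ ?_
  have hk' : k.length + 1 = l.1.length := seqFaces_length F l.1 hk
  have := normSeq_mem F k
  rwa [show (1 : ℤ) - k.length = n + 1 by rw [← hl', barDeg]; omega] at this

/-- The span of the degenerate sequences. -/
def degSpan (α : Type) : Submodule F (List α →₀ F) :=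
  Submodule.span F {x | ∃ l : List α, ¬ l.IsChain (· ≠ ·) ∧ x = Finsupp.single l 1}

theorem cons_mem_degSpan (a : α) {x : List α →₀ F} (hx : x ∈ degSpan F α) :
    Finsupp.mapDomain (List.cons a) x ∈ degSpan F α := by
  induction hx using Submodule.span_induction with
  | zero => rw [Finsupp.mapDomain_zero]; exact Submodule.zero_mem _
  | add x y _ _ hx hy => rw [Finsupp.mapDomain_add]; exact Submodule.add_mem _ hx hy
  | smul r x _ hx => rw [Finsupp.mapDomain_smul]; exact Submodule.smul_mem _ _ hx
  | mem x hx =>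
    obtain ⟨l, hl, rfl⟩ := hx
    rw [Finsupp.mapDomain_single]
    exact Submodule.subset_span ⟨a :: l, fun h => hl (List.IsChain.tail h), rfl⟩

theorem cons_cons_mem_degSpan (a : α) (x : List α →₀ F) :
    Finsupp.mapDomain (List.cons a) (Finsupp.mapDomain (List.cons a) x) ∈ degSpan F α := by
  induction x using Finsupp.induction_linear with
  | zero => simp
  | add x y hx hy => simpa [Finsupp.mapDomain_add] using Submodule.add_mem _ hx hy
  | single l c =>
    rw [Finsupp.mapDomain_single, Finsupp.mapDomain_single, ← mul_one c, ← smul_eq_mul,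
      ← Finsupp.smul_single]
    exact Submodule.smul_mem _ _ (Submodule.subset_span ⟨_, by simp, rfl⟩)

theorem seqFaces_mem_degSpan (l : List α) (hl : ¬ l.IsChain (· ≠ ·)) :
    seqFaces F l ∈ degSpan F α := by
  induction l with
  | nil => exact absurd List.IsChain.nil hl
  | cons a l ih =>
    cases l with
    | nil => exact absurd (List.IsChain.singleton a) hl
    | cons b l =>
      by_cases hab : a = b
      · subst hab
        have : seqFaces F (a :: a :: l) =
            Finsupp.mapDomain (List.cons a) (Finsupp.mapDomain (List.cons a) (seqFaces F l)) := by
          simp only [seqFaces, ← Finsupp.lmapDomain_apply F F, map_sub]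
          simp
        rw [this]
        exact cons_cons_mem_degSpan F a _
      · have hl' : ¬ (b :: l).IsChain (· ≠ ·) := fun h => hl (List.isChain_cons_cons.2 ⟨hab, h⟩)
        rw [seqFaces]
        exact Submodule.sub_mem _ (Submodule.subset_span ⟨_, hl', rfl⟩)
          (cons_mem_degSpan F a (ih hl'))

theorem linearCombination_normSeq_degSpan {x : List α →₀ F} (hx : x ∈ degSpan F α) :
    Finsupp.linearCombination F (normSeq F) x = 0 := by
  induction hx using Submodule.span_induction with
  | zero => simp
  | add x y _ _ hx hy => rw [map_add, hx, hy, add_zero]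
  | smul r x _ hx => rw [map_smul, hx, smul_zero]
  | mem x hx =>
    obtain ⟨l, hl, rfl⟩ := hx
    simp [normSeq, hl]

theorem seqFaces_seqFaces (l : List α) :
    Finsupp.linearCombination F (seqFaces F) (seqFaces F l) = 0 := by
  have hcons : ∀ (a : α) (x : List α →₀ F),
      Finsupp.linearCombination F (seqFaces F) (Finsupp.mapDomain (List.cons a) x) =
        x - Finsupp.mapDomain (List.cons a) (Finsupp.linearCombination F (seqFaces F) x) := by
    intro a x
    induction x using Finsupp.induction_linear with
    | zero => simp
    | add x y hx hy => simp only [Finsupp.mapDomain_add, map_add, hx, hy]; abel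
    | single l c => simp [seqFaces, smul_sub, Finsupp.mapDomain_smul]
  induction l with
  | nil => simp [seqFaces]
  | cons a l ih => simp [seqFaces, hcons, ih]

theorem barD_linearCombination_normSeq (x : List α →₀ F) :
    barD F α (Finsupp.linearCombination F (normSeq F) x) =
      Finsupp.linearCombination F (normSeq F) (Finsupp.linearCombination F (seqFaces F) x) := by
  induction x using Finsupp.induction_linear with
  | zero => simp
  | add x y hx hy => simp only [map_add, hx, hy]
  | single l c =>
    rw [Finsupp.linearCombination_single, Finsupp.linearCombination_single, map_smul, map_smul]
    congr 1
    by_cases h : l ≠ [] ∧ l.IsChain (· ≠ ·)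
    · simp [normSeq, h, barD]
    · have h0 : normSeq F l = 0 := by simp only [normSeq, h, dite_false]
      rw [h0, map_zero]
      by_cases h1 : l = []
      · subst h1; simp [seqFaces]
      · exact (linearCombination_normSeq_degSpan F
          (seqFaces_mem_degSpan F l fun h2 => h ⟨h1, h2⟩)).symm

theorem barD_barD (x : NDSeq α →₀ F) : barD F α (barD F α x) = 0 := by
  induction x using Finsupp.induction_linear with
  | zero => simp
  | add x y hx hy => rw [map_add, map_add, hx, hy, add_zero]
  | single l c =>
    rw [barD, Finsupp.linearCombination_single, ← barD, map_smul, barD_linearCombination_normSeq,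
      seqFaces_seqFaces, map_zero, smul_zero]

/-- The normalized chain complex of the contractible simplicial set on `α`, where chains of
dimension `d` have the upper degree `-d`. -/
def barComplex (α : Type) : DGModule.{u, u} F where
  carrier := NDSeq α →₀ F
  gr n := Finsupp.supported F F {b | barDeg b = n}
  isInternal := DGModule.isInternal_supported barDeg
  d := barD F α
  d_mem := barD_mem F
  d_d := barD_barD F

end BarComplex

/-! ## Operads -/

open Equiv (Perm)

/-- In the substitution of an operation with `s` inputs in the input `k` of an operation with `r`
inputs, this is the position of the input `i` of the operation which is inserted. -/
def inIdx {r s n : ℕ} (h : n + 1 = r + s) (k : Fin r) (i : Fin s) : Fin n :=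
  ⟨k + i, by omega⟩

/-- In the substitution of an operation with `s` inputs in the input `k` of an operation with `r`
inputs, this is the position of the input `j ≠ k` of the outer operation. -/
def outIdx {r s n : ℕ} (h : n + 1 = r + s) (k : Fin r) (j : {j : Fin r // j ≠ k}) : Fin n :=
  ⟨if j.1 < k then j.1 else j.1 + s - 1, by
    have := j.2
    have h' : (j.1 : ℕ) ≠ k := fun e => this (Fin.ext e)
    split_ifs with hlt
    · have : (j.1 : ℕ) < k := hlt
      omega
    · have : ¬ (j.1 : ℕ) < k := hlt
      omega⟩

theorem blocks_bijective {r s n : ℕ} (h : n + 1 = r + s) (k : Fin r) :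
    Function.Bijective (Sum.elim (outIdx h k) (inIdx h k)) := by
  constructor
  · rintro (⟨a, ha⟩ | a) (⟨b, hb⟩ | b) hab
    · have h1 : (a : ℕ) ≠ k := fun e => ha (Fin.ext e)
      have h2 : (b : ℕ) ≠ k := fun e => hb (Fin.ext e)
      simp only [Sum.elim_inl, outIdx, Fin.mk.injEq, Fin.lt_def] at hab
      congr 2
      apply Fin.ext
      split_ifs at hab <;> omega
    · have h1 : (a : ℕ) ≠ k := fun e => ha (Fin.ext e)
      simp only [Sum.elim_inl, Sum.elim_inr, outIdx, inIdx, Fin.mk.injEq, Fin.lt_def] at hab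
      split_ifs at hab <;> omega
    · have h2 : (b : ℕ) ≠ k := fun e => hb (Fin.ext e)
      simp only [Sum.elim_inl, Sum.elim_inr, outIdx, inIdx, Fin.mk.injEq, Fin.lt_def] at hab
      split_ifs at hab <;> omega
    · simp only [Sum.elim_inr, inIdx, Fin.mk.injEq] at hab
      congr 1
      apply Fin.ext
      omega
  · intro x
    by_cases h1 : (x : ℕ) < k
    · refine ⟨Sum.inl ⟨⟨x, by omega⟩, fun e => ?_⟩, ?_⟩
      · have := congrArg Fin.val e
        simp at this; omega
      · apply Fin.ext; simp [outIdx, Fin.lt_def, h1]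
    · by_cases h2 : (x : ℕ) < k + s
      · exact ⟨Sum.inr ⟨x - k, by omega⟩, by apply Fin.ext; simp [inIdx]; omega⟩
      · refine ⟨Sum.inl ⟨⟨x + 1 - s, by omega⟩, fun e => ?_⟩, ?_⟩
        · have := congrArg Fin.val e
          simp at this; omega
        · apply Fin.ext
          have : ¬ (x : ℕ) + 1 - s < k := by omega
          simp [outIdx, Fin.lt_def, this]; omega

/-- The inputs of a composite operation. -/
def blocks {r s n : ℕ} (h : n + 1 = r + s) (k : Fin r) : {j : Fin r // j ≠ k} ⊕ Fin s ≃ Fin n :=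
  Equiv.ofBijective _ (blocks_bijective h k)

/-- The partial composite `u ∘_k v` of permutations: in the sequence of values of `u`, the value `k`
is replaced by the (shifted) sequence of values of `v`, and the values greater than `k` are
shifted. -/
def permCirc {r s n : ℕ} (h : n + 1 = r + s) (k : Fin r) (u : Perm (Fin r)) (v : Perm (Fin s)) :
    Perm (Fin n) :=
  (blocks h (u.symm k)).symm.trans
    ((Equiv.sumCongr (u.subtypeEquiv fun j => by
      rw [not_iff_not]; exact Equiv.eq_symm_apply u) v).trans (blocks h k))

/-- The structure maps of an operad in dg-modules (their laws are in `IsOperad`): the components, the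
action of permutations, the unit, and the partial composition products
`∘_k : P(r) ⊗ P(s) → P(n)`, `n = r + s - 1`. Inputs are numbered from `0`. -/
structure OperadData (F : Type u) [CommRing F] where
  obj : ℕ → DGModule.{u, v} F
  rep : ∀ {r : ℕ}, Perm (Fin r) → (obj r →ₗ[F] obj r)
  one : obj 1
  circ : ∀ {r s n : ℕ}, n + 1 = r + s → Fin r → (obj r →ₗ[F] obj s →ₗ[F] obj n)

namespace OperadData

variable {F : Type u} [CommRing F]

/-- The laws of a (unital, symmetric) operad in dg-modules. -/
structure IsOperad (P : OperadData.{u, v} F) : Prop where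
  rep_hom : ∀ {r : ℕ} (σ : Perm (Fin r)), DGModule.IsHom (P.rep σ)
  rep_one : ∀ {r : ℕ} (p : P.obj r), P.rep 1 p = p
  rep_mul : ∀ {r : ℕ} (σ τ : Perm (Fin r)) (p : P.obj r), P.rep (σ * τ) p = P.rep σ (P.rep τ p)
  one_mem : P.one ∈ (P.obj 1).gr 0
  d_one : (P.obj 1).d P.one = 0
  circ_mem : ∀ {r s n : ℕ} (h : n + 1 = r + s) (k : Fin r) (a b : ℤ) (p : P.obj r) (q : P.obj s),
    p ∈ (P.obj r).gr a → q ∈ (P.obj s).gr b → P.circ h k p q ∈ (P.obj n).gr (a + b)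
  d_circ : ∀ {r s n : ℕ} (h : n + 1 = r + s) (k : Fin r) (a : ℤ) (p : P.obj r) (q : P.obj s),
    p ∈ (P.obj r).gr a →
    (P.obj n).d (P.circ h k p q) =
      P.circ h k ((P.obj r).d p) q + a.negOnePow • P.circ h k p ((P.obj s).d q)
  circ_one : ∀ {r : ℕ} (k : Fin r) (p : P.obj r), P.circ (n := r) rfl k p P.one = p
  one_circ : ∀ {s : ℕ} (q : P.obj s), P.circ (n := s) (Nat.add_comm s 1) 0 P.one q = q
  circ_rep : ∀ {r s n : ℕ} (h : n + 1 = r + s) (k : Fin r) (σ : Perm (Fin r)) (τ : Perm (Fin s))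
    (p : P.obj r) (q : P.obj s),
    P.circ h k (P.rep σ p) (P.rep τ q) = P.rep (permCirc h k σ τ) (P.circ h (σ.symm k) p q)
  circ_circ : ∀ {r s t a b n : ℕ} (h₁ : a + 1 = r + s) (h₂ : n + 1 = a + t) (h₃ : b + 1 = s + t)
    (h₄ : n + 1 = r + b) (i : Fin r) (j : Fin s) (p : P.obj r) (q : P.obj s) (x : P.obj t),
    P.circ h₂ (inIdx h₁ i j) (P.circ h₁ i p q) x = P.circ h₄ i p (P.circ h₃ j q x)
  circ_comm : ∀ {r s t a b n : ℕ} (h₁ : a + 1 = r + s) (h₂ : n + 1 = a + t) (h₃ : b + 1 = r + t)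
    (h₄ : n + 1 = b + s) (i k : Fin r) (hik : i < k) (dq dx : ℤ) (p : P.obj r) (q : P.obj s)
    (x : P.obj t), q ∈ (P.obj s).gr dq → x ∈ (P.obj t).gr dx →
    P.circ h₂ (outIdx h₁ i ⟨k, hik.ne'⟩) (P.circ h₁ i p q) x =
      (dq * dx).negOnePow • P.circ h₄ (outIdx h₃ k ⟨i, hik.ne⟩) (P.circ h₃ k p x) q

/-- Morphisms of dg-operads. -/
structure IsOperadHom {P : OperadData.{u, v} F} {Q : OperadData.{u, w} F}
    (f : ∀ r : ℕ, P.obj r →ₗ[F] Q.obj r) : Prop where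
  hom : ∀ r : ℕ, DGModule.IsHom (f r)
  map_rep : ∀ {r : ℕ} (σ : Perm (Fin r)) (p : P.obj r), f r (P.rep σ p) = Q.rep σ (f r p)
  map_one : f 1 P.one = Q.one
  map_circ : ∀ {r s n : ℕ} (h : n + 1 = r + s) (k : Fin r) (p : P.obj r) (q : P.obj s),
    f n (P.circ h k p q) = Q.circ h k (f r p) (f s q)

/-- The composition product of a tensor product of operads,
`(e ⊗ p) ∘_k (e' ⊗ p') = (-1)^(|p| |e'|) (e ∘_k e') ⊗ (p ∘_k p')`. -/
def tensorCirc (Q : OperadData.{u, w} F) (P : OperadData.{u, v} F) {r s n : ℕ}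
    (h : n + 1 = r + s) (k : Fin r) :
    Q.obj r ⊗[F] P.obj r →ₗ[F] Q.obj s ⊗[F] P.obj s →ₗ[F] Q.obj n ⊗[F] P.obj n :=
  (TensorProduct.map₂ (Q.circ h k) (P.circ h k)).compl₂ ((Q.obj s).evenPart.rTensor (P.obj s)) +
    (TensorProduct.map₂ (Q.circ h k) (P.circ h k ∘ₗ (P.obj r).sgn)).compl₂
      ((Q.obj s).oddPart.rTensor (P.obj s))

theorem tensorCirc_tmul (Q : OperadData.{u, w} F) (P : OperadData.{u, v} F) {r s n : ℕ}
    (h : n + 1 = r + s) (k : Fin r) {a b : ℤ} (e : Q.obj r) (p : P.obj r) (e' : Q.obj s)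
    (p' : P.obj s) (hp : p ∈ (P.obj r).gr a) (he' : e' ∈ (Q.obj s).gr b) :
    tensorCirc Q P h k (e ⊗ₜ[F] p) (e' ⊗ₜ[F] p') =
      (a * b).negOnePow • (Q.circ h k e e' ⊗ₜ[F] P.circ h k p p') := by
  simp only [tensorCirc, LinearMap.add_apply, LinearMap.compl₂_apply, LinearMap.rTensor_tmul,
    TensorProduct.map₂_apply_tmul, DGModule.evenPart, DGModule.oddPart,
    DGModule.onComponents_of_mem _ _ he', LinearMap.comp_apply, DGModule.sgn_of_mem _ hp]
  by_cases hb : Even b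
  · simp [hb, Int.negOnePow_even _ (hb.mul_left a)]
  · have hb' := Int.not_even_iff_odd.1 hb
    by_cases ha : Even a
    · simp [hb, Int.negOnePow_even _ (ha.mul_right b), Int.negOnePow_even _ ha]
    · have ha' := Int.not_even_iff_odd.1 ha
      simp [hb, Int.negOnePow_odd _ (ha'.mul hb'), Int.negOnePow_odd _ ha',
        TensorProduct.tmul_neg]

/-- The arity-wise tensor product of operads, `(Q ⊗ P)(r) = Q(r) ⊗ P(r)`. -/
def tensor (Q : OperadData.{u, w} F) (P : OperadData.{u, v} F) : OperadData.{u, max v w} F where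
  obj r := (Q.obj r).tensor (P.obj r)
  rep σ := TensorProduct.map (Q.rep σ) (P.rep σ)
  one := Q.one ⊗ₜ[F] P.one
  circ h k := tensorCirc Q P h k

/-! ### Algebras over an operad -/

/-- Evaluation products `P(r) ⊗ A^{⊗ r} → A` (their laws are in `IsAlgebra`). -/
abbrev Action (P : OperadData.{u, v} F) (A : DGModule.{u, w} F) : Type (max v w) :=
  ∀ r : ℕ, P.obj r →ₗ[F] MultilinearMap F (fun _ : Fin r => A.carrier) A.carrier

/-- The laws of an algebra over an operad in dg-modules. -/
structure IsAlgebra {P : OperadData.{u, v} F} {A : DGModule.{u, w} F} (α : P.Action A) : Prop where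
  mem : ∀ {r : ℕ} (e : ℤ) (m : Fin r → ℤ) (p : P.obj r) (a : Fin r → A),
    p ∈ (P.obj r).gr e → (∀ i, a i ∈ A.gr (m i)) → α r p a ∈ A.gr (e + ∑ i, m i)
  d_apply : ∀ {r : ℕ} (e : ℤ) (m : Fin r → ℤ) (p : P.obj r) (a : Fin r → A),
    p ∈ (P.obj r).gr e → (∀ i, a i ∈ A.gr (m i)) →
    A.d (α r p a) = α r ((P.obj r).d p) a +
      ∑ i, (e + ∑ j with j < i, m j).negOnePow • α r p (Function.update a i (A.d (a i)))
  one_apply : ∀ a : Fin 1 → A, α 1 P.one a = a 0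
  rep_apply : ∀ {r : ℕ} (σ : Perm (Fin r)) (m : Fin r → ℤ) (p : P.obj r) (a : Fin r → A),
    (∀ i, a i ∈ A.gr (m i)) →
    α r (P.rep σ p) a =
      (∑ x : Fin r × Fin r with x.1 < x.2 ∧ σ x.2 < σ x.1, m (σ x.1) * m (σ x.2)).negOnePow •
        α r p (a ∘ σ)
  circ_apply : ∀ {r s n : ℕ} (h : n + 1 = r + s) (k : Fin r) (e : ℤ) (m : Fin n → ℤ)
    (p : P.obj r) (q : P.obj s) (a : Fin n → A),
    q ∈ (P.obj s).gr e → (∀ i, a i ∈ A.gr (m i)) →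
    α n (P.circ h k p q) a =
      (e * ∑ i : Fin n with i.val < k.val, m i).negOnePow •
        α r p fun j => if hj : j = k then α s q (fun i => a (inIdx h k i))
          else a (outIdx h k ⟨j, hj⟩)

/-- Morphisms of algebras over an operad. -/
structure IsAlgebraHom {P : OperadData.{u, v} F} {A : DGModule.{u, w} F}
    {B : DGModule.{u, w'} F} (α : P.Action A) (β : P.Action B) (f : A →ₗ[F] B) : Prop where
  hom : DGModule.IsHom f
  map_apply : ∀ {r : ℕ} (p : P.obj r) (a : Fin r → A), f (α r p a) = β r p fun i => f (a i)

end OperadData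

namespace OperadData

variable {F : Type u} [CommRing F]

/-- Restriction of structure through a morphism of operads. -/
def Action.restrict {P : OperadData.{u, v} F} {Q : OperadData.{u, w'} F} {A : DGModule.{u, w} F}
    (β : Q.Action A) (f : ∀ r : ℕ, P.obj r →ₗ[F] Q.obj r) : P.Action A :=
  fun r => β r ∘ₗ f r

/-- The product of two algebras: the operations are defined componentwise. -/
def Action.prod {P : OperadData.{u, v} F} {A : DGModule.{u, w} F} {B : DGModule.{u, w'} F}
    (α : P.Action A) (β : P.Action B) : P.Action (A.prod B) :=
  fun r =>
    { toFun := fun p =>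
        ((α r p).compLinearMap fun _ => LinearMap.fst F A.carrier B.carrier).prod
          ((β r p).compLinearMap fun _ => LinearMap.snd F A.carrier B.carrier)
      map_add' := fun p q => by ext a <;> simp <;> rfl
      map_smul' := fun c p => by ext a <;> simp <;> rfl }

/-- The defining formula for the action of `Q ⊗ P` on the tensor product `K ⊗ A` of a `Q`-algebra
`K` and a `P`-algebra `A`:
`(e ⊗ p)(k₁ ⊗ a₁, …, k_r ⊗ a_r) = ± e(k₁, …, k_r) ⊗ p(a₁, …, a_r)`
for homogeneous elements, where the sign is produced by the commutation of `p` with the `k_j` and of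
the `a_i` with the `k_j`, `i < j`. -/
def IsTensorAction {Q : OperadData.{u, w'} F} {P : OperadData.{u, v} F} {K : DGModule.{u, u} F}
    {A : DGModule.{u, w} F} (κ : Q.Action K) (α : P.Action A)
    (τ : (Q.tensor P).Action (K.tensor A)) : Prop :=
  ∀ (r : ℕ) (dp : ℤ) (m n : Fin r → ℤ) (e : Q.obj r) (p : P.obj r) (k : Fin r → K) (a : Fin r → A),
    p ∈ (P.obj r).gr dp → (∀ i, k i ∈ K.gr (m i)) → (∀ i, a i ∈ A.gr (n i)) →
    τ r (e ⊗ₜ[F] p) (fun i => k i ⊗ₜ[F] a i) =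
      (dp * ∑ i, m i + ∑ x : Fin r × Fin r with x.1 < x.2, n x.1 * m x.2).negOnePow •
        (κ r e k ⊗ₜ[F] α r p a)

/-- A path object of a `P`-algebra `A`: a `P`-algebra `B` together with morphisms of `P`-algebras
`s₀ : A → B` and `d₀, d₁ : B → A`, such that `s₀` is a weak equivalence,
`(d₀, d₁) : B → A × A` is a fibration and `d₀ s₀ = d₁ s₀ = 1`. -/
structure IsPathObject {P : OperadData.{u, v} F} {A : DGModule.{u, w} F} {B : DGModule.{u, w'} F}
    (α : P.Action A) (β : P.Action B) (s₀ : A →ₗ[F] B) (d₀ d₁ : B →ₗ[F] A) : Prop where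
  isAlgebra : IsAlgebra β
  s₀_hom : IsAlgebraHom α β s₀
  d₀_hom : IsAlgebraHom β α d₀
  d₁_hom : IsAlgebraHom β α d₁
  s₀_weakEquivalence : DGModule.IsWeakEquivalence s₀
  d₀d₁_hom : IsAlgebraHom β (α.prod α) (d₀.prod d₁)
  d₀d₁_fibration : DGModule.IsFibration (W := A.prod A) (d₀.prod d₁)
  d₀_s₀ : d₀ ∘ₗ s₀ = LinearMap.id
  d₁_s₀ : d₁ ∘ₗ s₀ = LinearMap.id

end OperadData

/-! ## The Barratt-Eccles operad -/

/-- The paths from `(0, 0)` to `(d, e)` in a `d × e` diagram, for sequences `(u₀, …, u_d)` and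
`(v₀, …, v_e)`: the list of the sequences of vertices `(u_x, v_y)` with the signature of the shuffle
which takes the horizontal segments to the first places. A vertical first segment has to be permuted
with all the horizontal segments. -/
def shuffles {α β : Type} : List α → List β → List (ℤ × List (α × β))
  | [], _ => []
  | _ :: _, [] => []
  | [a], [b] => [(1, [(a, b)])]
  | [a], b :: b' :: v => (shuffles [a] (b' :: v)).map fun t => (t.1, (a, b) :: t.2)
  | a :: a' :: u, [b] => (shuffles (a' :: u) [b]).map fun t => (t.1, (a, b) :: t.2)
  | a :: a' :: u, b :: b' :: v =>
    ((shuffles (a' :: u) (b :: b' :: v)).map fun t => (t.1, (a, b) :: t.2)) ++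
      ((shuffles (a :: a' :: u) (b' :: v)).map fun t =>
        ((-1) ^ (u.length + 1) * t.1, (a, b) :: t.2))
termination_by u v => u.length + v.length

/-- The action of a permutation, `σ ⬝ (w₀, …, w_d) = (σ w₀, …, σ w_d)`. -/
def barrattEcclesRep (F : Type u) [CommRing F] {r : ℕ} (σ : Perm (Fin r)) :
    (NDSeq (Perm (Fin r)) →₀ F) →ₗ[F] (NDSeq (Perm (Fin r)) →₀ F) :=
  Finsupp.linearCombination F fun w => normSeq F (w.1.map fun x => σ * x)

/-- The composition product `u ∘_k v = ∑ ± (u_{x₀} ∘_k v_{y₀}, …, u_{x_{d+e}} ∘_k v_{y_{d+e}})`, where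
the sum ranges over the paths in a `d × e` diagram. -/
def barrattEcclesCirc (F : Type u) [CommRing F] {r s n : ℕ} (h : n + 1 = r + s) (k : Fin r) :
    (NDSeq (Perm (Fin r)) →₀ F) →ₗ[F] (NDSeq (Perm (Fin s)) →₀ F) →ₗ[F]
      (NDSeq (Perm (Fin n)) →₀ F) :=
  Finsupp.linearCombination F fun u => Finsupp.linearCombination F fun v =>
    ((shuffles u.1 v.1).map fun t => t.1 • normSeq F (t.2.map fun y => permCirc h k y.1 y.2)).sum

/-- The Barratt-Eccles operad, formed by the normalized bar complexes of the symmetric groups. -/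
def barrattEccles (F : Type u) [CommRing F] : OperadData.{u, u} F where
  obj r := barComplex F (Perm (Fin r))
  rep σ := barrattEcclesRep F σ
  one := normSeq F [1]
  circ h k := barrattEcclesCirc F h k

/-- The augmentation `E ⊗ P → P`, `w ⊗ p ↦ ε(w) p`, where `ε` is the augmentation of the bar complex
(`ε = 1` on the simplices of dimension `0`, and `ε = 0` on the simplices of dimension `> 0`). -/
def augmentation {F : Type u} [CommRing F] (P : OperadData.{u, v} F) (r : ℕ) :
    ((barrattEccles F).tensor P).obj r →ₗ[F] P.obj r :=
  (TensorProduct.lid F (P.obj r)).toLinearMap ∘ₗ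
    (Finsupp.linearCombination F fun w : NDSeq (Perm (Fin r)) =>
      if w.1.length = 1 then (1 : F) else 0).rTensor (P.obj r)

/-! ## The normalized cochains of the standard simplices -/

section Cochains

variable (F : Type u) [CommRing F]

/-- The non-degenerate simplices of the standard simplex `Δ^n`: the simplex
`Δ(x₀, …, x_m)`, `x₀ < ⋯ < x_m`, is given by its set of vertices. -/
abbrev Face (n : ℕ) : Type := {S : Finset (Fin (n + 1)) // S.Nonempty}

/-- The evaluation of normalized cochains on the simplex with a given set of vertices. -/
def faceEval {n : ℕ} (S : Finset (Fin (n + 1))) : (Face n → F) →ₗ[F] F :=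
  if h : S.Nonempty then LinearMap.proj ⟨S, h⟩ else 0

/-- The evaluation of normalized cochains on the simplex `Δ(x₀, …, x_m)`,
`x₀ ≤ ⋯ ≤ x_m`, which vanishes if the simplex is degenerate. -/
def seqEval {n : ℕ} (l : List (Fin (n + 1))) : (Face n → F) →ₗ[F] F :=
  if l.Pairwise (· < ·) then faceEval F l.toFinset else 0

/-- The dimension of a simplex. -/
def faceDim {n : ℕ} (S : Face n) : ℤ := (S.1.card : ℤ) - 1

/-- The cochains of degree `i`. -/
def cochainGr (n : ℕ) (i : ℤ) : Submodule F (Face n → F) where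
  carrier := {f | ∀ S, faceDim S ≠ i → f S = 0}
  zero_mem' := fun _ _ => rfl
  add_mem' := fun hf hg S hS => by simp [hf S hS, hg S hS]
  smul_mem' := fun c f hf S hS => by simp [hf S hS]

/-- The differential of cochains `δ(f) = -(-1)^|f| f ∘ δ`. In the simplex with the set of vertices
`S`, the face which omits the vertex `x` has the sign `(-1)^i`, where `i` is the number of vertices
`y < x`. -/
def cochainD (n : ℕ) : (Face n → F) →ₗ[F] (Face n → F) :=
  LinearMap.pi fun S => (-1 : F) ^ (S.1.card + 1) •
    ∑ x ∈ S.1, (-1 : F) ^ (S.1.filter (· < x)).card • faceEval F (S.1.erase x)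

theorem faceEval_cochainD {n : ℕ} (S : Finset (Fin (n + 1))) (f : Face n → F) :
    faceEval F S (cochainD F n f) = (-1 : F) ^ (S.card + 1) *
      ∑ x ∈ S, (-1 : F) ^ (S.filter (· < x)).card * faceEval F (S.erase x) f := by
  by_cases h : S.Nonempty
  · rw [faceEval, dif_pos h]
    simp [cochainD]
  · rw [Finset.not_nonempty_iff_eq_empty] at h
    subst h
    simp [faceEval]

theorem cochainD_cochainD (n : ℕ) (f : Face n → F) : cochainD F n (cochainD F n f) = 0 := by
  funext S
  have h1 : ∀ g : Face n → F, g S = faceEval F S.1 g := fun g => by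
    simp [faceEval, S.2]
  rw [h1 (cochainD F n (cochainD F n f)), faceEval_cochainD]
  have h2 : ∑ x ∈ S.1, (-1 : F) ^ (S.1.filter (· < x)).card *
      faceEval F (S.1.erase x) (cochainD F n f) = 0 := by
    simp only [faceEval_cochainD, Finset.mul_sum]
    rw [Finset.sum_sigma']
    refine Finset.sum_involution (fun z _ => ⟨z.2, z.1⟩) ?_ ?_ ?_ ?_
    · rintro ⟨x, y⟩ hz
      simp only [Finset.mem_sigma, Finset.mem_erase] at hz
      obtain ⟨hx, hyx, hy⟩ := hz
      simp only [Finset.card_erase_of_mem hx, Finset.card_erase_of_mem hy,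
        Finset.erase_right_comm (a := y) (b := x)]
      have key : ∀ a ∈ S.1, ∀ b ∈ S.1, a < b →
          (-1 : F) ^ (S.1.filter (· < b)).card =
            -(-1 : F) ^ ((S.1.erase a).filter (· < b)).card ∧
          ((S.1.erase b).filter (· < a)).card = (S.1.filter (· < a)).card := by
        intro a ha b hb hab
        constructor
        · have : (S.1.filter (· < b)).card = ((S.1.erase a).filter (· < b)).card + 1 := by
            rw [Finset.filter_erase, Finset.card_erase_of_mem (by simp [ha, hab])]
            have : 0 < (S.1.filter (· < b)).card := Finset.card_pos.2 ⟨a, by simp [ha, hab]⟩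
            omega
          rw [this, pow_succ]; ring
        · rw [Finset.filter_erase, Finset.erase_eq_of_notMem]
          simp [hab.le]
      rcases lt_or_gt_of_ne hyx with h | h
      · obtain ⟨e1, e2⟩ := key y hy x hx h
        rw [e1, e2]; ring
      · obtain ⟨e1, e2⟩ := key x hx y hy h
        rw [e1, e2]; ring
    · rintro ⟨x, y⟩ hz _ he
      simp only [Finset.mem_sigma, Finset.mem_erase] at hz
      exact hz.2.1 (congrArg Sigma.fst he)
    · rintro ⟨x, y⟩ hz
      simp only [Finset.mem_sigma, Finset.mem_erase] at hz ⊢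
      exact ⟨hz.2.2, Ne.symm hz.2.1, hz.1⟩
    · rintro ⟨x, y⟩ _
      rfl
  rw [h2, mul_zero]
  rfl

theorem cochainGr_isInternal (n : ℕ) : DirectSum.IsInternal (cochainGr F n) := by
  classical
  have hs : ∀ f : Face n → F, f = ∑ S, Pi.single S (f S) := fun f =>
    (Finset.univ_sum_single f).symm
  refine isInternal_of_components _
    (∑ S : Face n, Finsupp.lsingle (faceDim S) ∘ₗ LinearMap.single F (fun _ => F) S ∘ₗ
      LinearMap.proj S) ?_ ?_
  · intro i f hf
    conv_rhs => rw [hs f, ← Finsupp.singleAddHom_apply, map_sum]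
    rw [LinearMap.sum_apply]
    refine Finset.sum_congr rfl fun S _ => ?_
    by_cases h : faceDim S = i
    · simp [h]
    · simp [hf S h]
  · intro f
    rw [hs f]
    refine Submodule.sum_mem _ fun S _ => Submodule.mem_iSup_of_mem (faceDim S) ?_
    intro T hT
    have : T ≠ S := fun e => hT (by rw [e])
    simp [this]

theorem cochainD_mem (n : ℕ) (i : ℤ) (f : Face n → F) (hf : f ∈ cochainGr F n i) :
    cochainD F n f ∈ cochainGr F n (i + 1) := by
  intro S hS
  have h1 : cochainD F n f S = faceEval F S.1 (cochainD F n f) := by simp [faceEval, S.2]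
  rw [h1, faceEval_cochainD]
  rw [Finset.sum_eq_zero, mul_zero]
  intro x hx
  by_cases h : (S.1.erase x).Nonempty
  · have h2 : faceDim (⟨S.1.erase x, h⟩ : Face n) ≠ i := by
      intro e
      apply hS
      rw [← e, faceDim, faceDim, Finset.card_erase_of_mem hx]
      have : 0 < S.1.card := Finset.card_pos.2 S.2
      omega
    simp [faceEval, h, hf _ h2]
  · simp [faceEval, h]

/-- The normalized cochain complex `N^*(Δ^n)`. -/
def cochains (n : ℕ) : DGModule.{u, u} F where
  carrier := Face n → F
  gr := cochainGr F n
  isInternal := cochainGr_isInternal F n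
  d := cochainD F n
  d_mem := cochainD_mem F n
  d_d := cochainD_cochainD F n

/-- The map `N^*(Δ^n) → N^*(Δ^m)` induced by a monotone map `[m] → [n]`. -/
def cochainMap {m n : ℕ} (θ : Fin (m + 1) →o Fin (n + 1)) : (Face n → F) →ₗ[F] (Face m → F) :=
  LinearMap.pi fun S : Face m =>
    open Classical in if Set.InjOn θ S.1 then faceEval F (S.1.image θ) else 0

/-! ### The table reduction morphism -/

/-- The surjections (as sequences of values) which arise from a simplex `(w₀, …, w_d)` by table
reduction, when the values in `used` have already been given their final occurrence. In each row
but the last one, we take the first terms `l₀, …, l_j` of the permutation which are not in `used`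
(for any `j ≥ 0`), and `l₀, …, l_{j-1}` cannot be repeated below; the last row consists of all the
remaining values. -/
def tableReduction {r : ℕ} : List (Fin r) → List (Perm (Fin r)) → List (List (Fin r))
  | _, [] => []
  | used, [w] => [(List.ofFn w).filter fun x => x ∉ used]
  | used, w :: w' :: ws =>
    let row := (List.ofFn w).filter fun x => x ∉ used
    (List.range row.length).flatMap fun j =>
      (tableReduction (used ++ row.take j) (w' :: ws)).map fun t => row.take (j + 1) ++ t

/-! ### The interval cut operations -/

open Classical in
/-- The cuts `0 = n₀ ≤ n₁ ≤ ⋯ ≤ n_L = m` of the interval `{0, …, m}`. -/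
def intervalCuts (L m : ℕ) : Finset (Fin (L + 1) → Fin (m + 1)) :=
  Finset.univ.filter fun c => Monotone c ∧ c 0 = 0 ∧ c (Fin.last L) = Fin.last m

variable {r L m : ℕ} (u : Fin L → Fin r) (c : Fin (L + 1) → Fin (m + 1))

/-- The interval with index `i` is inner if `u i` is a caesura of `u`, that is, if it is not the last
occurrence of a value. -/
def IsInner (i : Fin L) : Prop := ∃ j, i < j ∧ u j = u i

open Classical in
/-- The length of an interval of the cut. -/
def intervalLength (i : Fin L) : ℕ :=
  (c i.succ : ℕ) - (c i.castSucc : ℕ) + if IsInner u i then 1 else 0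

/-- The exponent of the permutation sign: the intervals, whose degrees are their lengths, are
permuted so that their labels are put in order. -/
def permutationExponent : ℕ :=
  ∑ x : Fin L × Fin L with x.1 < x.2 ∧ u x.2 < u x.1, intervalLength u c x.1 * intervalLength u c x.2

open Classical in
/-- The exponent of the position sign: an inner interval contributes its right end point. -/
def positionExponent : ℕ := ∑ i with IsInner u i, (c i.succ : ℕ)

/-- The sequence `C_(k)`, the concatenation of the intervals with the label `k`, in a simplex given by
its sequence of vertices. -/
def intervalCut {β : Type} (x : List β) (k : Fin r) : List β :=
  (List.finRange L).flatMap fun i =>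
    if u i = k then
      (x.drop (c i.castSucc)).take ((c i.succ : ℕ) + 1 - (c i.castSucc : ℕ))
    else []

/-- The exponent of the sign in the pairing of `f₁ ⊗ ⋯ ⊗ f_r` with a tensor
`x(C_(1)) ⊗ ⋯ ⊗ x(C_(r))`, which is produced by the commutation of the cochains with the
simplices. -/
def pairingExponent {β : Type} (x : List β) : ℕ :=
  ∑ y : Fin r × Fin r with y.1 < y.2,
    ((intervalCut u c x y.1).length - 1) * ((intervalCut u c x y.2).length - 1)

/-- The exponent of the sign produced by the commutation of an operation of degree `d` with the
cochains `f₁, …, f_r`. -/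
def operationExponent {β : Type} (d : ℕ) (x : List β) : ℕ :=
  d * ∑ k, ((intervalCut u c x k).length - 1)

/-- The dual of the interval cut operation `AW(u)`, for an operation of degree `d`:
the value of `(-1)^(d(|f₁| + ⋯ + |f_r|)) (f₁ ⊗ ⋯ ⊗ f_r)(AW(u)(x))` on the simplex `x` with the set of
vertices `S`, where `AW(u)(x) = ∑ ± x(C_(1)) ⊗ ⋯ ⊗ x(C_(r))`. -/
def intervalCutDual {n : ℕ} (d : ℕ) (S : Face n) :
    MultilinearMap F (fun _ : Fin r => Face n → F) F :=
  ∑ c ∈ intervalCuts L (S.1.card - 1),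
    (-1 : F) ^ (permutationExponent u c + positionExponent u c +
        pairingExponent u c (S.1.sort (· ≤ ·)) + operationExponent u c d (S.1.sort (· ≤ ·))) •
      (MultilinearMap.mkPiAlgebra F (Fin r) F).compLinearMap fun k =>
        seqEval F (intervalCut u c (S.1.sort (· ≤ ·)) k)

/-- The action of the Barratt-Eccles operad on `N^*(Δ^n)`: the dual of the operations
`w ↦ AW(TR(w))` on `N_*(Δ^n)`. -/
def cochainAction (n : ℕ) : (barrattEccles F).Action (cochains F n) := fun _ =>
  Finsupp.linearCombination F fun w => MultilinearMap.pi fun S =>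
    ((tableReduction [] w.1).map fun u => intervalCutDual F u.get (w.1.length - 1) S).sum

end Cochains

/-! ## The maps of the path object -/

section PathMaps

variable (F : Type u) [CommRing F] (A : DGModule.{u, w} F)

/-- The map `N^*(Δ^n) ⊗ A → N^*(Δ^m) ⊗ A` induced by a monotone map `[m] → [n]`. -/
def tensorCochainMap {m n : ℕ} (θ : Fin (m + 1) →o Fin (n + 1)) :
    (cochains F n).tensor A →ₗ[F] (cochains F m).tensor A :=
  (cochainMap F θ).rTensor A.carrier

instance : Unique (Face 0) where
  default := ⟨{0}, by simp⟩
  uniq := fun S => Subtype.ext (by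
    obtain ⟨x, hx⟩ := S.2
    ext y
    have hy : y = x := Subsingleton.elim (α := Fin 1) y x
    have h0 : x = 0 := Subsingleton.elim (α := Fin 1) x 0
    subst hy
    subst h0
    simpa using hx)

/-- The identification `N^*(Δ^0) ⊗ A = F ⊗ A = A`. -/
def pointEquiv : (cochains F 0).tensor A ≃ₗ[F] A :=
  (TensorProduct.congr
    (LinearEquiv.funUnique (Face 0) F F : (cochains F 0).carrier ≃ₗ[F] F)
    (LinearEquiv.refl F A.carrier)).trans (TensorProduct.lid F A.carrier)

/-- The map `s₀ : A = N^*(Δ^0) ⊗ A → N^*(Δ^1) ⊗ A`, induced by `[1] → [0]`. -/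
def pathS₀ : A →ₗ[F] (cochains F 1).tensor A :=
  tensorCochainMap F A (⟨fun _ => 0, monotone_const⟩ : Fin (1 + 1) →o Fin (0 + 1)) ∘ₗ
    (pointEquiv F A).symm.toLinearMap

/-- The maps `d_i : N^*(Δ^1) ⊗ A → N^*(Δ^0) ⊗ A = A`, induced by the map `[0] → [1]` which omits
the value `i`. -/
def pathD (i : Fin 2) : (cochains F 1).tensor A →ₗ[F] A :=
  (pointEquiv F A).toLinearMap ∘ₗ
    tensorCochainMap F A ((Fin.succAboveOrderEmb i).toOrderHom : Fin (0 + 1) →o Fin (1 + 1))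

end PathMaps

end

noncomputable section

open Equiv (Perm)

/-! ## Signs -/

/-! The theorem rests on a general calculus of Koszul signs and on an explicit description of the
Barratt-Eccles action on the cochains of the interval.

General part. The formula for `(e ⊗ p)(k₁ ⊗ a₁, …)` fixes an operation on homogeneous pure tensors,
which span, hence uniqueness. Existence for `N^*(Δ^n)` comes from its finite homogeneous basis
(`tensorAction`). If `K` and `A` are algebras, the algebra laws on `K ⊗ A` reduce to congruences
modulo 2 between exponents (`koszulExponent_perm`, `koszulExponent_circ`). Evaluation at a vertex
`x` is a character of `N^*(Δ^n)`: an operation `w` sends `f₁, …, f_r` to a cochain whose value at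
`x` is `ε(w) ∏ f_k(x)`. Therefore evaluation at a vertex turns the action of `E ⊗ P` into the action
of `P` through the augmentation, and the section `σ` makes the identification of `N^*(Δ^0) ⊗ A` with
`A` and the maps `d₀`, `d₁` into morphisms of `P`-algebras. The map `s₀` is a morphism by
naturality. The contraction of the interval on the vertex `0`, tensored with `A`, shows that `s₀` is
a weak equivalence, and the indicator cochains of the two vertices give the surjectivity of `(d₀,
d₁)`.

Interval part. It remains to see that the action dual to `AW(TR(w))` satisfies the laws of an
algebra on `N^*(Δ^1)`; the point follows because its cochains are a retract. Let `h` and `p` be the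
homotopy and the projection of the contraction: `hd + dh = p - 1` and `h² = hp = ph = 0`. For a
permutation `w`, the homotopies and projections in the separate variables, taken in the order of
`w`, assemble into the tensor product homotopy `H_w = ∑ p_{w(1)} ⋯ p_{w(i-1)} h_{w(i)}` on
multilinear forms, and into the total projection `P`, which does not depend on `w`. They satisfy `D
H_w + H_w D = P - 1`, `H_w² = 0` and `P H_w = H_w P = 0`. The key fact, `cochainAction_edgeFace`, is
that the value of `(w₀, …, w_d)` on the edge is, up to the sign `(-1)^((d+1) choose 2)`, the form
`H_{w₀} ⋯ H_{w_d}(∏ f_k(1))`, called `edgeForm`. Expanding this product gives exactly the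
surjections of the table reduction and the cuts of the edge (`sum_tableReduction`, `edgeCut_term`).

The laws become formal. Degenerate simplices act by zero because `H_w² = 0`. The relation of `D` and
`H_w` produces the alternate sum of faces (`totalD_edgeForm`). Equivariance is a relabelling of the
variables (`isPermutedForm_edgeForm`). The composition product follows from a recursive identity
between `H_{a ∘ b}`, `H_a` and `H_b` (`listH_listH_insertEdge`) which has the shape of the recursion
for shuffles (`shuffles_edgeForm`). -/

theorem negOnePow_congr {a b : ℤ} (c : ℤ) (h : a = b + 2 * c) : a.negOnePow = b.negOnePow := by
  rw [h, Int.negOnePow_add, Int.negOnePow_even _ (even_two_mul c), mul_one]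

theorem LinearMap.map_intUnits_smul {F : Type*} [CommRing F] {V W : Type*} [AddCommGroup V]
    [Module F V] [AddCommGroup W] [Module F W] (f : V →ₗ[F] W) (z : ℤˣ) (x : V) :
    f (z • x) = z • f x := by
  rcases Int.units_eq_one_or z with h | h <;> simp [h]

theorem MultilinearMap.map_update_intUnits_smul {F ι : Type*} [CommRing F] [DecidableEq ι]
    {V : Type*} {W : Type*} [AddCommGroup V] [Module F V]
    [AddCommGroup W] [Module F W] (f : MultilinearMap F (fun _ : ι => V) W) (x : ι → V) (i : ι)
    (z : ℤˣ) (y : V) :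
    f (Function.update x i (z • y)) = z • f (Function.update x i y) := by
  rcases Int.units_eq_one_or z with h | h <;> simp [h]

theorem tmul_intUnits_smul {F : Type*} [CommRing F] {V W : Type*} [AddCommGroup V]
    [Module F V] [AddCommGroup W] [Module F W] (z : ℤˣ) (x : V) (y : W) :
    x ⊗ₜ[F] (z • y) = z • (x ⊗ₜ[F] y) := by
  rcases Int.units_eq_one_or z with h | h <;> simp [h, TensorProduct.tmul_neg]

theorem Submodule.intUnits_smul_mem {F : Type*} [CommRing F] {V : Type*} [AddCommGroup V]
    [Module F V] (S : Submodule F V) (z : ℤˣ) {x : V} (hx : x ∈ S) : z • x ∈ S := by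
  rcases Int.units_eq_one_or z with h | h <;> simp [h, hx]

/-! ## Multilinear maps and spanning sets -/

section Span

variable {F ι V W : Type*} [CommRing F] [AddCommGroup V] [Module F V]
  [AddCommGroup W] [Module F W]

/-- A function of several variables which is linear in each of them. -/
structure IsMultilinear [DecidableEq ι] (f : (ι → V) → W) : Prop where
  add : ∀ (x : ι → V) (i : ι) (a b : V), f (Function.update x i (a + b)) =
    f (Function.update x i a) + f (Function.update x i b)
  smul : ∀ (x : ι → V) (i : ι) (c : F) (a : V), f (Function.update x i (c • a)) =
    c • f (Function.update x i a)

theorem MultilinearMap.isMultilinear [DecidableEq ι] (f : MultilinearMap F (fun _ : ι => V) W) :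
    IsMultilinear (F := F) f :=
  ⟨fun x i a b => f.map_update_add x i a b, fun x i c a => f.map_update_smul x i c a⟩

theorem IsMultilinear.sub [DecidableEq ι] {f g : (ι → V) → W} (hf : IsMultilinear (F := F) f)
    (hg : IsMultilinear (F := F) g) : IsMultilinear (F := F) fun x => f x - g x :=
  ⟨fun x i a b => by rw [hf.add, hg.add]; abel,
    fun x i c a => by rw [hf.smul, hg.smul, smul_sub]⟩

/-- Entries are decomposed one at a time: the induction is on the set `J` of the places where the
entry is only known to lie in the span, the entries at the other places being generators. -/
theorem IsMultilinear.mem_of_span [DecidableEq ι] [Fintype ι] {f : (ι → V) → W}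
    (hf : IsMultilinear (F := F) f) (s : ι → Set V) (T : Submodule F W)
    (h : ∀ x : ι → V, (∀ i, x i ∈ s i) → f x ∈ T) (x : ι → V)
    (hx : ∀ i, x i ∈ Submodule.span F (s i)) : f x ∈ T := by
  suffices H : ∀ (J : Finset ι) (x : ι → V), (∀ i ∈ J, x i ∈ Submodule.span F (s i)) →
      (∀ i ∉ J, x i ∈ s i) → f x ∈ T from
    H Finset.univ x (fun i _ => hx i) (fun i hi => absurd (Finset.mem_univ i) hi)
  intro J
  induction J using Finset.induction_on with
  | empty => exact fun x _ h2 => h x fun i => h2 i (Finset.notMem_empty i)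
  | insert j J hj ih =>
    intro x h1 h2
    have key : ∀ y ∈ Submodule.span F (s j), f (Function.update x j y) ∈ T := by
      intro y hy
      induction hy using Submodule.span_induction with
      | mem y hy =>
        refine ih _ (fun i hi => ?_) (fun i hi => ?_)
        · rw [Function.update_of_ne (by rintro rfl; exact hj hi)]
          exact h1 i (Finset.mem_insert_of_mem hi)
        · by_cases e : i = j
          · subst e; simpa using hy
          · rw [Function.update_of_ne e]
            exact h2 i (by simp [e, hi])
      | zero =>
        have := hf.smul x j 0 0
        rw [zero_smul, zero_smul] at this
        rw [this]; exact T.zero_mem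
      | add a b _ _ ha hb => rw [hf.add]; exact T.add_mem ha hb
      | smul c a _ ha => rw [hf.smul]; exact T.smul_mem c ha
    simpa using key (x j) (h1 j (Finset.mem_insert_self j J))

theorem IsMultilinear.eq_of_span [DecidableEq ι] [Fintype ι] {f g : (ι → V) → W}
    (hf : IsMultilinear (F := F) f) (hg : IsMultilinear (F := F) g) (s : ι → Set V)
    (h : ∀ x : ι → V, (∀ i, x i ∈ s i) → f x = g x) (x : ι → V)
    (hx : ∀ i, x i ∈ Submodule.span F (s i)) : f x = g x := by
  have := (hf.sub hg).mem_of_span s ⊥ (fun x hx => by simp [h x hx]) x hx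
  rwa [Submodule.mem_bot, sub_eq_zero] at this

theorem IsMultilinear.sum [DecidableEq ι] {κ : Type*} (J : Finset κ) {f : κ → (ι → V) → W}
    (hf : ∀ j, IsMultilinear (F := F) (f j)) : IsMultilinear (F := F) fun x => ∑ j ∈ J, f j x :=
  ⟨fun x i a b => by simp only [(hf _).add, Finset.sum_add_distrib],
    fun x i c a => by simp only [(hf _).smul, Finset.smul_sum]⟩

theorem IsMultilinear.add' [DecidableEq ι] {f g : (ι → V) → W} (hf : IsMultilinear (F := F) f)
    (hg : IsMultilinear (F := F) g) : IsMultilinear (F := F) fun x => f x + g x :=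
  ⟨fun x i a b => by rw [hf.add, hg.add]; abel,
    fun x i c a => by rw [hf.smul, hg.smul, smul_add]⟩

theorem IsMultilinear.linearMap_comp [DecidableEq ι] {W' : Type*} [AddCommGroup W'] [Module F W']
    {f : (ι → V) → W} (hf : IsMultilinear (F := F) f) (g : W →ₗ[F] W') :
    IsMultilinear (F := F) fun x => g (f x) :=
  ⟨fun x i a b => by rw [hf.add, map_add], fun x i c a => by rw [hf.smul, map_smul]⟩

theorem IsMultilinear.intUnits_smul [DecidableEq ι] (z : ℤˣ) {f : (ι → V) → W}
    (hf : IsMultilinear (F := F) f) : IsMultilinear (F := F) fun x => z • f x := by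
  rcases Int.units_eq_one_or z with h | h
  · simpa [h] using hf
  · exact ⟨fun x i a b => by simp [h, hf.add], fun x i c a => by simp [h, hf.smul]⟩

theorem IsMultilinear.comp_update [DecidableEq ι] {f : (ι → V) → W}
    (hf : IsMultilinear (F := F) f) (j : ι) (g : V →ₗ[F] V) :
    IsMultilinear (F := F) fun x => f (Function.update x j (g (x j))) := by
  have key : ∀ (x : ι → V) (i : ι) (y : V),
      Function.update (Function.update x i y) j (g (Function.update x i y j)) =
        if i = j then Function.update x j (g y) else
          Function.update (Function.update x j (g (x j))) i y := by
    intro x i y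
    split_ifs with h
    · subst h; simp
    · rw [Function.update_of_ne (Ne.symm h), Function.update_comm h]
  constructor
  · intro x i a b
    simp only [key]
    split_ifs
    · rw [map_add, hf.add]
    · rw [hf.add]
  · intro x i c a
    simp only [key]
    split_ifs
    · rw [map_smul, hf.smul]
    · rw [hf.smul]

theorem IsMultilinear.comp_linearMap [DecidableEq ι] {V' : Type*} [AddCommGroup V'] [Module F V']
    {f : (ι → V) → W} (hf : IsMultilinear (F := F) f) (g : ι → V' →ₗ[F] V) :
    IsMultilinear (F := F) fun x : ι → V' => f fun i => g i (x i) := by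
  have key : ∀ (x : ι → V') (i : ι) (y : V'), (fun l => g l (Function.update x i y l)) =
      Function.update (fun l => g l (x l)) i (g i y) := by
    intro x i y
    ext l
    by_cases h : l = i
    · subst h; simp
    · simp [h]
  exact ⟨fun x i a b => by simp only [key, map_add, hf.add],
    fun x i c a => by simp only [key, map_smul, hf.smul]⟩

theorem IsMultilinear.comp_perm [DecidableEq ι] {f : (ι → V) → W}
    (hf : IsMultilinear (F := F) f) (σ : Perm ι) :
    IsMultilinear (F := F) fun x : ι → V => f (x ∘ σ) := by
  have key : ∀ (x : ι → V) (i : ι) (y : V), Function.update x i y ∘ σ =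
      Function.update (x ∘ σ) (σ.symm i) y := by
    intro x i y
    rw [Function.update_comp_equiv]
  exact ⟨fun x i a b => by simp only [key, hf.add], fun x i c a => by simp only [key, hf.smul]⟩

/-- The multilinear map given by a multilinear function. -/
def IsMultilinear.toMultilinearMap [inst : DecidableEq ι] {f : (ι → V) → W}
    (hf : IsMultilinear (F := F) f) : MultilinearMap F (fun _ : ι => V) W where
  toFun := f
  map_update_add' := fun {inst'} x i a b => by
    obtain rfl : inst = inst' := Subsingleton.elim _ _
    exact hf.add x i a b
  map_update_smul' := fun {inst'} x i c a => by
    obtain rfl : inst = inst' := Subsingleton.elim _ _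
    exact hf.smul x i c a

end Span

/-- The composite of multilinear functions in the input `k` is multilinear. -/
theorem IsMultilinear.circ {F V W : Type*} [CommRing F] [AddCommGroup V] [Module F V]
    [AddCommGroup W] [Module F W] {r s n : ℕ}
    (h : n + 1 = r + s) (k : Fin r) {f : (Fin r → V) → W} {g : (Fin s → V) → V}
    (hf : IsMultilinear (F := F) f) (hg : IsMultilinear (F := F) g) :
    IsMultilinear (F := F) fun a : Fin n → V => f fun j =>
      if hj : j = k then g (fun i => a (inIdx h k i)) else a (outIdx h k ⟨j, hj⟩) := by
  have hb := (blocks_bijective h k).1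
  -- The inner and outer positions are disjoint and do not repeat, so that a change at an outer
  -- position affects a single input of `f`, and a change at an inner position (`key₂`) only affects
  -- the input `k`, through `g`.
  have key₁ : ∀ (a : Fin n → V) (i : {j : Fin r // j ≠ k}) (y : V),
      (fun j => if hj : j = k then g (fun l => Function.update a (outIdx h k i) y (inIdx h k l))
        else Function.update a (outIdx h k i) y (outIdx h k ⟨j, hj⟩)) =
      Function.update (fun j => if hj : j = k then g (fun l => a (inIdx h k l))
        else a (outIdx h k ⟨j, hj⟩)) i.1 y := by
    intro a i y
    ext j
    have h1 : ∀ l, inIdx h k l ≠ outIdx h k i := fun l e => by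
      have := @hb (Sum.inr l) (Sum.inl i) e
      simp at this
    by_cases hj : j = k
    · subst hj
      rw [Function.update_of_ne (Ne.symm i.2)]
      simp [h1]
    · simp only [hj, dite_false]
      by_cases e : j = i.1
      · subst e; simp
      · rw [Function.update_of_ne e, Function.update_of_ne]
        · simp [hj]
        · intro e'
          have := @hb (Sum.inl ⟨j, hj⟩) (Sum.inl i) e'
          simp at this
          exact e (by rw [← this])
  have key₂ : ∀ (a : Fin n → V) (i : Fin s) (y : V),
      (fun j => if hj : j = k then g (fun l => Function.update a (inIdx h k i) y (inIdx h k l))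
        else Function.update a (inIdx h k i) y (outIdx h k ⟨j, hj⟩)) =
      Function.update (fun j => if hj : j = k then g (fun l => a (inIdx h k l))
        else a (outIdx h k ⟨j, hj⟩)) k (g (Function.update (fun l => a (inIdx h k l)) i y)) := by
    intro a i y
    ext j
    by_cases hj : j = k
    · subst hj
      simp only [dite_true, Function.update_self]
      congr 1
      ext l
      by_cases e : l = i
      · subst e; simp
      · rw [Function.update_of_ne e, Function.update_of_ne]
        intro e'
        exact e (by simpa using @hb (Sum.inr l) (Sum.inr i) e')
    · rw [Function.update_of_ne hj]
      simp only [hj, dite_false]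
      rw [Function.update_of_ne]
      intro e'
      have := @hb (Sum.inl ⟨j, hj⟩) (Sum.inr i) e'
      simp at this
  constructor
  · intro a i x y
    obtain ⟨i | i, rfl⟩ := (blocks_bijective h k).2 i
    · simp only [Sum.elim_inl, key₁, hf.add]
    · simp only [Sum.elim_inr, key₂, hg.add, hf.add]
  · intro a i c x
    obtain ⟨i | i, rfl⟩ := (blocks_bijective h k).2 i
    · simp only [Sum.elim_inl, key₁, hf.smul]
    · simp only [Sum.elim_inr, key₂, hg.smul, hf.smul]

/-! ## Sums over the inputs of a composite operation -/

section BlockSums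

variable {r s n : ℕ} (h : n + 1 = r + s) (k : Fin r)

theorem inIdx_lt_inIdx (i j : Fin s) : inIdx h k i < inIdx h k j ↔ i < j := by
  rw [Fin.lt_def, Fin.lt_def]
  simp only [inIdx]
  omega

theorem outIdx_lt_outIdx (i j : {j : Fin r // j ≠ k}) :
    outIdx h k i < outIdx h k j ↔ i.1 < j.1 := by
  have h1 : (i.1 : ℕ) ≠ k := fun e => i.2 (Fin.ext e)
  have h2 : (j.1 : ℕ) ≠ k := fun e => j.2 (Fin.ext e)
  simp only [outIdx, Fin.lt_def]
  split_ifs <;> omega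

theorem outIdx_lt_inIdx (i : {j : Fin r // j ≠ k}) (j : Fin s) :
    outIdx h k i < inIdx h k j ↔ i.1 < k := by
  have h1 : (i.1 : ℕ) ≠ k := fun e => i.2 (Fin.ext e)
  simp only [outIdx, inIdx, Fin.lt_def]
  split_ifs <;> omega

theorem inIdx_lt_outIdx (i : {j : Fin r // j ≠ k}) (j : Fin s) :
    inIdx h k j < outIdx h k i ↔ k < i.1 := by
  have h1 : (i.1 : ℕ) ≠ k := fun e => i.2 (Fin.ext e)
  have := j.2
  simp only [outIdx, inIdx, Fin.lt_def]
  split_ifs <;> omega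

theorem outIdx_val_lt (i : {j : Fin r // j ≠ k}) : (outIdx h k i : ℕ) < k ↔ i.1 < k := by
  have h1 : (i.1 : ℕ) ≠ k := fun e => i.2 (Fin.ext e)
  simp only [outIdx, Fin.lt_def]
  split_ifs <;> omega

theorem inIdx_val_lt (i : Fin s) : ¬ (inIdx h k i : ℕ) < k := by
  simp [inIdx]

theorem sum_blocks {M : Type*} [AddCommMonoid M] (f : Fin n → M) :
    ∑ i, f i = ∑ j : {j : Fin r // j ≠ k}, f (outIdx h k j) + ∑ i : Fin s, f (inIdx h k i) := by
  rw [← (Equiv.ofBijective _ (blocks_bijective h k)).sum_comp, Fintype.sum_sum_type]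
  rfl

theorem sum_eq_add_sum_ne {M : Type*} [AddCommMonoid M] (f : Fin r → M) :
    ∑ i, f i = f k + ∑ j : {j : Fin r // j ≠ k}, f j := by
  rw [← Finset.add_sum_erase _ _ (Finset.mem_univ k)]
  congr 1
  exact Finset.sum_subtype _ (by simp) f

end BlockSums

/-- The exponent of the sign of the permutation of `p, k₁, a₁, …, k_r, a_r`. -/
def koszulExponent {r : ℕ} (dp : ℤ) (m n : Fin r → ℤ) : ℤ :=
  dp * ∑ i, m i + ∑ x : Fin r × Fin r with x.1 < x.2, n x.1 * m x.2

theorem sum_pairs {r : ℕ} (p : Fin r → Fin r → Prop) [∀ x y, Decidable (p x y)]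
    (f : Fin r → Fin r → ℤ) :
    ∑ x : Fin r × Fin r with p x.1 x.2, f x.1 x.2 = ∑ x, ∑ y, if p x y then f x y else 0 := by
  rw [Finset.sum_filter, Fintype.sum_prod_type]

/-- Raising the degree of `k_i` by one, as the differential does, adds its crossings with `p` and
with the `a_j`, `j < i`. -/
theorem koszulExponent_update_left {r : ℕ} (dp : ℤ) (m n : Fin r → ℤ) (i : Fin r) :
    koszulExponent dp (Function.update m i (m i + 1)) n =
      koszulExponent dp m n + dp + ∑ j with j < i, n j := by
  have hu : ∀ j, Function.update m i (m i + 1) j = m j + if j = i then 1 else 0 := by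
    intro j
    by_cases e : j = i
    · subst e; simp
    · simp [e]
  simp only [koszulExponent, Finset.sum_filter, Fintype.sum_prod_type, hu]
  have : ∀ x y : Fin r, (if x < y then n x * (m y + if y = i then 1 else 0) else 0) =
      (if x < y then n x * m y else 0) + if y = i then (if x < i then n x else 0) else 0 := by
    intro x y
    by_cases h1 : y = i
    · subst h1
      split_ifs <;> ring
    · simp [h1]
  simp only [this, Finset.sum_add_distrib, Finset.sum_ite_eq', Finset.mem_univ, if_true]
  ring

/-- Here the additional crossings are those of `a_i` with the `k_j`, `j > i`. -/
theorem koszulExponent_update_right {r : ℕ} (dp : ℤ) (m n : Fin r → ℤ) (i : Fin r) :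
    koszulExponent dp m (Function.update n i (n i + 1)) =
      koszulExponent dp m n + ∑ j with i < j, m j := by
  have hu : ∀ j, Function.update n i (n i + 1) j = n j + if j = i then 1 else 0 := by
    intro j
    by_cases e : j = i
    · subst e; simp
    · simp [e]
  simp only [koszulExponent, Finset.sum_filter, Fintype.sum_prod_type, hu]
  have : ∀ x y : Fin r, (if x < y then (n x + if x = i then 1 else 0) * m y else 0) =
      (if x < y then n x * m y else 0) + if x = i then (if i < y then m y else 0) else 0 := by
    intro x y
    by_cases h1 : x = i
    · subst h1
      split_ifs <;> ring
    · simp [h1]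
  simp only [this, Finset.sum_add_distrib]
  rw [Finset.sum_comm (f := fun x y => if x = i then (if i < y then m y else 0) else 0)]
  simp only [Finset.sum_ite_eq', Finset.mem_univ, if_true]
  ring

theorem sum_eq_sum_lt_add_sum_gt {r : ℕ} (m : Fin r → ℤ) (i : Fin r) :
    ∑ j, m j = ∑ j with j < i, m j + m i + ∑ j with i < j, m j := by
  have : ∀ j, m j = (if j < i then m j else 0) + (if j = i then m j else 0) +
      if i < j then m j else 0 := by
    intro j
    rcases lt_trichotomy j i with e | e | e
    · simp [e, e.ne, e.le]
    · simp [e]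
    · simp [e, e.ne', e.le]
  rw [Finset.sum_congr rfl fun j _ => this j]
  simp [Finset.sum_add_distrib, Finset.sum_filter]

/-- The parity of a rearrangement of graded symbols is the same whether the pairs `k_i ⊗ a_i` are
permuted before the `k`'s and the `a`'s are separated, or after. This is the sign identity for
equivariance. -/
theorem koszulExponent_perm {r : ℕ} (dp : ℤ) (m n : Fin r → ℤ) (σ : Perm (Fin r)) :
    ∃ c : ℤ, koszulExponent dp m n +
      (∑ x : Fin r × Fin r with x.1 < x.2 ∧ σ x.2 < σ x.1, m (σ x.1) * m (σ x.2) +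
        ∑ x : Fin r × Fin r with x.1 < x.2 ∧ σ x.2 < σ x.1, n (σ x.1) * n (σ x.2)) =
      ∑ x : Fin r × Fin r with x.1 < x.2 ∧ σ x.2 < σ x.1,
        (m (σ x.1) + n (σ x.1)) * (m (σ x.2) + n (σ x.2)) +
      koszulExponent dp (m ∘ σ) (n ∘ σ) + 2 * c := by
  -- By `h4`, the two Koszul exponents differ by the inversion sums of `m(σ x) n(σ y)` and of `n(σ
  -- x) m(σ y)`, with opposite signs. The product of the total degrees contains both with the sign
  -- `+`, so the second is off by twice its value.
  refine ⟨-∑ x : Fin r × Fin r with x.1 < x.2 ∧ σ x.2 < σ x.1, n (σ x.1) * m (σ x.2), ?_⟩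
  have h1 : ∑ i, m (σ i) = ∑ i, m i := Equiv.sum_comp σ m
  have h2 : ∑ x : Fin r × Fin r with x.1 < x.2, n x.1 * m x.2 =
      ∑ x, ∑ y, if σ x < σ y then n (σ x) * m (σ y) else 0 := by
    rw [sum_pairs (fun x y => x < y) (fun x y => n x * m y),
      ← Equiv.sum_comp σ]
    exact Finset.sum_congr rfl fun x _ => (Equiv.sum_comp σ _).symm
  have h3 : ∑ x : Fin r × Fin r with x.1 < x.2 ∧ σ x.2 < σ x.1, m (σ x.1) * n (σ x.2) =
      ∑ x, ∑ y, if y < x ∧ σ x < σ y then n (σ x) * m (σ y) else 0 := by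
    rw [sum_pairs (fun x y => x < y ∧ σ y < σ x) (fun x y => m (σ x) * n (σ y)), Finset.sum_comm]
    exact Finset.sum_congr rfl fun x _ => Finset.sum_congr rfl fun y _ => by
      rw [mul_comm]
  have h4 : (∑ x, ∑ y, if σ x < σ y then n (σ x) * m (σ y) else 0) +
      (∑ x, ∑ y, if x < y ∧ σ y < σ x then n (σ x) * m (σ y) else 0) =
      (∑ x, ∑ y, if x < y then n (σ x) * m (σ y) else 0) +
      ∑ x, ∑ y, if y < x ∧ σ x < σ y then n (σ x) * m (σ y) else 0 := by
    simp only [← Finset.sum_add_distrib]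
    refine Finset.sum_congr rfl fun x _ => Finset.sum_congr rfl fun y _ => ?_
    rcases lt_trichotomy x y with e | e | e
    · rcases lt_trichotomy (σ x) (σ y) with e' | e' | e'
      · simp [e, e', e.not_gt, e'.not_gt]
      · exact absurd (σ.injective e') e.ne
      · simp [e, e', e.not_gt, e'.not_gt]
    · simp [e]
    · rcases lt_trichotomy (σ x) (σ y) with e' | e' | e'
      · simp [e, e', e.not_gt, e'.not_gt]
      · exact absurd (σ.injective e') e.ne'
      · simp [e, e', e.not_gt, e'.not_gt]
  have h5 := sum_pairs (fun x y => x < y ∧ σ y < σ x) (fun x y => n (σ x) * m (σ y))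
  have h6 := sum_pairs (fun x y => x < y) (fun x y => n (σ x) * m (σ y))
  simp only [koszulExponent, Function.comp_apply, h1, add_mul, mul_add, Finset.sum_add_distrib]
  rw [h2, h3, h5, h6]
  linear_combination h4

/-- The same parity is computed by sorting all the symbols at once or by sorting the inserted block
first and then the outer inputs. This is the sign identity for composites. -/
theorem koszulExponent_circ {r s n : ℕ} (h : n + 1 = r + s) (k : Fin r) (dp dp' de' : ℤ)
    (m l : Fin n → ℤ) :
    ∃ c : ℤ, dp * de' + (koszulExponent (dp + dp') m l +
        (de' * ∑ i : Fin n with i.val < k.val, m i + dp' * ∑ i : Fin n with i.val < k.val, l i)) =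
      (de' + dp') * ∑ i : Fin n with i.val < k.val, (m i + l i) +
      (koszulExponent dp' (fun i => m (inIdx h k i)) (fun i => l (inIdx h k i)) +
        koszulExponent dp
          (fun j => if hj : j = k then de' + ∑ i, m (inIdx h k i) else m (outIdx h k ⟨j, hj⟩))
          (fun j => if hj : j = k then dp' + ∑ i, l (inIdx h k i) else l (outIdx h k ⟨j, hj⟩))) +
      2 * c := by
  have hlt : ∀ f : Fin n → ℤ, ∑ i : Fin n with i.val < k.val, f i =
      ∑ j : {j : Fin r // j ≠ k}, if j.1 < k then f (outIdx h k j) else 0 := by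
    intro f
    rw [Finset.sum_filter, sum_blocks h k]
    simp [outIdx_val_lt, inIdx_val_lt]
  have hne : ∀ (x : {j : Fin r // j ≠ k}), x.1 ≠ k := fun x => x.2
  have hout : ∀ f : Fin n → ℤ, ∑ j : {j : Fin r // j ≠ k}, f (outIdx h k j) =
      (∑ j : {j : Fin r // j ≠ k}, if j.1 < k then f (outIdx h k j) else 0) +
      ∑ j : {j : Fin r // j ≠ k}, if k < j.1 then f (outIdx h k j) else 0 := by
    intro f
    rw [← Finset.sum_add_distrib]
    refine Finset.sum_congr rfl fun x _ => ?_
    rcases lt_or_gt_of_ne (hne x) with e | e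
    · simp [e, e.le]
    · simp [e, e.le]
  -- The crossings of the inserted operation `e'` with the `a_i` placed before the block occur twice
  -- on the right: when the whole inserted operation moves to its place, and in the outer Koszul
  -- exponent, where `e'` contributes to the degree of the cochain in the place `k`.
  refine ⟨-(de' * ∑ j : {j : Fin r // j ≠ k}, if j.1 < k then l (outIdx h k j) else 0), ?_⟩
  simp only [koszulExponent, hlt]
  rw [sum_pairs (fun x y => x < y) (fun x y => l x * m y),
    sum_pairs (fun x y => x < y) (fun x y => l (inIdx h k x) * m (inIdx h k y)),
    sum_pairs (fun x y => x < y) (fun x y =>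
      (if hj : x = k then dp' + ∑ i, l (inIdx h k i) else l (outIdx h k ⟨x, hj⟩)) *
      (if hj : y = k then de' + ∑ i, m (inIdx h k i) else m (outIdx h k ⟨y, hj⟩)))]
  simp only [sum_blocks h k, sum_eq_add_sum_ne k, outIdx_lt_outIdx, outIdx_lt_inIdx,
    inIdx_lt_outIdx, inIdx_lt_inIdx, hne, dite_true, dite_false, lt_irrefl, if_false, zero_add,
    hout m]
  have e1 : ∀ (x : {j : Fin r // j ≠ k}) (c : ℤ), (∑ y : Fin s, if x.1 < k then
      c * m (inIdx h k y) else 0) = (if x.1 < k then c else 0) * ∑ y, m (inIdx h k y) := by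
    intro x c
    split_ifs <;> simp [Finset.mul_sum]
  have e2 : ∀ (c : ℤ), (∑ y : {j : Fin r // j ≠ k}, if k < y.1 then c * m (outIdx h k y) else 0) =
      c * ∑ y : {j : Fin r // j ≠ k}, if k < y.1 then m (outIdx h k y) else 0 := by
    intro c
    rw [Finset.mul_sum]
    exact Finset.sum_congr rfl fun y _ => by split_ifs <;> simp
  have e3 : ∀ (x : {j : Fin r // j ≠ k}) (c d : ℤ), (if x.1 < k then c * d else 0) =
      (if x.1 < k then c else 0) * d := by
    intro x c d
    split_ifs <;> simp
  simp only [e1, e2]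
  simp only [e3, ← Finset.sum_mul, Finset.sum_add_distrib]
  have e4 : ∀ (x : {j : Fin r // j ≠ k}), (if x.1 < k then m (outIdx h k x) + l
      (outIdx h k x) else 0)
      = (if x.1 < k then m (outIdx h k x) else 0) + if x.1 < k then l (outIdx h k x) else 0 := by
    intro x
    split_ifs <;> simp
  simp only [e4, Finset.sum_add_distrib]
  ring

theorem LinearMap.intUnits_smul_apply {F : Type*} [CommRing F] {V W : Type*}
    [AddCommGroup V] [Module F V] [AddCommGroup W] [Module F W]
    (f : V →ₗ[F] W) (z : ℤˣ) (x : V) : (z • f) x = z • f x := by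
  rcases Int.units_eq_one_or z with h | h <;> simp [h]

theorem MultilinearMap.intUnits_smul_apply {F ι : Type*} [CommRing F] {V W : Type*}
    [AddCommGroup V] [Module F V] [AddCommGroup W] [Module F W] (z : ℤˣ)
    (f : MultilinearMap F (fun _ : ι => V) W) (x : ι → V) : (z • f) x = z • f x := by
  rcases Int.units_eq_one_or z with h | h <;> simp [h]

/-! ## Tensor products of operads and of algebras

The arguments only use the following characterizations of tensor products. -/

namespace DGModule

variable {F : Type u} [CommRing F]

/-- The bilinear map `t` makes `T` into a tensor product of `V` and `W`. -/
structure IsTensor {V : DGModule.{u, v} F} {W : DGModule.{u, w} F} {T : DGModule.{u, w'} F}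
    (t : V →ₗ[F] W →ₗ[F] T) : Prop where
  gr_eq : ∀ n, T.gr n = Submodule.span F {x | ∃ (p q : ℤ) (a : V) (b : W),
    p + q = n ∧ a ∈ V.gr p ∧ b ∈ W.gr q ∧ x = t a b}
  d_apply : ∀ {p : ℤ} {a : V}, a ∈ V.gr p → ∀ b : W,
    T.d (t a b) = t (V.d a) b + p.negOnePow • t a (W.d b)

theorem isTensor_tensor (V : DGModule.{u, v} F) (W : DGModule.{u, w} F) :
    IsTensor (T := V.tensor W) (TensorProduct.mk F V.carrier W.carrier) where
  gr_eq _ := rfl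
  d_apply ha b := tensorD_tmul V W ha b

variable {V : DGModule.{u, v} F} {W : DGModule.{u, w} F} {T : DGModule.{u, w'} F}
  {t : V →ₗ[F] W →ₗ[F] T}

theorem IsTensor.apply_mem (ht : IsTensor t) {p q : ℤ} {a : V} {b : W} (ha : a ∈ V.gr p)
    (hb : b ∈ W.gr q) : t a b ∈ T.gr (p + q) := by
  rw [ht.gr_eq]
  exact Submodule.subset_span ⟨p, q, a, b, rfl, ha, hb, rfl⟩

theorem IsTensor.induction_gr (ht : IsTensor t) {n : ℤ} {C : ∀ x : T, x ∈ T.gr n → Prop}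
    (zero : C 0 (Submodule.zero_mem _))
    (add : ∀ x y hx hy, C x hx → C y hy → C (x + y) (Submodule.add_mem _ hx hy))
    (smul : ∀ (c : F) x hx, C x hx → C (c • x) (Submodule.smul_mem _ c hx))
    (apply : ∀ (p q : ℤ) (a : V) (b : W) (h : p + q = n) (ha : a ∈ V.gr p) (hb : b ∈ W.gr q),
      C (t a b) (h ▸ ht.apply_mem ha hb))
    {x : T} (hx : x ∈ T.gr n) : C x hx := by
  suffices h : ∀ x ∈ Submodule.span F {x | ∃ (p q : ℤ) (a : V) (b : W),
      p + q = n ∧ a ∈ V.gr p ∧ b ∈ W.gr q ∧ x = t a b}, ∃ hx, C x hx from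
    (h x (ht.gr_eq n ▸ hx)).2
  intro x hx
  induction hx using Submodule.span_induction with
  | zero => exact ⟨_, zero⟩
  | add x y _ _ h h' => exact ⟨_, add x y _ _ h.2 h'.2⟩
  | smul c x _ h => exact ⟨_, smul c x _ h.2⟩
  | mem x hx =>
    obtain ⟨p, q, a, b, h, ha, hb, rfl⟩ := hx
    exact ⟨_, apply p q a b h ha hb⟩

theorem IsTensor.induction (ht : IsTensor t) {C : T → Prop} (zero : C 0)
    (add : ∀ x y, C x → C y → C (x + y)) (smul : ∀ (c : F) x, C x → C (c • x))
    (apply : ∀ (p q : ℤ) (a : V) (b : W), a ∈ V.gr p → b ∈ W.gr q → C (t a b)) (x : T) : C x := by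
  induction T.mem_iSup x using Submodule.iSup_induction' with
  | zero => exact zero
  | add x y _ _ h h' => exact add x y h h'
  | mem n x hx =>
    exact ht.induction_gr (C := fun x _ => C x) zero (fun x y _ _ => add x y)
      (fun c x _ => smul c x) (fun p q a b _ => apply p q a b) hx

/-- Membership in a submodule of the values of a function which is linear in each variable can be
checked on homogeneous pure tensors. -/
theorem IsTensor.mem_of_pure (ht : IsTensor t) {X : Type*} [AddCommGroup X] [Module F X] {r : ℕ}
    {f : (Fin r → T) → X} (hf : IsMultilinear (F := F) f) (S : Submodule F X) (l : Fin r → ℤ)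
    (h : ∀ (m n : Fin r → ℤ) (a : Fin r → V) (b : Fin r → W), (∀ i, m i + n i = l i) →
      (∀ i, a i ∈ V.gr (m i)) → (∀ i, b i ∈ W.gr (n i)) → (f fun i => t (a i) (b i)) ∈ S)
    (x : Fin r → T) (hx : ∀ i, x i ∈ T.gr (l i)) : f x ∈ S := by
  simp only [ht.gr_eq] at hx
  refine hf.mem_of_span _ S (fun x hx => ?_) x hx
  choose m n a b hmn ha hb hx using hx
  obtain rfl : x = fun i => t (a i) (b i) := funext hx
  exact h m n a b hmn ha hb

/-- Functions which are linear in each variable agree if they agree on homogeneous pure tensors. -/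
theorem IsTensor.eq_of_pure_gr (ht : IsTensor t) {X : Type*} [AddCommGroup X] [Module F X] {r : ℕ}
    {f g : (Fin r → T) → X} (hf : IsMultilinear (F := F) f) (hg : IsMultilinear (F := F) g)
    (l : Fin r → ℤ)
    (h : ∀ (m n : Fin r → ℤ) (a : Fin r → V) (b : Fin r → W), (∀ i, m i + n i = l i) →
      (∀ i, a i ∈ V.gr (m i)) → (∀ i, b i ∈ W.gr (n i)) →
      f (fun i => t (a i) (b i)) = g fun i => t (a i) (b i))
    (x : Fin r → T) (hx : ∀ i, x i ∈ T.gr (l i)) : f x = g x := by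
  have := ht.mem_of_pure (hf.sub hg) ⊥ l (fun m n a b hmn ha hb => by
    rw [Submodule.mem_bot, h m n a b hmn ha hb, sub_self]) x hx
  rwa [Submodule.mem_bot, sub_eq_zero] at this

theorem IsTensor.eq_of_pure (ht : IsTensor t) {X : Type*} [AddCommGroup X] [Module F X] {r : ℕ}
    {f g : (Fin r → T) → X} (hf : IsMultilinear (F := F) f) (hg : IsMultilinear (F := F) g)
    (h : ∀ (m n : Fin r → ℤ) (a : Fin r → V) (b : Fin r → W),
      (∀ i, a i ∈ V.gr (m i)) → (∀ i, b i ∈ W.gr (n i)) →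
      f (fun i => t (a i) (b i)) = g fun i => t (a i) (b i)) (x : Fin r → T) : f x = g x := by
  refine hf.eq_of_span hg (fun _ => ⋃ n, (T.gr n : Set T)) (fun x hx => ?_) x fun i => ?_
  · choose l hl using fun i => Set.mem_iUnion.1 (hx i)
    exact ht.eq_of_pure_gr hf hg l (fun m n a b _ => h m n a b) x hl
  · rw [Submodule.span_iUnion]
    simp only [Submodule.span_eq]
    exact T.mem_iSup (x i)

theorem update_apply₂ (t : V →ₗ[F] W →ₗ[F] T) {r : ℕ} (a : Fin r → V) (b : Fin r → W) (i : Fin r)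
    (a' : V) (b' : W) :
    Function.update (fun j => t (a j) (b j)) i (t a' b') =
      fun j => t (Function.update a i a' j) (Function.update b i b' j) := by
  ext j
  by_cases h : j = i
  · subst h; simp
  · simp [h]

end DGModule

namespace OperadData

open DGModule

variable {F : Type u} [CommRing F]

universe v₁ v₂ v₃ w₁ w₂ w₃

/-- The bilinear maps `t r` make `R` into the arity-wise tensor product of `Q` and `P`. -/
structure IsTensor {Q : OperadData.{u, v₁} F} {P : OperadData.{u, v₂} F} {R : OperadData.{u, v₃} F}
    (t : ∀ r, Q.obj r →ₗ[F] P.obj r →ₗ[F] R.obj r) : Prop where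
  obj : ∀ r, DGModule.IsTensor (t r)
  rep : ∀ {r : ℕ} (σ : Perm (Fin r)) (e : Q.obj r) (p : P.obj r),
    R.rep σ (t r e p) = t r (Q.rep σ e) (P.rep σ p)
  one : R.one = t 1 Q.one P.one
  circ : ∀ {r s n : ℕ} (h : n + 1 = r + s) (k : Fin r) {a b : ℤ} (e : Q.obj r) {p : P.obj r}
    {e' : Q.obj s} (p' : P.obj s), p ∈ (P.obj r).gr a → e' ∈ (Q.obj s).gr b →
    R.circ h k (t r e p) (t s e' p') =
      (a * b).negOnePow • t n (Q.circ h k e e') (P.circ h k p p')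

theorem isTensor_tensor (Q : OperadData.{u, v₁} F) (P : OperadData.{u, v₂} F) :
    IsTensor (R := Q.tensor P) fun r => TensorProduct.mk F (Q.obj r).carrier (P.obj r).carrier where
  obj r := DGModule.isTensor_tensor (Q.obj r) (P.obj r)
  rep _ _ _ := rfl
  one := rfl
  circ h k _ _ e p e' p' hp he' := tensorCirc_tmul Q P h k e p e' p' hp he'

variable {Q : OperadData.{u, v₁} F} {P : OperadData.{u, v₂} F} {R : OperadData.{u, v₃} F}
  {K : DGModule.{u, w₁} F} {A : DGModule.{u, w₂} F} {B : DGModule.{u, w₃} F}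
  {κ : Q.Action K} {α : P.Action A} {τ : R.Action B}
  {t : ∀ r, Q.obj r →ₗ[F] P.obj r →ₗ[F] R.obj r} {t' : K →ₗ[F] A →ₗ[F] B}

/-- The defining formula for the action of a tensor product of operads on a tensor product of
dg-modules. -/
def IsTensorActionOf (t : ∀ r, Q.obj r →ₗ[F] P.obj r →ₗ[F] R.obj r) (t' : K →ₗ[F] A →ₗ[F] B)
    (κ : Q.Action K) (α : P.Action A) (τ : R.Action B) : Prop :=
  ∀ {r : ℕ} {dp : ℤ} {m n : Fin r → ℤ} (e : Q.obj r) {p : P.obj r} {k : Fin r → K}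
    {a : Fin r → A}, p ∈ (P.obj r).gr dp → (∀ i, k i ∈ K.gr (m i)) → (∀ i, a i ∈ A.gr (n i)) →
    τ r (t r e p) (fun i => t' (k i) (a i)) =
      (koszulExponent dp m n).negOnePow • t' (κ r e k) (α r p a)

theorem IsTensorActionOf.unique (ht : IsTensor t) (ht' : DGModule.IsTensor t')
    (hτ : IsTensorActionOf t t' κ α τ) {τ' : R.Action B} (hτ' : IsTensorActionOf t t' κ α τ') :
    τ' = τ := by
  funext r
  refine LinearMap.ext fun z => MultilinearMap.ext fun x => ?_
  induction z using (ht.obj r).induction with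
  | zero => rw [map_zero, map_zero]
  | add z z' h h' => rw [map_add, map_add, add_apply, add_apply, h, h']
  | smul c z h => rw [map_smul, map_smul, smul_apply, smul_apply, h]
  | apply de dp e p he hp =>
    refine ht'.eq_of_pure (τ' r _).isMultilinear (τ r _).isMultilinear ?_ x
    intro m n k a hk ha
    rw [hτ e hp hk ha, hτ' e hp hk ha]

theorem IsTensorActionOf.mem (ht : IsTensor t) (ht' : DGModule.IsTensor t') (hκ : IsAlgebra κ)
    (hα : IsAlgebra α) (hτ : IsTensorActionOf t t' κ α τ)
    {r : ℕ} (e : ℤ) (m : Fin r → ℤ) (z : R.obj r) (x : Fin r → B)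
    (hz : z ∈ (R.obj r).gr e) (hx : ∀ i, x i ∈ B.gr (m i)) :
    τ r z x ∈ B.gr (e + ∑ i, m i) := by
  induction hz using (ht.obj r).induction_gr with
  | zero => rw [map_zero]; exact Submodule.zero_mem _
  | add z z' _ _ h h' =>
    rw [map_add]; exact Submodule.add_mem _ h h'
  | smul c z _ h =>
    rw [map_smul]; exact Submodule.smul_mem _ _ h
  | apply de dp e p hde he hp =>
    subst hde
    refine ht'.mem_of_pure (τ r _).isMultilinear _ m ?_ x hx
    intro m₁ m₂ k a hm hk ha
    rw [hτ e hp hk ha]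
    refine Submodule.intUnits_smul_mem _ _ ?_
    have := ht'.apply_mem (hκ.mem de m₁ e k he hk) (hα.mem dp m₂ p a hp ha)
    have e1 : de + ∑ i, m₁ i + (dp + ∑ i, m₂ i) = de + dp + ∑ i, m i := by
      rw [← Finset.sum_congr rfl fun i _ => hm i, Finset.sum_add_distrib]; ring
    rwa [e1] at this

/-- On homogeneous pure tensors, both sides are sums of terms in which the differential meets `e`,
`p`, one `k_i` or one `a_i`; only their signs have to be compared. -/
theorem IsTensorActionOf.d_apply (ht : IsTensor t) (ht' : DGModule.IsTensor t') (hκ : IsAlgebra κ)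
    (hα : IsAlgebra α) (hτ : IsTensorActionOf t t' κ α τ)
    {r : ℕ} (e : ℤ) (m : Fin r → ℤ) (z : R.obj r) (x : Fin r → B)
    (hz : z ∈ (R.obj r).gr e) (hx : ∀ i, x i ∈ B.gr (m i)) :
    B.d (τ r z x) = τ r ((R.obj r).d z) x +
      ∑ i, (e + ∑ j with j < i, m j).negOnePow •
        τ r z (Function.update x i (B.d (x i))) := by
  induction hz using (ht.obj r).induction_gr with
  | zero => simp
  | add z z' _ _ h h' =>
    simp only [map_add, add_apply, smul_add, Finset.sum_add_distrib] at h h' ⊢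
    rw [h, h']; abel
  | smul c z _ h =>
    simp only [map_smul, smul_apply] at h ⊢
    rw [h, smul_add, Finset.smul_sum]
    congr 1
    exact Finset.sum_congr rfl fun i _ => smul_comm _ _ _
  | apply de dp e p hde he hp =>
    subst hde
    refine ht'.eq_of_pure_gr ((τ r _).isMultilinear.linearMap_comp B.d)
      ((τ r _).isMultilinear.add' (IsMultilinear.sum Finset.univ fun i =>
        ((τ r _).isMultilinear.comp_update i B.d).intUnits_smul _)) m ?_ x hx
    clear hx x
    intro m₁ m₂ k a hm hk ha
    have hu : ∀ (i : Fin r), (∀ j, Function.update k i (K.d (k i)) j ∈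
        K.gr (Function.update m₁ i (m₁ i + 1) j)) := by
      intro i j
      by_cases h : j = i
      · subst h; simpa using K.d_mem _ _ (hk j)
      · simpa [h] using hk j
    have hv : ∀ (i : Fin r), (∀ j, Function.update a i (A.d (a i)) j ∈
        A.gr (Function.update m₂ i (m₂ i + 1) j)) := by
      intro i j
      by_cases h : j = i
      · subst h; simpa using A.d_mem _ _ (ha j)
      · simpa [h] using ha j
    have h1 : (R.obj r).d (t r e p) =
        t r ((Q.obj r).d e) p + de.negOnePow • t r e ((P.obj r).d p) := (ht.obj r).d_apply he p
    have h2 : ∀ i, Function.update (fun i => t' (k i) (a i)) i (B.d (t' (k i) (a i))) =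
        Function.update (fun i => t' (k i) (a i)) i
          (t' (K.d (k i)) (a i) + (m₁ i).negOnePow • t' (k i) (A.d (a i))) := fun i => by
      rw [ht'.d_apply (hk i)]
    have h3 : ∀ i, τ r (t r e p) (Function.update (fun i => t' (k i) (a i)) i
        (B.d (t' (k i) (a i)))) =
        (koszulExponent dp (Function.update m₁ i (m₁ i + 1)) m₂).negOnePow •
          t' (κ r e (Function.update k i (K.d (k i)))) (α r p a) +
        (m₁ i).negOnePow • (koszulExponent dp m₁ (Function.update m₂ i (m₂ i + 1))).negOnePow •
          t' (κ r e k) (α r p (Function.update a i (A.d (a i)))) := by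
      intro i
      rw [h2]
      rw [(τ r (t r e p)).map_update_add, MultilinearMap.map_update_intUnits_smul]
      rw [update_apply₂, update_apply₂, Function.update_eq_self, Function.update_eq_self,
        hτ e hp (hu i) ha, hτ e hp hk (hv i)]
    simp only [h3, h1]
    rw [map_add (τ r), LinearMap.map_intUnits_smul (τ r)]
    rw [add_apply]
    rw [MultilinearMap.intUnits_smul_apply, hτ _ hp hk ha, hτ _ ((P.obj r).d_mem _ _ hp) hk ha,
        hτ _ hp hk ha,
      LinearMap.map_intUnits_smul, ht'.d_apply (hκ.mem de m₁ e k he hk),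
      hκ.d_apply de m₁ e k he hk, hα.d_apply dp m₂ p a hp ha]
    simp only [map_add, LinearMap.add_apply, map_sum,
      LinearMap.sum_apply, smul_add, Finset.smul_sum, LinearMap.intUnits_smul_apply,
          LinearMap.map_intUnits_smul,
      smul_smul, ← Int.negOnePow_add, Finset.sum_add_distrib]
    -- Signs of the terms where the differential meets `p` (`t1`), `k_i` (`t2`) and `a_i` (`t3`).
    have t1 : (koszulExponent dp m₁ m₂ + (de + ∑ i, m₁ i)).negOnePow =
        (de + koszulExponent (dp + 1) m₁ m₂).negOnePow := by
      congr 1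
      simp only [koszulExponent]; ring
    have t2 : ∀ i, (koszulExponent dp m₁ m₂ + (de + ∑ j with j < i, m₁ j)).negOnePow =
        (de + dp + ∑ j with j < i, m j +
          koszulExponent dp (Function.update m₁ i (m₁ i + 1)) m₂).negOnePow := by
      intro i
      simp only [koszulExponent_update_left, ← hm, Finset.sum_add_distrib]
      exact negOnePow_congr (-(dp + ∑ j with j < i, m₂ j)) (by ring)
    have t3 : ∀ i, (koszulExponent dp m₁ m₂ + (de + ∑ i, m₁ i + (dp + ∑ j with j < i,
        m₂ j))).negOnePow =
        (de + dp + ∑ j with j < i, m j + (m₁ i +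
          koszulExponent dp m₁ (Function.update m₂ i (m₂ i + 1)))).negOnePow := by
      intro i
      simp only [koszulExponent_update_right, ← hm, Finset.sum_add_distrib]
      rw [sum_eq_sum_lt_add_sum_gt m₁ i]
      congr 1
      ring
    simp only [← add_assoc] at t1 t2 t3 ⊢
    simp only [t1, t2, t3]
    abel

theorem IsTensorActionOf.rep_apply (ht : IsTensor t) (ht' : DGModule.IsTensor t')
    (hP : P.IsOperad) (hκ : IsAlgebra κ) (hα : IsAlgebra α)
    (hτ : IsTensorActionOf t t' κ α τ) {r : ℕ} (σ : Perm (Fin r)) (m : Fin r → ℤ)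
    (z : R.obj r) (x : Fin r → B) (hx : ∀ i, x i ∈ B.gr (m i)) :
    τ r (R.rep σ z) x =
      (∑ x : Fin r × Fin r with x.1 < x.2 ∧ σ x.2 < σ x.1, m (σ x.1) * m (σ x.2)).negOnePow •
        τ r z (x ∘ σ) := by
  induction z using (ht.obj r).induction with
  | zero => simp
  | add z z' h h' =>
    simp only [map_add, add_apply, smul_add] at h h' ⊢
    rw [h, h']
  | smul c z h =>
    simp only [map_smul, smul_apply] at h ⊢
    rw [h, smul_comm]
  | apply de dp e p he hp =>
    refine ht'.eq_of_pure_gr (τ r _).isMultilinear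
      (((τ r _).isMultilinear.comp_perm σ).intUnits_smul _) m ?_ x hx
    clear hx x
    intro m₁ m₂ k a hm hk ha
    have h1 : R.rep σ (t r e p) = t r (Q.rep σ e) (P.rep σ p) := ht.rep σ e p
    have h2 : (fun i => t' (k i) (a i)) ∘ σ = fun i => t' ((k ∘ σ) i) ((a ∘ σ) i) := rfl
    rw [h1, h2, hτ _ ((hP.rep_hom σ).map_mem _ _ hp) hk ha,
      hτ (m := m₁ ∘ σ) (n := m₂ ∘ σ) (k := k ∘ σ) (a := a ∘ σ) _ hp (fun i => hk _)
        (fun i => ha _),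
      hκ.rep_apply σ m₁ e k hk, hα.rep_apply σ m₂ p a ha]
    simp only [LinearMap.intUnits_smul_apply, LinearMap.map_intUnits_smul, smul_smul,
        ← Int.negOnePow_add, ← hm]
    obtain ⟨c, hc⟩ := koszulExponent_perm dp m₁ m₂ σ
    congr 1
    exact negOnePow_congr c (by linear_combination hc)

theorem IsTensorActionOf.circ_apply (ht : IsTensor t) (ht' : DGModule.IsTensor t')
    (hP : P.IsOperad) (hκ : IsAlgebra κ) (hα : IsAlgebra α)
    (hτ : IsTensorActionOf t t' κ α τ) {r s n : ℕ} (h : n + 1 = r + s) (k : Fin r) (e : ℤ)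
    (m : Fin n → ℤ) (z : R.obj r) (y : R.obj s) (x : Fin n → B)
    (hy : y ∈ (R.obj s).gr e) (hx : ∀ i, x i ∈ B.gr (m i)) :
    τ n (R.circ h k z y) x =
      (e * ∑ i : Fin n with i.val < k.val, m i).negOnePow •
        τ r z fun j => if hj : j = k then τ s y (fun i => x (inIdx h k i))
          else x (outIdx h k ⟨j, hj⟩) := by
  induction z using (ht.obj r).induction with
  | zero => simp
  | add z z' h h' =>
    simp only [map_add, LinearMap.add_apply, add_apply, smul_add] at h h' ⊢
    rw [h, h']
  | smul c z h =>
    simp only [map_smul, LinearMap.smul_apply, smul_apply] at h ⊢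
    rw [h, smul_comm]
  | apply de dp e₁ p₁ he₁ hp₁ =>
    -- The inserted operation only enters through the entry in the place `k`; written as an update,
    -- this gives the linearity in `y` that the induction on `y` uses.
    have hupd : ∀ y : R.obj s, (fun j => if hj : j = k then
          τ s y (fun i => x (inIdx h k i)) else x (outIdx h k ⟨j, hj⟩)) =
        Function.update (fun j => if hj : j = k then 0 else x (outIdx h k ⟨j, hj⟩)) k
          (τ s y (fun i => x (inIdx h k i))) := by
      intro y
      ext j
      by_cases hj : j = k
      · subst hj; simp
      · simp [hj]
    induction hy using (ht.obj s).induction_gr with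
    | zero =>
      rw [hupd, map_zero, map_zero, map_zero, zero_apply, zero_apply,
          MultilinearMap.map_update_zero,
        smul_zero]
    | add z z' _ _ h h' =>
      rw [hupd, map_add, map_add, map_add, add_apply, add_apply, MultilinearMap.map_update_add,
        smul_add, h, h', hupd, hupd]
    | smul c z _ h =>
      rw [hupd, map_smul, map_smul, map_smul, smul_apply, smul_apply,
        MultilinearMap.map_update_smul, smul_comm, h, hupd]
    | apply de' dp' e₂ p₂ hde he₂ hp₂ =>
      clear hupd
      subst hde
      refine ht'.eq_of_pure_gr (τ n _).isMultilinear
        (((τ r _).isMultilinear.circ h k (τ s _).isMultilinear).intUnits_smul _) m ?_ x hx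
      clear hx x
      intro m₁ m₂ b a hm hb ha
      have h1 : R.circ h k (t r e₁ p₁) (t s e₂ p₂) =
          (dp * de').negOnePow • (t n (Q.circ h k e₁ e₂) (P.circ h k p₁ p₂)) :=
        ht.circ h k e₁ p₂ hp₁ he₂
      have h2 : (fun j => if hj : j = k then t' (κ s e₂ fun i => b (inIdx h k i))
            (α s p₂ fun i => a (inIdx h k i)) else
            t' (b (outIdx h k ⟨j, hj⟩)) (a (outIdx h k ⟨j, hj⟩))) = fun j =>
          t' (if hj : j = k then κ s e₂ fun i => b (inIdx h k i) else b (outIdx h k ⟨j, hj⟩))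
          (if hj : j = k then α s p₂ fun i => a (inIdx h k i) else a (outIdx h k ⟨j, hj⟩)) := by
        ext j
        split_ifs <;> rfl
      have h3 : (fun j => if hj : j = k then
            τ s (t s e₂ p₂) (fun i => t' (b (inIdx h k i)) (a (inIdx h k i))) else
            t' (b (outIdx h k ⟨j, hj⟩)) (a (outIdx h k ⟨j, hj⟩))) =
          Function.update (fun j => if hj : j = k then t' (κ s e₂ fun i => b (inIdx h k i))
            (α s p₂ fun i => a (inIdx h k i)) else
            t' (b (outIdx h k ⟨j, hj⟩)) (a (outIdx h k ⟨j, hj⟩))) k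
          ((koszulExponent dp' (fun i => m₁ (inIdx h k i))
            (fun i => m₂ (inIdx h k i))).negOnePow •
            (t' (κ s e₂ fun i => b (inIdx h k i)) (α s p₂ fun i => a (inIdx h k i)))) := by
        ext j
        by_cases hj : j = k
        · subst hj
          simp only [dite_true, Function.update_self]
          rw [hτ _ hp₂ (fun i => hb _) (fun i => ha _)]
        · simp [hj]
      have h4 : ∀ j, (if hj : j = k then κ s e₂ fun i => b (inIdx h k i)
          else b (outIdx h k ⟨j, hj⟩)) ∈ K.gr (if hj : j = k then
            de' + ∑ i, m₁ (inIdx h k i) else m₁ (outIdx h k ⟨j, hj⟩)) := by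
        intro j
        split_ifs
        · exact hκ.mem de' _ e₂ _ he₂ fun i => hb _
        · exact hb _
      have h5 : ∀ j, (if hj : j = k then α s p₂ fun i => a (inIdx h k i)
          else a (outIdx h k ⟨j, hj⟩)) ∈ A.gr (if hj : j = k then
            dp' + ∑ i, m₂ (inIdx h k i) else m₂ (outIdx h k ⟨j, hj⟩)) := by
        intro j
        split_ifs
        · exact hα.mem dp' _ p₂ _ hp₂ fun i => ha _
        · exact ha _
      rw [h1, LinearMap.map_intUnits_smul (τ n), MultilinearMap.intUnits_smul_apply,
        hτ _ (hP.circ_mem h k _ _ _ _ hp₁ hp₂) hb ha,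
        hκ.circ_apply h k de' m₁ e₁ e₂ b he₂ hb, hα.circ_apply h k dp' m₂ p₁ p₂ a hp₂ ha]
      rw [h3, MultilinearMap.map_update_intUnits_smul]
      rw [Function.update_eq_self_iff.2 (by simp)]
      rw [h2, hτ _ hp₁ h4 h5]
      simp only [LinearMap.intUnits_smul_apply, LinearMap.map_intUnits_smul, smul_smul,
          ← Int.negOnePow_add, ← hm]
      obtain ⟨c, hc⟩ := koszulExponent_circ h k dp dp' de' m₁ m₂
      congr 1
      exact negOnePow_congr c (by linear_combination hc)

/-- The tensor product of a `Q`-algebra and of a `P`-algebra is a `Q ⊗ P`-algebra. -/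
theorem IsTensorActionOf.isAlgebra (ht : IsTensor t) (ht' : DGModule.IsTensor t')
    (hP : P.IsOperad) (hκ : IsAlgebra κ) (hα : IsAlgebra α)
    (hτ : IsTensorActionOf t t' κ α τ) : IsAlgebra τ where
  mem := hτ.mem ht ht' hκ hα
  d_apply := hτ.d_apply ht ht' hκ hα
  one_apply := by
    refine ht'.eq_of_pure (τ 1 _).isMultilinear
      ⟨fun x i a b => by simp [Subsingleton.elim i 0],
        fun x i c a => by simp [Subsingleton.elim i 0]⟩ ?_
    intro m n k a hk ha
    have h1 : R.one = t 1 Q.one P.one := ht.one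
    rw [h1, hτ _ hP.one_mem hk ha, hκ.one_apply, hα.one_apply]
    have h2 : koszulExponent 0 m n = 0 := by
      have : ∀ x : Fin 1 × Fin 1, ¬ x.1 < x.2 := fun x => by
        rw [Subsingleton.elim x.1 x.2]; exact lt_irrefl _
      simp [koszulExponent, this]
    rw [h2, Int.negOnePow_zero, one_smul]
  rep_apply := hτ.rep_apply ht ht' hP hκ hα
  circ_apply := hτ.circ_apply ht ht' hP hκ hα

theorem IsAlgebra.restrict {Q : OperadData.{u, w'} F} {P : OperadData.{u, v} F}
    {A : DGModule.{u, w} F} {α : Q.Action A} (hα : IsAlgebra α)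
    {f : ∀ r : ℕ, P.obj r →ₗ[F] Q.obj r} (hf : IsOperadHom f) : IsAlgebra (α.restrict f) where
  mem e m p a hp ha := hα.mem e m _ a ((hf.hom _).map_mem _ _ hp) ha
  d_apply e m p a hp ha := by
    have := hα.d_apply e m _ a ((hf.hom _).map_mem _ _ hp) ha
    rw [← (hf.hom _).map_d] at this
    exact this
  one_apply a := by
    have := hα.one_apply a
    rwa [← hf.map_one] at this
  rep_apply σ m p a ha := by
    have := hα.rep_apply σ m (f _ p) a ha
    rwa [← hf.map_rep] at this
  circ_apply h k e m p q a hq ha := by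
    have := hα.circ_apply h k e m (f _ p) _ a ((hf.hom _).map_mem _ _ hq) ha
    rwa [← hf.map_circ] at this

/-- A retract (in dg-modules) `A` of an algebra `B`, such that the inclusion of `A` in `B` commutes
with operations, is an algebra. -/
theorem IsAlgebraHom.isAlgebra_of_retract {P : OperadData.{u, v} F} {A : DGModule.{u, w} F}
    {B : DGModule.{u, w'} F} {α : P.Action A} {β : P.Action B} (hβ : IsAlgebra β)
    {f : A →ₗ[F] B} (hf : IsAlgebraHom α β f) {g : B →ₗ[F] A} (hg : IsHom g)
    (hgf : g ∘ₗ f = LinearMap.id) : IsAlgebra α := by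
  have hgf' : ∀ x, g (f x) = x := fun x => LinearMap.congr_fun hgf x
  -- Operations of `A` are computed in `B` and retracted by `g`, so each law for `α` is the image
  -- under `g` of the same law for `β`; `g` itself need not commute with operations.
  have hα : ∀ {r : ℕ} (p : P.obj r) (a : Fin r → A), α r p a = g (β r p fun i => f (a i)) :=
    fun p a => by rw [← hf.map_apply, hgf']
  have hm : ∀ {r : ℕ} {m : Fin r → ℤ} {a : Fin r → A}, (∀ i, a i ∈ A.gr (m i)) →
      ∀ i, f (a i) ∈ B.gr (m i) := fun ha i => hf.hom.map_mem _ _ (ha i)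
  refine ⟨?_, ?_, ?_, ?_, ?_⟩
  · intro r e m p a hp ha
    rw [hα]
    exact hg.map_mem _ _ (hβ.mem e m p _ hp (hm ha))
  · intro r e m p a hp ha
    rw [hα, ← hg.map_d, hβ.d_apply e m p _ hp (hm ha), map_add, ← hα, map_sum]
    congr 1
    refine Finset.sum_congr rfl fun i _ => ?_
    rw [LinearMap.map_intUnits_smul, hα]
    congr 3
    ext j
    by_cases h : j = i
    · subst h; simp [hf.hom.map_d]
    · simp [h]
  · intro a
    rw [hα, hβ.one_apply, hgf']
  · intro r σ m p a ha
    rw [hα, hβ.rep_apply σ m p _ (hm ha), LinearMap.map_intUnits_smul, hα]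
    rfl
  · intro r s n h k e m p q a hq ha
    rw [hα, hβ.circ_apply h k e m p q _ hq (hm ha), LinearMap.map_intUnits_smul, hα]
    congr 3
    ext j
    split_ifs
    · rw [hf.map_apply]
    · rfl

/-- Naturality of tensor products of algebras. -/
theorem IsTensorActionOf.map (ht : IsTensor t) (ht' : DGModule.IsTensor t')
    (hτ : IsTensorActionOf t t' κ α τ) {K₁ : DGModule.{u, w₁} F}
    {B₁ : DGModule.{u, w₃} F} {κ₁ : Q.Action K₁} {τ₁ : R.Action B₁} {t₁ : K₁ →ₗ[F] A →ₗ[F] B₁}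
    (ht₁ : DGModule.IsTensor t₁) (hτ₁ : IsTensorActionOf t t₁ κ₁ α τ₁) {f : K →ₗ[F] K₁}
    (hf : IsAlgebraHom κ κ₁ f) {g : B →ₗ[F] B₁} (hg : ∀ k a, g (t' k a) = t₁ (f k) a) :
    IsAlgebraHom τ τ₁ g where
  hom :=
    { map_mem := by
        intro n x hx
        induction hx using ht'.induction_gr with
        | zero => rw [map_zero]; exact Submodule.zero_mem _
        | add x y _ _ hx hy => rw [map_add]; exact Submodule.add_mem _ hx hy
        | smul r x _ hx => rw [map_smul]; exact Submodule.smul_mem _ _ hx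
        | apply p q a b h ha hb =>
          rw [hg, ← h]
          exact ht₁.apply_mem (hf.hom.map_mem _ _ ha) hb
      map_d := by
        intro x
        induction x using ht'.induction with
        | zero => simp
        | add x y hx hy => rw [map_add, map_add, hx, hy, map_add, map_add]
        | smul c x hx => rw [map_smul, map_smul, hx, map_smul, map_smul]
        | apply p q a b ha hb =>
          rw [ht'.d_apply ha, map_add, LinearMap.map_intUnits_smul, hg, hg, hg,
            ht₁.d_apply (hf.hom.map_mem _ _ ha), hf.hom.map_d] }
  map_apply := by
    intro r z x
    induction z using (ht.obj r).induction with
    | zero => simp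
    | add z z' h h' => rw [map_add, add_apply, map_add, h, h', map_add, add_apply]
    | smul c z h => rw [map_smul, smul_apply, map_smul, h, map_smul, smul_apply]
    | apply de dp e p he hp =>
      refine ht'.eq_of_pure ((τ r _).isMultilinear.linearMap_comp g)
        ((τ₁ r _).isMultilinear.comp_linearMap fun _ => g) ?_ x
      intro m n k a hk ha
      simp only [hg]
      rw [hτ e hp hk ha, hτ₁ e hp (fun i => hf.hom.map_mem _ _ (hk i)) ha,
        LinearMap.map_intUnits_smul, hg, hf.map_apply]

end OperadData

/-! ## Tensor products with cochain algebras -/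

namespace DGModule

variable {F : Type u} [CommRing F]

/-- The operator `x ↦ (-1)^(n|x|) x`. -/
def sgnPow (V : DGModule.{u, v} F) (n : ℤ) : V →ₗ[F] V := if Even n then LinearMap.id else V.sgn

theorem sgnPow_of_mem (V : DGModule.{u, v} F) (n : ℤ) {m : ℤ} {x : V} (hx : x ∈ V.gr m) :
    V.sgnPow n x = (m * n).negOnePow • x := by
  unfold sgnPow
  split_ifs with h
  · simp [Int.negOnePow_even _ (h.mul_left m)]
  · rw [sgn_of_mem V hx]
    congr 1
    obtain ⟨c, rfl⟩ := Int.not_even_iff_odd.1 h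
    exact negOnePow_congr (-(m * c)) (by ring)

end DGModule

theorem smul_intUnits_smul_comm {F V : Type*} [CommRing F] [AddCommGroup V] [Module F V] (c : F)
    (z : ℤˣ) (x : V) : c • z • x = z • c • x := by
  rcases Int.units_eq_one_or z with h | h <;> simp [h]

theorem Int.negOnePow_sum {ι : Type*} (J : Finset ι) (f : ι → ℤ) :
    (∑ i ∈ J, f i).negOnePow = ∏ i ∈ J, (f i).negOnePow := by
  classical
  induction J using Finset.induction_on with
  | empty => simp
  | insert i J h ih => rw [Finset.sum_insert h, Finset.prod_insert h, Int.negOnePow_add, ih]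

theorem MultilinearMap.map_intUnits_smul_univ {F V W ι : Type*} [CommRing F] [AddCommGroup V]
    [Module F V] [AddCommGroup W] [Module F W] [Fintype ι]
    (f : MultilinearMap F (fun _ : ι => V) W) (z : ι → ℤˣ) (x : ι → V) :
    (f fun i => z i • x i) = (∏ i, z i) • f x := by
  have h1 : (fun i => z i • x i) = fun i => (((z i : ℤ) : F)) • x i := by
    ext i
    rcases Int.units_eq_one_or (z i) with h | h <;> simp [h]
  have h2 : ((∏ i, z i : ℤˣ) • f x) = (∏ i, (((z i : ℤ) : F))) • f x := by
    rw [Units.smul_def, Units.coe_prod, ← Int.cast_smul_eq_zsmul F, Int.cast_prod]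
  rw [h1, f.map_smul_univ, h2]

theorem MultilinearMap.map_eq_sum_single {F W : Type*} [CommRing F] [AddCommGroup W] [Module F W]
    {B : Type*} [Fintype B] [DecidableEq B] {r : ℕ}
    (f : MultilinearMap F (fun _ : Fin r => B → F) W) (k : Fin r → B → F) :
    f k = ∑ S : Fin r → B, (∏ i, k i (S i)) • f fun i => Pi.single (S i) 1 := by
  have h1 : k = fun i => ∑ b, k i b • (Pi.single b 1 : B → F) := by
    ext i b
    simp [Pi.single_apply]
  conv_lhs => rw [h1]
  rw [f.map_sum]
  exact Finset.sum_congr rfl fun S _ => f.map_smul_univ _ _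

namespace OperadData

open DGModule

variable {F : Type u} [CommRing F] {Q : OperadData.{u, w'} F} {P : OperadData.{u, v} F}
  {A : DGModule.{u, w} F} {n : ℕ}

/-- The component of an element of `N^*(Δ^n) ⊗ A` on a simplex. -/
def faceComponent (A : DGModule.{u, w} F) (S : Face n) : (Face n → F) ⊗[F] A →ₗ[F] A :=
  (TensorProduct.lid F A.carrier).toLinearMap ∘ₗ (LinearMap.proj S).rTensor A.carrier

theorem faceComponent_tmul (S : Face n) (k : Face n → F) (a : A) :
    faceComponent A S (k ⊗ₜ[F] a) = k S • a := by
  simp [faceComponent]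

/-- The part of an operation of a tensor product which is given by its values on the simplices
`S`. -/
def tensorActionAux {r : ℕ} (κ : Q.obj r →ₗ[F] MultilinearMap F (fun _ : Fin r => Face n → F)
    (Face n → F))
    (α : P.Action A) (S : Fin r → Face n)
    (e : Q.obj r) (p : P.obj r) :
    MultilinearMap F (fun _ : Fin r => (Face n → F) ⊗[F] A) ((Face n → F) ⊗[F] A) :=
  (TensorProduct.mk F (Face n → F) A.carrier
    (κ e fun i => Pi.single (S i) 1)).compMultilinearMap
    ((α r ((P.obj r).sgnPow (∑ i, faceDim (S i)) p)).compLinearMap fun i =>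
      A.sgnPow (∑ j with i < j, faceDim (S j)) ∘ₗ faceComponent A (S i))

theorem tensorActionAux_apply {r : ℕ} (κ : Q.obj r →ₗ[F] MultilinearMap F
    (fun _ : Fin r => Face n → F) (Face n → F))
    (α : P.Action A)
    (S : Fin r → Face n) (e : Q.obj r) (p : P.obj r) (x : Fin r → (Face n → F) ⊗[F] A) :
    tensorActionAux κ α S e p x = (κ e fun i => Pi.single (S i) 1) ⊗ₜ[F]
      α r ((P.obj r).sgnPow (∑ i, faceDim (S i)) p) fun i =>
        A.sgnPow (∑ j with i < j, faceDim (S j)) (faceComponent A (S i) (x i)) := rfl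

theorem tensorActionAux_add_left {r : ℕ} (κ : Q.obj r →ₗ[F] MultilinearMap F
    (fun _ : Fin r => Face n → F) (Face n → F))
    (α : P.Action A)
    (S : Fin r → Face n) (e e' : Q.obj r) (p : P.obj r) :
    tensorActionAux κ α S (e + e') p = tensorActionAux κ α S e p + tensorActionAux κ α S e' p := by
  ext1 x
  rw [add_apply]
  simp only [tensorActionAux_apply, map_add, add_apply]
  exact TensorProduct.add_tmul _ _ _

theorem tensorActionAux_smul_left {r : ℕ} (κ : Q.obj r →ₗ[F] MultilinearMap F
    (fun _ : Fin r => Face n → F) (Face n → F))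
    (α : P.Action A)
    (S : Fin r → Face n) (c : F) (e : Q.obj r) (p : P.obj r) :
    tensorActionAux κ α S (c • e) p = c • tensorActionAux κ α S e p := by
  ext1 x
  rw [smul_apply]
  simp only [tensorActionAux_apply, map_smul, smul_apply]
  exact TensorProduct.smul_tmul' _ _ _

theorem tensorActionAux_add_right {r : ℕ} (κ : Q.obj r →ₗ[F] MultilinearMap F
    (fun _ : Fin r => Face n → F) (Face n → F))
    (α : P.Action A)
    (S : Fin r → Face n) (e : Q.obj r) (p p' : P.obj r) :
    tensorActionAux κ α S e (p + p') = tensorActionAux κ α S e p + tensorActionAux κ α S e p' := by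
  ext1 x
  rw [add_apply]
  simp only [tensorActionAux_apply, map_add]
  exact TensorProduct.tmul_add _ _ _

theorem tensorActionAux_smul_right {r : ℕ} (κ : Q.obj r →ₗ[F] MultilinearMap F
    (fun _ : Fin r => Face n → F) (Face n → F))
    (α : P.Action A)
    (S : Fin r → Face n) (c : F) (e : Q.obj r) (p : P.obj r) :
    tensorActionAux κ α S e (c • p) = c • tensorActionAux κ α S e p := by
  ext1 x
  rw [smul_apply]
  simp only [tensorActionAux_apply, map_smul, smul_apply]
  exact TensorProduct.tmul_smul _ _ _

/-- If the dimensions of the simplices `S i` are the degrees of the cochains, then the sign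
operators built into `tensorActionAux` produce the Koszul sign. Otherwise some `k i` vanishes on `S
i`, and both sides are zero. -/
theorem tensorActionAux_tmul {r : ℕ} (κ : Q.obj r →ₗ[F] MultilinearMap F
    (fun _ : Fin r => Face n → F) (Face n → F))
    (α : P.Action A) {dp : ℤ}
    {m l : Fin r → ℤ} (S : Fin r → Face n) (e : Q.obj r) {p : P.obj r} {k : Fin r → Face n → F}
    {a : Fin r → A} (hp : p ∈ (P.obj r).gr dp) (hk : ∀ i, k i ∈ cochainGr F n (m i))
    (ha : ∀ i, a i ∈ A.gr (l i)) :
    tensorActionAux κ α S e p (fun i => k i ⊗ₜ[F] a i) =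
      (koszulExponent dp m l).negOnePow • (((∏ i, k i (S i)) •
        (κ e fun i => Pi.single (S i) 1)) ⊗ₜ[F] α r p a) := by
  by_cases hS : ∀ i, faceDim (S i) = m i
  · rw [tensorActionAux_apply]
    simp only [hS, faceComponent_tmul, map_smul, sgnPow_of_mem _ _ hp, sgnPow_of_mem _ _ (ha _)]
    rw [MultilinearMap.map_smul_univ, MultilinearMap.map_intUnits_smul_univ,
      LinearMap.map_intUnits_smul, MultilinearMap.intUnits_smul_apply, TensorProduct.tmul_smul,
      tmul_intUnits_smul, tmul_intUnits_smul, smul_smul, ← Int.negOnePow_sum,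
      ← Int.negOnePow_add, smul_intUnits_smul_comm, TensorProduct.smul_tmul']
    congr 2
    rw [koszulExponent, add_comm, sum_pairs (fun x y => x < y) (fun x y => l x * m y)]
    simp only [Finset.mul_sum, Finset.sum_filter, mul_ite, mul_zero]
  · obtain ⟨i, hi⟩ := not_forall.1 hS
    have h0 : k i (S i) = 0 := hk i _ hi
    rw [tensorActionAux_apply, Finset.prod_eq_zero (Finset.mem_univ i) h0, zero_smul,
      TensorProduct.zero_tmul, smul_zero]
    rw [(α r _).map_coord_zero i, TensorProduct.tmul_zero]
    rw [faceComponent_tmul, h0, zero_smul, map_zero]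

/-- The action of `Q ⊗ P` on the tensor product of a cochain algebra and of a `P`-algebra. -/
def tensorAction (κ : Q.Action (cochains F n)) (α : P.Action A) :
    (Q.tensor P).Action ((cochains F n).tensor A) := fun r =>
  (TensorProduct.lift (∑ S : Fin r → Face n, LinearMap.mk₂ F (tensorActionAux (n := n) (κ r) α S)
    (tensorActionAux_add_left (n := n) (κ r) α S) (tensorActionAux_smul_left (n := n) (κ r) α S)
    (tensorActionAux_add_right (n := n) (κ r) α S) (tensorActionAux_smul_right (n := n)
        (κ r) α S)) :
    Q.obj r ⊗[F] P.obj r →ₗ[F]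
      MultilinearMap F (fun _ : Fin r => (Face n → F) ⊗[F] A) ((Face n → F) ⊗[F] A))

/-- The sum over all families of simplices reassembles `κ e k` from its expansion in the basis of
indicator cochains. -/
theorem isTensorAction_tensorAction (κ : Q.Action (cochains F n)) (α : P.Action A) :
    IsTensorAction κ α (tensorAction κ α) := by
  intro r dp m l e p k a hp hk ha
  have key : ∀ (κ' : Q.obj r →ₗ[F] MultilinearMap F (fun _ : Fin r => Face n → F) (Face n → F))
      (k : Fin r → Face n → F), (∀ i, k i ∈ cochainGr F n (m i)) →
      TensorProduct.lift (∑ S : Fin r → Face n, LinearMap.mk₂ F (tensorActionAux κ' α S)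
        (tensorActionAux_add_left κ' α S) (tensorActionAux_smul_left κ' α S)
        (tensorActionAux_add_right κ' α S) (tensorActionAux_smul_right κ' α S)) (e ⊗ₜ[F] p)
        (fun i => k i ⊗ₜ[F] a i) = (koszulExponent dp m l).negOnePow • (κ' e k ⊗ₜ[F] α r p a) := by
    intro κ' k hk
    classical
    rw [TensorProduct.lift.tmul, LinearMap.sum_apply, LinearMap.sum_apply, sum_apply]
    simp only [LinearMap.mk₂_apply]
    rw [Finset.sum_congr rfl fun S _ => tensorActionAux_tmul κ' α S e hp hk ha, ← Finset.smul_sum,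
      ← TensorProduct.sum_tmul, ← (κ' e).map_eq_sum_single k]
  exact key (κ r) k hk

theorem IsTensorAction.of {K : DGModule.{u, u} F} {κ : Q.Action K} {α : P.Action A}
    {τ : (Q.tensor P).Action (K.tensor A)} (hτ : IsTensorAction κ α τ) :
    IsTensorActionOf (fun r => TensorProduct.mk F (Q.obj r).carrier (P.obj r).carrier)
      (TensorProduct.mk F K.carrier A.carrier) κ α τ :=
  fun e _ _ _ hp hk ha => hτ _ _ _ _ e _ _ _ hp hk ha

end OperadData

/-! ## The cochains of the interval -/

section Interval

variable {F : Type u} [CommRing F]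

/-- The vertices of a simplex. -/
def vertexFace {n : ℕ} (x : Fin (n + 1)) : Face n := ⟨{x}, Finset.singleton_nonempty x⟩

/-- The simplex of dimension `1` of the interval. -/
def edgeFace : Face 1 := ⟨Finset.univ, Finset.univ_nonempty⟩

theorem face_interval_cases (S : Face 1) :
    S = vertexFace 0 ∨ S = vertexFace 1 ∨ S = edgeFace := by
  revert S
  decide

theorem vertexFace_zero_ne_one : (vertexFace 0 : Face 1) ≠ vertexFace 1 := by decide

theorem vertexFace_ne_edgeFace (x : Fin 2) : (vertexFace x : Face 1) ≠ edgeFace := by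
  revert x
  decide

theorem interval_ext {f g : Face 1 → F} (h₀ : f (vertexFace 0) = g (vertexFace 0))
    (h₁ : f (vertexFace 1) = g (vertexFace 1)) (h₂ : f edgeFace = g edgeFace) : f = g := by
  funext S
  rcases face_interval_cases S with rfl | rfl | rfl <;> assumption

variable (F)

/-- The dual of the homotopy on the chains of the interval, which takes the vertex `1` to the
edge. -/
def intervalH : Module.End F (Face 1 → F) :=
  LinearMap.single F (fun _ => F) (vertexFace 1) ∘ₗ LinearMap.proj edgeFace

/-- The dual of the projection of the interval on the vertex `0`. -/
def intervalP : Module.End F (Face 1 → F) :=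
  (LinearMap.single F (fun _ => F) (vertexFace 0) +
    LinearMap.single F (fun _ => F) (vertexFace 1)) ∘ₗ LinearMap.proj (vertexFace 0)

/-- The sign operator. -/
def intervalSgn : Module.End F (Face 1 → F) :=
  LinearMap.pi fun S => if S = edgeFace then -LinearMap.proj S else LinearMap.proj S

variable {F}

theorem intervalH_apply (f : Face 1 → F) :
    intervalH F f (vertexFace 0) = 0 ∧ intervalH F f (vertexFace 1) = f edgeFace ∧
      intervalH F f edgeFace = 0 := by
  simp [intervalH, vertexFace_zero_ne_one, (vertexFace_ne_edgeFace 1).symm]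

theorem intervalP_apply (f : Face 1 → F) :
    intervalP F f (vertexFace 0) = f (vertexFace 0) ∧
      intervalP F f (vertexFace 1) = f (vertexFace 0) ∧ intervalP F f edgeFace = 0 := by
  simp [intervalP, vertexFace_zero_ne_one, vertexFace_zero_ne_one.symm,
    (vertexFace_ne_edgeFace 0).symm, (vertexFace_ne_edgeFace 1).symm]

theorem intervalSgn_apply (f : Face 1 → F) :
    intervalSgn F f (vertexFace 0) = f (vertexFace 0) ∧
      intervalSgn F f (vertexFace 1) = f (vertexFace 1) ∧
      intervalSgn F f edgeFace = -f edgeFace := by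
  simp [intervalSgn, vertexFace_ne_edgeFace]

theorem cochainD_vertexFace {n : ℕ} (x : Fin (n + 1)) (f : Face n → F) :
    cochainD F n f (vertexFace x) = 0 := by
  simp [cochainD, vertexFace, faceEval]

/-- The edge has two vertices, hence the global sign `(-1)^(2+1) = -1`, and the face which omits the
vertex `0` is the vertex `1`. The sign convention of the differential thus reverses the usual
difference. -/
theorem cochainD_edgeFace (f : Face 1 → F) :
    cochainD F 1 f edgeFace = f (vertexFace 0) - f (vertexFace 1) := by
  have h0 : (Finset.univ.filter fun y : Fin 2 => y < 0) = ∅ := by decide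
  have h1 : (Finset.univ.filter fun y : Fin 2 => y < 1) = {0} := by decide
  have e0 : (Finset.univ.erase 0 : Finset (Fin 2)) = {1} := by decide
  have e1 : (Finset.univ.erase 1 : Finset (Fin 2)) = {0} := by decide
  have h2 : cochainD F 1 f edgeFace = faceEval F Finset.univ (cochainD F 1 f) := by
    simp [faceEval, edgeFace]
  rw [h2, faceEval_cochainD, Fin.sum_univ_two, h0, h1, e0, e1]
  simp [faceEval, vertexFace]
  ring

theorem intervalD_apply (f : Face 1 → F) :
    cochainD F 1 f (vertexFace 0) = 0 ∧ cochainD F 1 f (vertexFace 1) = 0 ∧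
      cochainD F 1 f edgeFace = f (vertexFace 0) - f (vertexFace 1) :=
  ⟨cochainD_vertexFace _ _, cochainD_vertexFace _ _, cochainD_edgeFace f⟩

theorem interval_end_ext {A B : Module.End F (Face 1 → F)}
    (h : ∀ f, A f (vertexFace 0) = B f (vertexFace 0) ∧ A f (vertexFace 1) = B f (vertexFace 1) ∧
      A f edgeFace = B f edgeFace) : A = B :=
  LinearMap.ext fun f => interval_ext (h f).1 (h f).2.1 (h f).2.2

theorem intervalSgn_sgn : intervalSgn F * intervalSgn F = 1 :=
  interval_end_ext fun f => by simp [intervalSgn_apply]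

theorem intervalH_sgn : intervalH F * intervalSgn F = -(intervalSgn F * intervalH F) :=
  interval_end_ext fun f => by simp [intervalSgn_apply, intervalH_apply]

theorem intervalD_sgn : cochainD F 1 * intervalSgn F = -(intervalSgn F * cochainD F 1) :=
  interval_end_ext fun f => by
    simp [intervalSgn_apply, intervalD_apply]

theorem intervalP_sgn : intervalP F * intervalSgn F = intervalSgn F * intervalP F :=
  interval_end_ext fun f => by simp [intervalSgn_apply, intervalP_apply]

/-- This relation, `intervalH_P` and `intervalP_H` are the side conditions of the contraction. All
the vanishing statements for the tensor product homotopies come from them. -/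
theorem intervalH_H : intervalH F * intervalH F = 0 :=
  interval_end_ext fun f => by simp [intervalH_apply]

theorem intervalH_P : intervalH F * intervalP F = 0 :=
  interval_end_ext fun f => by simp [intervalH_apply, intervalP_apply]

theorem intervalP_H : intervalP F * intervalH F = 0 :=
  interval_end_ext fun f => by simp [intervalH_apply, intervalP_apply]

theorem intervalP_P : intervalP F * intervalP F = intervalP F :=
  interval_end_ext fun f => by simp [intervalP_apply]

theorem intervalP_D : intervalP F * cochainD F 1 = 0 :=
  interval_end_ext fun f => by simp [intervalP_apply, intervalD_apply]

theorem intervalD_P : cochainD F 1 * intervalP F = 0 :=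
  interval_end_ext fun f => by simp [intervalP_apply, intervalD_apply]

/-- The interval contracts to the vertex `0`: at the vertex `1` the left side is `f(0) - f(1)`, and
on the edge it is `-f`. -/
theorem intervalD_H :
    intervalH F * cochainD F 1 + cochainD F 1 * intervalH F = intervalP F - 1 :=
  interval_end_ext fun f => by simp [intervalP_apply, intervalD_apply, intervalH_apply]

end Interval

/-! ## Operators on forms in several cochains of the interval -/

section Operators

variable (F : Type u) [CommRing F]

/-- Multilinear forms in `r` cochains of the interval. -/
abbrev IntervalForm (r : ℕ) : Type u := MultilinearMap F (fun _ : Fin r => Face 1 → F) F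

variable {F} {r : ℕ}

/-- The operator of an odd endomorphism in the variable `j`. -/
def oddOp (u : Module.End F (Face 1 → F)) (j : Fin r) : Module.End F (IntervalForm F r) :=
  MultilinearMap.compLinearMapₗ fun i => if i < j then intervalSgn F else if i = j then u else 1

/-- The operator of an even endomorphism in the variable `j`. -/
def evenOp (u : Module.End F (Face 1 → F)) (j : Fin r) : Module.End F (IntervalForm F r) :=
  MultilinearMap.compLinearMapₗ fun i => if i = j then u else 1

theorem oddOp_apply (u : Module.End F (Face 1 → F)) (j : Fin r) (G : IntervalForm F r)
    (f : Fin r → Face 1 → F) : oddOp u j G f =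
      G fun i => (if i < j then intervalSgn F else if i = j then u else 1) (f i) := rfl

theorem evenOp_apply (u : Module.End F (Face 1 → F)) (j : Fin r) (G : IntervalForm F r)
    (f : Fin r → Face 1 → F) : evenOp u j G f = G fun i => (if i = j then u else 1) (f i) := rfl

theorem IntervalForm.eq_neg (G : IntervalForm F r) {a b : Fin r → Face 1 → F} (i : Fin r)
    (hi : a i = -b i) (h : ∀ l, l ≠ i → a l = b l) : G a = -G b := by
  have : a = Function.update b i (-b i) := by
    ext1 l
    by_cases e : l = i
    · subst e; simp [hi]
    · simp [e, h l e]
  rw [this, G.map_update_neg, Function.update_eq_self]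

theorem IntervalForm.eq_zero (G : IntervalForm F r) {a : Fin r → Face 1 → F} (i : Fin r)
    (hi : a i = 0) : G a = 0 := G.map_coord_zero i hi

theorem sgn_sgn_apply (f : Face 1 → F) : intervalSgn F (intervalSgn F f) = f :=
  LinearMap.congr_fun intervalSgn_sgn f

/-- The two operators only interfere in the variable `i`, where the operator of the variable `j`
puts the sign operator; `u` anticommutes with it. -/
theorem oddOp_oddOp_of_lt {u v : Module.End F (Face 1 → F)}
    (hu : u * intervalSgn F = -(intervalSgn F * u)) {i j : Fin r} (hij : i < j) :
    oddOp u i * oddOp v j = (-1 : F) • (oddOp v j * oddOp u i) := by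
  refine LinearMap.ext fun G => MultilinearMap.ext fun f => ?_
  change G _ = (-1 : F) • G _
  rw [neg_one_smul]
  refine G.eq_neg i ?_ fun l hl => ?_
  · have := LinearMap.congr_fun hu (f i)
    simp only [Module.End.mul_apply, LinearMap.neg_apply] at this
    simp [hij, this]
  · rcases lt_or_gt_of_ne hl with h | h
    · simp [h, h.trans hij]
    · by_cases h2 : l < j
      · simp [h2, h.not_gt, h.ne']
      · simp [h2, h.not_gt, h.ne']

theorem oddOp_oddOp {u v : Module.End F (Face 1 → F)}
    (hu : u * intervalSgn F = -(intervalSgn F * u))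
    (hv : v * intervalSgn F = -(intervalSgn F * v)) {i j : Fin r} (hij : i ≠ j) :
    oddOp u i * oddOp v j = (-1 : F) • (oddOp v j * oddOp u i) := by
  rcases lt_or_gt_of_ne hij with h | h
  · exact oddOp_oddOp_of_lt hu h
  · rw [oddOp_oddOp_of_lt hv h, smul_smul, neg_one_mul, neg_neg, one_smul]

theorem evenOp_oddOp {u v : Module.End F (Face 1 → F)}
    (hu : u * intervalSgn F = intervalSgn F * u) {i j : Fin r} (hij : i ≠ j) :
    evenOp u i * oddOp v j = oddOp v j * evenOp u i := by
  refine LinearMap.ext fun G => MultilinearMap.ext fun f => ?_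
  change G _ = G _
  congr 1
  funext l
  by_cases h : l = i
  · subst h
    have := LinearMap.congr_fun hu (f l)
    simp only [Module.End.mul_apply] at this
    by_cases h2 : l < j
    · simp [h2, this]
    · simp [h2, hij]
  · simp [h]

theorem evenOp_evenOp (u v : Module.End F (Face 1 → F)) {i j : Fin r} (hij : i ≠ j) :
    evenOp u i * evenOp v j = evenOp v j * evenOp u i := by
  refine LinearMap.ext fun G => MultilinearMap.ext fun f => ?_
  change G _ = G _
  congr 1
  funext l
  by_cases h : l = i
  · subst h; simp [hij]
  · simp [h]

/-- The sign operators in the variables before `j` cancel in pairs. Forms are pulled back along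
endomorphisms, hence the reversed product `v * u`. -/
theorem oddOp_oddOp_self (u v : Module.End F (Face 1 → F)) (j : Fin r) :
    oddOp u j * oddOp v j = evenOp (v * u) j := by
  refine LinearMap.ext fun G => MultilinearMap.ext fun f => ?_
  change G _ = G _
  congr 1
  funext l
  by_cases h : l < j
  · simp [h, h.ne, sgn_sgn_apply]
  · by_cases h2 : l = j
    · simp [h2]
    · simp [h, h2]

theorem oddOp_evenOp_self (u v : Module.End F (Face 1 → F)) (j : Fin r) :
    oddOp u j * evenOp v j = oddOp (v * u) j := by
  refine LinearMap.ext fun G => MultilinearMap.ext fun f => ?_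
  change G _ = G _
  congr 1
  funext l
  by_cases h : l < j
  · simp [h, h.ne]
  · by_cases h2 : l = j
    · simp [h2]
    · simp [h, h2]

theorem evenOp_oddOp_self (u v : Module.End F (Face 1 → F)) (j : Fin r) :
    evenOp u j * oddOp v j = oddOp (v * u) j := by
  refine LinearMap.ext fun G => MultilinearMap.ext fun f => ?_
  change G _ = G _
  congr 1
  funext l
  by_cases h : l < j
  · simp [h, h.ne]
  · by_cases h2 : l = j
    · simp [h2]
    · simp [h2]

theorem evenOp_evenOp_self (u v : Module.End F (Face 1 → F)) (j : Fin r) :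
    evenOp u j * evenOp v j = evenOp (v * u) j := by
  refine LinearMap.ext fun G => MultilinearMap.ext fun f => ?_
  change G _ = G _
  congr 1
  funext l
  by_cases h2 : l = j
  · simp [h2]
  · simp [h2]

theorem oddOp_zero (j : Fin r) : oddOp (0 : Module.End F (Face 1 → F)) j = 0 :=
  LinearMap.ext fun G => MultilinearMap.ext fun f => G.eq_zero j (by simp)

theorem evenOp_zero (j : Fin r) : evenOp (0 : Module.End F (Face 1 → F)) j = 0 :=
  LinearMap.ext fun G => MultilinearMap.ext fun f => G.eq_zero j (by simp)

theorem evenOp_one (j : Fin r) : evenOp (1 : Module.End F (Face 1 → F)) j = 1 :=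
  LinearMap.ext fun G => MultilinearMap.ext fun f => by simp [evenOp_apply]

theorem evenOp_eq_update (u : Module.End F (Face 1 → F)) (j : Fin r) (G : IntervalForm F r)
    (f : Fin r → Face 1 → F) : evenOp u j G f = G (Function.update f j (u (f j))) := by
  rw [evenOp_apply]
  congr 1
  funext i
  by_cases h : i = j
  · subst h; simp
  · simp [h]

theorem evenOp_add (u v : Module.End F (Face 1 → F)) (j : Fin r) :
    evenOp (u + v) j = evenOp u j + evenOp v j :=
  LinearMap.ext fun G => MultilinearMap.ext fun f => by
    rw [LinearMap.add_apply, add_apply]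
    simp only [evenOp_eq_update, LinearMap.add_apply, G.map_update_add]

/-- The homotopy in the variable `j`. -/
def hOp (j : Fin r) : Module.End F (IntervalForm F r) := oddOp (intervalH F) j

/-- The projection in the variable `j`. -/
def pOp (j : Fin r) : Module.End F (IntervalForm F r) := evenOp (intervalP F) j

/-- The differential in the variable `j`. -/
def dOp (j : Fin r) : Module.End F (IntervalForm F r) := oddOp (cochainD F 1) j

theorem hOp_hOp {i j : Fin r} (h : i ≠ j) :
    (hOp i * hOp j : Module.End F (IntervalForm F r)) = (-1 : F) • (hOp j * hOp i) :=
  oddOp_oddOp intervalH_sgn intervalH_sgn h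

theorem pOp_hOp {i j : Fin r} (h : i ≠ j) :
    (pOp i * hOp j : Module.End F (IntervalForm F r)) = hOp j * pOp i :=
  evenOp_oddOp intervalP_sgn h

theorem pOp_pOp (i j : Fin r) :
    (pOp i * pOp j : Module.End F (IntervalForm F r)) = pOp j * pOp i := by
  by_cases h : i = j
  · rw [h]
  · exact evenOp_evenOp _ _ h

theorem hOp_self (j : Fin r) : (hOp j * hOp j : Module.End F (IntervalForm F r)) = 0 := by
  rw [hOp, oddOp_oddOp_self, intervalH_H, evenOp_zero]

theorem pOp_hOp_self (j : Fin r) : (pOp j * hOp j : Module.End F (IntervalForm F r)) = 0 := by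
  rw [hOp, pOp, evenOp_oddOp_self, intervalH_P, oddOp_zero]

theorem hOp_pOp_self (j : Fin r) : (hOp j * pOp j : Module.End F (IntervalForm F r)) = 0 := by
  rw [hOp, pOp, oddOp_evenOp_self, intervalP_H, oddOp_zero]

theorem pOp_self (j : Fin r) : (pOp j * pOp j : Module.End F (IntervalForm F r)) = pOp j := by
  rw [pOp, evenOp_evenOp_self, intervalP_P]

theorem dOp_pOp (i j : Fin r) :
    (dOp i * pOp j : Module.End F (IntervalForm F r)) = pOp j * dOp i := by
  by_cases h : i = j
  · subst h
    rw [dOp, pOp, oddOp_evenOp_self, evenOp_oddOp_self, intervalP_D, intervalD_P]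
  · exact (evenOp_oddOp intervalP_sgn (Ne.symm h)).symm

/-- The total differential. -/
def totalD : Module.End F (IntervalForm F r) := ∑ j, dOp j

theorem totalD_pOp (j : Fin r) :
    (totalD * pOp j : Module.End F (IntervalForm F r)) = pOp j * totalD := by
  simp only [totalD, Finset.sum_mul, Finset.mul_sum, dOp_pOp]

/-- The differentials in the other variables anticommute with the homotopy; the variable `j`
contributes the relation `intervalD_H`. -/
theorem totalD_hOp (j : Fin r) :
    (totalD * hOp j + hOp j * totalD + 1 : Module.End F (IntervalForm F r)) = pOp j := by
  have h : ∀ i ≠ j, (dOp i * hOp j + hOp j * dOp i : Module.End F (IntervalForm F r)) = 0 := by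
    intro i e
    have h0 : ∀ X : Module.End F (IntervalForm F r), (-1 : F) • X + X = 0 := fun X => by
      rw [show (-1 : F) • X + X = ((-1 : F) + 1) • X by rw [add_smul, one_smul], neg_add_cancel,
        zero_smul]
    rw [dOp, hOp, oddOp_oddOp intervalD_sgn intervalH_sgn e, h0]
  rw [totalD, Finset.sum_mul, Finset.mul_sum, ← Finset.sum_add_distrib,
    Finset.sum_eq_single j (fun i _ e => h i e) (fun e => absurd (Finset.mem_univ j) e), dOp, hOp,
    oddOp_oddOp_self, oddOp_oddOp_self, ← evenOp_add, intervalD_H, ← evenOp_one j, ← evenOp_add,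
    sub_add_cancel, pOp]

/-- The homotopy in the variables of a list, taken in the order of the list. -/
def listH : List (Fin r) → Module.End F (IntervalForm F r)
  | [] => 0
  | j :: l => hOp j + pOp j * listH l

/-- The projection in the variables of a list. -/
def listP : List (Fin r) → Module.End F (IntervalForm F r)
  | [] => 1
  | j :: l => pOp j * listP l

theorem listP_append (l l' : List (Fin r)) :
    (listP (l ++ l') : Module.End F (IntervalForm F r)) = listP l * listP l' := by
  induction l with
  | nil => simp [listP]
  | cons j l ih => simp [listP, ih, mul_assoc]

theorem listH_append (l l' : List (Fin r)) :
    (listH (l ++ l') : Module.End F (IntervalForm F r)) = listH l + listP l * listH l' := by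
  induction l with
  | nil => simp [listP, listH]
  | cons j l ih => simp [listP, listH, ih, mul_assoc, mul_add, add_assoc]

theorem pOp_listP (j : Fin r) (l : List (Fin r)) :
    (pOp j * listP l : Module.End F (IntervalForm F r)) = listP l * pOp j := by
  induction l with
  | nil => simp [listP]
  | cons i l ih => rw [listP, ← mul_assoc, pOp_pOp, mul_assoc, ih, mul_assoc]

theorem listP_comm (l l' : List (Fin r)) :
    (listP l * listP l' : Module.End F (IntervalForm F r)) = listP l' * listP l := by
  induction l with
  | nil => simp [listP]
  | cons j l ih => rw [listP, mul_assoc, ih, ← mul_assoc, pOp_listP, mul_assoc]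

theorem pOp_listP_of_mem {j : Fin r} {l : List (Fin r)} (h : j ∈ l) :
    (pOp j * listP l : Module.End F (IntervalForm F r)) = listP l := by
  induction l with
  | nil => simp at h
  | cons i l ih =>
    rw [listP]
    rcases List.mem_cons.1 h with rfl | h
    · rw [← mul_assoc, pOp_self]
    · rw [← mul_assoc, pOp_pOp, mul_assoc, ih h]

/-- The projections are commuting idempotents, so their product only depends on the set of
variables. In particular all permutations give the same projection. -/
theorem listP_eq_of_mem_iff {l l' : List (Fin r)} (h : ∀ j, j ∈ l ↔ j ∈ l') :
    (listP l : Module.End F (IntervalForm F r)) = listP l' := by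
  have key : ∀ l l' : List (Fin r), (∀ j ∈ l, j ∈ l') →
      (listP l * listP l' : Module.End F (IntervalForm F r)) = listP l' := by
    intro l l' hl
    induction l with
    | nil => simp [listP]
    | cons j l ih =>
      rw [listP, mul_assoc, ih fun i hi => hl i (List.mem_cons_of_mem _ hi),
        pOp_listP_of_mem (hl j List.mem_cons_self)]
  rw [← key l' l fun j => (h j).2, listP_comm, key l l' fun j => (h j).1]

theorem listP_self (l : List (Fin r)) :
    (listP l * listP l : Module.End F (IntervalForm F r)) = listP l := by
  induction l with
  | nil => simp [listP]
  | cons j l ih =>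
    rw [listP, mul_assoc, ← mul_assoc (listP l), ← pOp_listP, mul_assoc, ih, ← mul_assoc, pOp_self]

theorem pOp_listH {j : Fin r} {l : List (Fin r)} (h : j ∉ l) :
    (pOp j * listH l : Module.End F (IntervalForm F r)) = listH l * pOp j := by
  induction l with
  | nil => simp [listH]
  | cons i l ih =>
    rw [List.mem_cons, not_or] at h
    rw [listH, mul_add, add_mul, pOp_hOp h.1, ← mul_assoc, pOp_pOp, mul_assoc, ih h.2, mul_assoc]

theorem hOp_listP {j : Fin r} {l : List (Fin r)} (h : j ∉ l) :
    (hOp j * listP l : Module.End F (IntervalForm F r)) = listP l * hOp j := by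
  induction l with
  | nil => simp [listP]
  | cons i l ih =>
    rw [List.mem_cons, not_or] at h
    rw [listP, ← mul_assoc, ← pOp_hOp (Ne.symm h.1), mul_assoc, ih h.2, mul_assoc]

theorem hOp_listH {j : Fin r} {l : List (Fin r)} (h : j ∉ l) :
    (hOp j * listH l : Module.End F (IntervalForm F r)) = (-1 : F) • (listH l * hOp j) := by
  induction l with
  | nil => simp [listH]
  | cons i l ih =>
    rw [List.mem_cons, not_or] at h
    rw [listH, mul_add, add_mul, hOp_hOp h.1, ← mul_assoc, ← pOp_hOp (Ne.symm h.1), mul_assoc,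
      ih h.2, mul_smul_comm, smul_add, mul_assoc]

theorem pOp_mul_listH_of_cons (j : Fin r) (l : List (Fin r)) (hj : j ∉ l) :
    (pOp j * listH (j :: l) : Module.End F (IntervalForm F r)) = pOp j * listH l ∧
    (listH (j :: l) * pOp j : Module.End F (IntervalForm F r)) = pOp j * listH l := by
  constructor
  · rw [listH, mul_add, pOp_hOp_self, zero_add, ← mul_assoc, pOp_self]
  · rw [listH, add_mul, hOp_pOp_self, zero_add, mul_assoc, ← pOp_listH hj, ← mul_assoc, pOp_self]

/-- In the square of `h_j + p_j H`, the terms vanish by `h_j² = 0`, by `h_j p_j = 0`, by `p_j h_j =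
0` once `p_j` is moved across `H` (possible as `j` does not occur again), and by induction. -/
theorem listH_self {l : List (Fin r)} (hl : l.Nodup) :
    (listH l * listH l : Module.End F (IntervalForm F r)) = 0 := by
  induction l with
  | nil => simp [listH]
  | cons j l ih =>
    obtain ⟨hj, hl⟩ := List.nodup_cons.1 hl
    have h1 : (hOp j * (pOp j * listH l) : Module.End F (IntervalForm F r)) = 0 := by
      rw [← mul_assoc, hOp_pOp_self, zero_mul]
    have h2 : (pOp j * listH l * hOp j : Module.End F (IntervalForm F r)) = 0 := by
      rw [pOp_listH hj, mul_assoc, pOp_hOp_self, mul_zero]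
    have h3 : (pOp j * listH l * (pOp j * listH l) : Module.End F (IntervalForm F r)) = 0 := by
      rw [mul_assoc, pOp_listH hj, ← mul_assoc (listH l), ih hl, zero_mul, mul_zero]
    rw [listH, add_mul, mul_add, mul_add, hOp_self, h1, h2, h3]
    simp

theorem listP_listH {l : List (Fin r)} (hl : l.Nodup) :
    (listP l * listH l : Module.End F (IntervalForm F r)) = 0 := by
  induction l with
  | nil => simp [listH]
  | cons j l ih =>
    obtain ⟨hj, hl⟩ := List.nodup_cons.1 hl
    rw [listP, pOp_listP, mul_assoc, (pOp_mul_listH_of_cons j l hj).1, pOp_listH hj, ← mul_assoc,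
      ih hl, zero_mul]

theorem listH_listP {l : List (Fin r)} (hl : l.Nodup) :
    (listH l * listP l : Module.End F (IntervalForm F r)) = 0 := by
  induction l with
  | nil => simp [listH]
  | cons j l ih =>
    obtain ⟨hj, hl⟩ := List.nodup_cons.1 hl
    rw [listP, ← mul_assoc, (pOp_mul_listH_of_cons j l hj).2, mul_assoc, ih hl, mul_zero]

/-- The usual relation for the homotopy of a tensor product of contractions: for the list `j :: l`
one has `p_j - 1` from the first variable and `p_j (P - 1)` from the others, and the sum telescopes.
-/
theorem totalD_listH {l : List (Fin r)} (hl : l.Nodup) :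
    (totalD * listH l + listH l * totalD + 1 : Module.End F (IntervalForm F r)) = listP l := by
  induction l with
  | nil => simp [listH, listP]
  | cons j l ih =>
    obtain ⟨hj, hl⟩ := List.nodup_cons.1 hl
    have h1 : (totalD * listH (j :: l) + listH (j :: l) * totalD + 1 :
        Module.End F (IntervalForm F r)) = totalD * hOp j + hOp j * totalD + 1 +
        pOp j * (totalD * listH l + listH l * totalD) := by
      rw [listH, mul_add, add_mul, ← mul_assoc, totalD_pOp, mul_assoc, mul_assoc, mul_add]
      abel
    rw [h1, totalD_hOp, listP, ← ih hl, mul_add _ _ (1 : Module.End F (IntervalForm F r)), mul_one,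
      add_comm]

end Operators

/-! ### Forms on the edge associated to sequences of permutations -/

section IntervalOperations

variable {F : Type u} [CommRing F] {r : ℕ}

/-- The form `f₁, …, f_r ↦ ∏ f_k(x)`. -/
def vertexForm {n : ℕ} (x : Fin (n + 1)) : MultilinearMap F (fun _ : Fin r => Face n → F) F :=
  (MultilinearMap.mkPiAlgebra F (Fin r) F).compLinearMap fun _ => LinearMap.proj (vertexFace x)

theorem vertexForm_apply {n : ℕ} (x : Fin (n + 1)) (f : Fin r → Face n → F) :
    vertexForm x f = ∏ k, f k (vertexFace x) := by
  simp [vertexForm]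

/-- The value on the edge, up to a sign, of the operation associated to a sequence of
permutations. -/
def edgeForm : List (Perm (Fin r)) → IntervalForm F r
  | [] => vertexForm 1
  | w :: ws => listH (List.ofFn w) (edgeForm ws)

theorem nodup_ofFn_perm (w : Perm (Fin r)) : (List.ofFn w).Nodup :=
  List.nodup_ofFn_ofInjective w.injective

theorem mem_ofFn_perm (w : Perm (Fin r)) (j : Fin r) : j ∈ List.ofFn w := by
  rw [List.mem_ofFn]
  exact ⟨w.symm j, by simp⟩

theorem listP_ofFn_perm (w w' : Perm (Fin r)) :
    (listP (List.ofFn w) : Module.End F (IntervalForm F r)) = listP (List.ofFn w') :=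
  listP_eq_of_mem_iff fun j => by simp only [mem_ofFn_perm]

theorem listP_vertexForm (l : List (Fin r)) (f : Fin r → Face 1 → F) :
    listP l (vertexForm 1) f = ∏ k, if k ∈ l then f k (vertexFace 0) else f k (vertexFace 1) := by
  induction l generalizing f with
  | nil => simp [listP, vertexForm_apply]
  | cons j l ih =>
    rw [listP, Module.End.mul_apply, pOp, evenOp_eq_update, ih]
    refine Finset.prod_congr rfl fun i _ => ?_
    by_cases h : i = j
    · subst h
      simp [intervalP_apply]
    · simp [h]

theorem listP_ofFn_vertexForm (w : Perm (Fin r)) :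
    listP (List.ofFn w) (vertexForm 1 : IntervalForm F r) = vertexForm 0 :=
  MultilinearMap.ext fun f => by
    rw [listP_vertexForm, vertexForm_apply]
    exact Finset.prod_congr rfl fun k _ => if_pos (mem_ofFn_perm w k)

/-- The projection does not depend on the order of the variables, so `P H = 0` holds for a homotopy
and a projection taken in different orders. -/
theorem listP_listH_ofFn (w w' : Perm (Fin r)) (G : IntervalForm F r) :
    listP (List.ofFn w) (listH (List.ofFn w') G) = 0 := by
  rw [listP_ofFn_perm w w', ← Module.End.mul_apply, listP_listH (nodup_ofFn_perm w'),
    LinearMap.zero_apply]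

/-- The form at the vertex `0` is the projection of the form at the vertex `1`, and `H P = 0`. -/
theorem listH_vertexForm_zero (w : Perm (Fin r)) :
    listH (List.ofFn w) (vertexForm 0 : IntervalForm F r) = 0 := by
  rw [← listP_ofFn_vertexForm w, ← Module.End.mul_apply, listH_listP (nodup_ofFn_perm w),
    LinearMap.zero_apply]

/-- A repeated permutation creates a factor `H_w H_w = 0`; thus `edgeForm` is defined on the
normalized bar complex. -/
theorem edgeForm_of_not_isChain {ws : List (Perm (Fin r))} (h : ¬ ws.IsChain (· ≠ ·)) :
    (edgeForm ws : IntervalForm F r) = 0 := by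
  induction ws with
  | nil => exact absurd List.IsChain.nil h
  | cons w ws ih =>
    cases ws with
    | nil => exact absurd (List.IsChain.singleton w) h
    | cons w' ws =>
      by_cases e : w = w'
      · subst e
        rw [edgeForm, edgeForm, ← Module.End.mul_apply, listH_self (nodup_ofFn_perm w),
          LinearMap.zero_apply]
      · rw [edgeForm, ih fun h' => h (List.isChain_cons_cons.2 ⟨e, h'⟩), map_zero]

theorem totalD_vertexForm (x : Fin 2) : totalD (vertexForm x : IntervalForm F r) = 0 := by
  rw [totalD, LinearMap.sum_apply]
  refine Finset.sum_eq_zero fun j _ => MultilinearMap.ext fun f => ?_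
  rw [dOp, oddOp_apply, vertexForm_apply]
  refine Finset.prod_eq_zero (Finset.mem_univ j) ?_
  simp [cochainD_vertexFace]

/-- Apply `D H_w = P - 1 - H_w D` to the first factor. The term `-1` gives the face which omits `w`,
the term `H_w D` gives by induction the faces which keep `w`, and `P` kills `edgeForm ws` unless
`ws` is empty, when it moves the vertex `1` to the vertex `0`. -/
theorem totalD_edgeForm (ws : List (Perm (Fin r))) :
    totalD (edgeForm ws : IntervalForm F r) =
      (if ws.length = 1 then vertexForm 0 else 0) -
        Finsupp.linearCombination F edgeForm (seqFaces F ws) := by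
  induction ws with
  | nil => simp [edgeForm, totalD_vertexForm, seqFaces]
  | cons w ws ih =>
    have h1 : ∀ x : List (Perm (Fin r)) →₀ F,
        Finsupp.linearCombination F (edgeForm (F := F)) (Finsupp.mapDomain (List.cons w) x) =
          listH (List.ofFn w) (Finsupp.linearCombination F edgeForm x) := by
      intro x
      rw [Finsupp.linearCombination_mapDomain, Finsupp.apply_linearCombination]
      rfl
    have h2 := LinearMap.congr_fun (totalD_listH (F := F) (nodup_ofFn_perm w)) (edgeForm ws)
    simp only [LinearMap.add_apply, Module.End.mul_apply, Module.End.one_apply, ih, map_sub] at h2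
    have h3 : listH (List.ofFn w) (if ws.length = 1 then vertexForm 0 else 0 : IntervalForm F r) =
        0 := by
      split_ifs
      · exact listH_vertexForm_zero w
      · exact map_zero _
    have h4 : listP (List.ofFn w) (edgeForm ws : IntervalForm F r) =
        if ws.length + 1 = 1 then vertexForm 0 else 0 := by
      cases ws with
      | nil => simp [edgeForm, listP_ofFn_vertexForm]
      | cons w' ws => simp [edgeForm, listP_listH_ofFn]
    rw [h3, h4] at h2
    rw [seqFaces, map_sub, h1, edgeForm, Finsupp.linearCombination_single, one_smul,
      List.length_cons, ← h2]
    abel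

/-- A form is homogeneous of degree `D` if it vanishes on the cochains of total degree `≠ D`. -/
def IntervalForm.HasDegree (G : IntervalForm F r) (D : ℤ) : Prop :=
  ∀ (m : Fin r → ℤ) (f : Fin r → Face 1 → F), (∀ i, f i ∈ cochainGr F 1 (m i)) → ∑ i, m i ≠ D →
    G f = 0

theorem faceDim_vertexFace {n : ℕ} (x : Fin (n + 1)) : faceDim (vertexFace x) = 0 := by
  simp [faceDim, vertexFace]

theorem faceDim_edgeFace : faceDim edgeFace = 1 := by
  simp [faceDim, edgeFace]

theorem mem_cochainGr_interval {f : Face 1 → F} {m : ℤ} (h₀ : m ≠ 0 → f (vertexFace 0) = 0)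
    (h₁ : m ≠ 0 → f (vertexFace 1) = 0) (h₂ : m ≠ 1 → f edgeFace = 0) : f ∈ cochainGr F 1 m := by
  intro S hS
  rcases face_interval_cases S with rfl | rfl | rfl
  · exact h₀ fun e => hS (by rw [faceDim_vertexFace, e])
  · exact h₁ fun e => hS (by rw [faceDim_vertexFace, e])
  · exact h₂ fun e => hS (by rw [faceDim_edgeFace, e])

theorem apply_vertexFace_of_mem {n : ℕ} {f : Face n → F} {m : ℤ} (hf : f ∈ cochainGr F n m)
    (hm : m ≠ 0) (x : Fin (n + 1)) : f (vertexFace x) = 0 :=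
  hf _ (by rw [faceDim_vertexFace]; exact hm.symm)

theorem apply_edgeFace_of_mem {f : Face 1 → F} {m : ℤ} (hf : f ∈ cochainGr F 1 m)
    (hm : m ≠ 1) : f edgeFace = 0 :=
  hf _ (by rw [faceDim_edgeFace]; exact hm.symm)

theorem intervalH_mem {f : Face 1 → F} {m : ℤ} (hf : f ∈ cochainGr F 1 m) :
    intervalH F f ∈ cochainGr F 1 (m - 1) :=
  mem_cochainGr_interval (fun _ => (intervalH_apply f).1)
    (fun h => (intervalH_apply f).2.1.trans (apply_edgeFace_of_mem hf (by omega)))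
    (fun _ => (intervalH_apply f).2.2)

theorem intervalP_mem {f : Face 1 → F} {m : ℤ} (hf : f ∈ cochainGr F 1 m) :
    intervalP F f ∈ cochainGr F 1 m :=
  mem_cochainGr_interval (fun h => (intervalP_apply f).1.trans (apply_vertexFace_of_mem hf h 0))
    (fun h => (intervalP_apply f).2.1.trans (apply_vertexFace_of_mem hf h 0))
    (fun _ => (intervalP_apply f).2.2)

theorem intervalSgn_of_mem {f : Face 1 → F} {m : ℤ} (hf : f ∈ cochainGr F 1 m) :
    intervalSgn F f = m.negOnePow • f := by
  by_cases h : m = 1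
  · subst h
    have h0 := apply_vertexFace_of_mem hf one_ne_zero
    exact interval_ext (by simp [intervalSgn_apply, h0]) (by simp [intervalSgn_apply, h0])
      (by simp [intervalSgn_apply])
  · have h0 := apply_edgeFace_of_mem hf h
    by_cases h' : m = 0
    · subst h'
      exact interval_ext (by simp [intervalSgn_apply]) (by simp [intervalSgn_apply])
        (by simp [intervalSgn_apply, h0])
    · have h1 := apply_vertexFace_of_mem hf h'
      exact interval_ext (by rw [(intervalSgn_apply f).1, Pi.smul_apply, h1, smul_zero])
        (by rw [(intervalSgn_apply f).2.1, Pi.smul_apply, h1, smul_zero])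
        (by rw [(intervalSgn_apply f).2.2, Pi.smul_apply, h0, smul_zero, neg_zero])

/-- On homogeneous cochains, the sign operators in the variables before `j` amount to the Koszul
sign for crossing them. -/
theorem oddOp_apply_of_mem (u : Module.End F (Face 1 → F)) (j : Fin r) (G : IntervalForm F r)
    {m : Fin r → ℤ} {f : Fin r → Face 1 → F} (hf : ∀ i, f i ∈ cochainGr F 1 (m i)) :
    oddOp u j G f =
      (∑ i with i < j, m i).negOnePow • G (Function.update f j (u (f j))) := by
  have h1 : (fun i => (if i < j then intervalSgn F else if i = j then u else 1) (f i)) =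
      fun i => (if i < j then (m i).negOnePow else 1) • Function.update f j (u (f j)) i := by
    funext i
    by_cases h : i < j
    · simp [h, h.ne, intervalSgn_of_mem (hf i)]
    · by_cases h' : i = j
      · subst h'; simp
      · simp [h, h']
  rw [oddOp_apply, h1, G.map_intUnits_smul_univ, Finset.sum_filter, Int.negOnePow_sum]
  congr 1
  refine Finset.prod_congr rfl fun i _ => ?_
  split_ifs <;> simp

theorem IntervalForm.HasDegree.hOp {G : IntervalForm F r} {D : ℤ} (hG : G.HasDegree D)
    (j : Fin r) : IntervalForm.HasDegree (hOp j G) (D + 1) := by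
  intro m f hf hm
  rw [_root_.hOp, oddOp_apply_of_mem _ _ _ hf, hG (Function.update m j (m j - 1)), smul_zero]
  · intro i
    by_cases h : i = j
    · subst h; simpa using intervalH_mem (hf i)
    · simpa [h] using hf i
  · rw [Finset.sum_update_of_mem (Finset.mem_univ j), Finset.sdiff_singleton_eq_erase]
    have := Finset.add_sum_erase Finset.univ m (Finset.mem_univ j)
    intro e
    apply hm
    rw [← this]
    linarith

theorem IntervalForm.HasDegree.pOp {G : IntervalForm F r} {D : ℤ} (hG : G.HasDegree D)
    (j : Fin r) : IntervalForm.HasDegree (pOp j G) D := by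
  intro m f hf hm
  rw [_root_.pOp, evenOp_eq_update]
  refine hG m _ (fun i => ?_) hm
  by_cases h : i = j
  · subst h; simpa using intervalP_mem (hf i)
  · simpa [h] using hf i

theorem IntervalForm.HasDegree.listH {G : IntervalForm F r} {D : ℤ} (hG : G.HasDegree D)
    (l : List (Fin r)) : IntervalForm.HasDegree (listH l G) (D + 1) := by
  induction l with
  | nil => exact fun m f _ _ => rfl
  | cons j l ih =>
    intro m f hf hm
    have h1 := hG.hOp j m f hf hm
    have h2 := ih.pOp j m f hf hm
    rw [_root_.listH, LinearMap.add_apply, add_apply, h1, Module.End.mul_apply, h2, add_zero]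

theorem hasDegree_vertexForm (x : Fin 2) : 
    IntervalForm.HasDegree (vertexForm x : IntervalForm F r) 0 := by
  intro m f hf hm
  obtain ⟨i, -, hi⟩ := Finset.exists_ne_zero_of_sum_ne_zero hm
  rw [vertexForm_apply]
  exact Finset.prod_eq_zero (Finset.mem_univ i) (apply_vertexFace_of_mem (hf i) hi x)

/-- Each factor `H_w` lowers by one the degree of one input, hence raises by one the total degree
that the form requires. This gives the homogeneity of the operations, and the vanishing of non-empty
edge forms on cochains of degree `0`. -/
theorem hasDegree_edgeForm (ws : List (Perm (Fin r))) :
    IntervalForm.HasDegree (edgeForm ws : IntervalForm F r) ws.length := by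
  induction ws with
  | nil => exact hasDegree_vertexForm 1
  | cons w ws ih => simpa [edgeForm] using ih.listH (List.ofFn w)

/-! ### Equivariance -/

/-- The exponent of the sign of a permutation of homogeneous elements. -/
def permExponent (σ : Perm (Fin r)) (m : Fin r → ℤ) : ℤ :=
  ∑ x : Fin r × Fin r with x.1 < x.2 ∧ σ x.2 < σ x.1, m (σ x.1) * m (σ x.2)

/-- The form `G'` is obtained from `G` by a signed permutation of the variables. -/
def IsPermutedForm (σ : Perm (Fin r)) (G G' : IntervalForm F r) : Prop :=
  ∀ (m : Fin r → ℤ) (f : Fin r → Face 1 → F), (∀ i, f i ∈ cochainGr F 1 (m i)) →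
    G' f = (permExponent σ m).negOnePow • G (f ∘ σ)

theorem permExponent_update (σ : Perm (Fin r)) (m : Fin r → ℤ) (j : Fin r) :
    ∃ c : ℤ, ∑ i with i < σ j, m i + permExponent σ (Function.update m (σ j) (m (σ j) - 1)) =
      permExponent σ m + ∑ i with i < j, m (σ i) + 2 * c := by
  -- By `h3`, lowering the degree at `σ j` removes the degrees of all the variables in inversion
  -- with it. Those which come after `j` compensate the discrepancy between the two sums of
  -- preceding degrees; those which come before `j` are off by twice their sum.
  refine ⟨-∑ i with i < j ∧ σ j < σ i, m (σ i), ?_⟩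
  have h0 : ∑ i with i < σ j, m i = ∑ i with σ i < σ j, m (σ i) := by
    rw [Finset.sum_filter, Finset.sum_filter, ← Equiv.sum_comp σ]
  have h1 : ∑ i with σ i < σ j, m (σ i) = ∑ i with i < j ∧ σ i < σ j, m (σ i) +
      ∑ i with j < i ∧ σ i < σ j, m (σ i) := by
    simp only [Finset.sum_filter, ← Finset.sum_add_distrib]
    refine Finset.sum_congr rfl fun i _ => ?_
    rcases lt_trichotomy i j with e | e | e
    · simp [e, e.not_gt]
    · simp [e]
    · simp [e, e.not_gt]
  have h2 : ∑ i with i < j, m (σ i) = ∑ i with i < j ∧ σ i < σ j, m (σ i) +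
      ∑ i with i < j ∧ σ j < σ i, m (σ i) := by
    simp only [Finset.sum_filter, ← Finset.sum_add_distrib]
    refine Finset.sum_congr rfl fun i _ => ?_
    rcases lt_trichotomy (σ i) (σ j) with e | e | e
    · simp [e, e.not_gt]
    · simp [σ.injective e]
    · simp [e, e.not_gt]
  have hu : ∀ i, Function.update m (σ j) (m (σ j) - 1) (σ i) = m
      (σ i) - if i = j then 1 else 0 := by
    intro i
    by_cases e : i = j
    · subst e; simp
    · simp [e]
  have h3 : permExponent σ (Function.update m (σ j) (m (σ j) - 1)) = permExponent σ m -
      ∑ i with i < j ∧ σ j < σ i, m (σ i) - ∑ i with j < i ∧ σ i < σ j, m (σ i) := by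
    simp only [permExponent, Finset.sum_filter, Fintype.sum_prod_type, hu]
    have : ∀ x y : Fin r, (if x < y ∧ σ y < σ x then
        (m (σ x) - if x = j then 1 else 0) * (m (σ y) - if y = j then 1 else 0) else 0) =
        (if x < y ∧ σ y < σ x then m (σ x) * m (σ y) else 0) -
          (if y = j then if x < j ∧ σ j < σ x then m (σ x) else 0 else 0) -
          (if x = j then if j < y ∧ σ y < σ j then m (σ y) else 0 else 0) := by
      intro x y
      by_cases e : x = j
      · subst e
        by_cases e' : y = x
        · subst e'; simp
        · simp only [e', if_true, if_false]
          split_ifs <;> ring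
      · by_cases e' : y = j
        · subst e'
          simp only [e, if_true, if_false]
          split_ifs <;> ring
        · simp [e, e']
    simp only [this, Finset.sum_sub_distrib]
    congr 1
    · congr 1
      refine Finset.sum_congr rfl fun x _ => ?_
      simp
    · rw [Finset.sum_eq_single j]
      · simp
      · intro x _ hx; simp [hx]
      · simp
  rw [h0, h1, h2, h3]
  ring

theorem IsPermutedForm.hOp {σ : Perm (Fin r)} {G G' : IntervalForm F r}
    (h : IsPermutedForm σ G G') (j : Fin r) : IsPermutedForm σ (hOp j G) (hOp (σ j) G') := by
  intro m f hf
  have hf' : ∀ i, Function.update f (σ j) (intervalH F (f (σ j))) i ∈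
      cochainGr F 1 (Function.update m (σ j) (m (σ j) - 1) i) := by
    intro i
    by_cases h : i = σ j
    · subst h; simpa using intervalH_mem (hf (σ j))
    · simpa [h] using hf i
  have e : Function.update f (σ j) (intervalH F (f (σ j))) ∘ σ =
      Function.update (f ∘ σ) j (intervalH F ((f ∘ σ) j)) := by
    rw [Function.update_comp_equiv, Equiv.symm_apply_apply]; rfl
  obtain ⟨c, hc⟩ := permExponent_update σ m j
  rw [_root_.hOp, _root_.hOp, oddOp_apply_of_mem _ _ _ hf, h _ _ hf', e,
    oddOp_apply_of_mem (m := m ∘ σ) (f := f ∘ σ) _ _ _ (fun i => hf (σ i)), smul_smul, smul_smul,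
    ← Int.negOnePow_add, ← Int.negOnePow_add, negOnePow_congr c hc]
  rfl

theorem IsPermutedForm.pOp {σ : Perm (Fin r)} {G G' : IntervalForm F r}
    (h : IsPermutedForm σ G G') (j : Fin r) : IsPermutedForm σ (pOp j G) (pOp (σ j) G') := by
  intro m f hf
  have e : Function.update f (σ j) (intervalP F (f (σ j))) ∘ σ =
      Function.update (f ∘ σ) j (intervalP F ((f ∘ σ) j)) := by
    rw [Function.update_comp_equiv, Equiv.symm_apply_apply]; rfl
  rw [_root_.pOp, _root_.pOp, evenOp_eq_update, evenOp_eq_update, ← e]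
  refine h m _ fun i => ?_
  by_cases h : i = σ j
  · subst h; simpa using intervalP_mem (hf (σ j))
  · simpa [h] using hf i

theorem IsPermutedForm.listH {σ : Perm (Fin r)} {G G' : IntervalForm F r}
    (h : IsPermutedForm σ G G') (l : List (Fin r)) :
    IsPermutedForm σ (listH l G) (listH (l.map σ) G') := by
  induction l with
  | nil => exact fun m f _ => by simp [_root_.listH]
  | cons j l ih =>
    intro m f hf
    rw [List.map_cons, _root_.listH, _root_.listH, LinearMap.add_apply, LinearMap.add_apply,
      add_apply, add_apply, Module.End.mul_apply, Module.End.mul_apply, h.hOp j m f hf,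
      ih.pOp j m f hf, smul_add]

theorem isPermutedForm_vertexForm (σ : Perm (Fin r)) (x : Fin 2) :
    IsPermutedForm σ (vertexForm x : IntervalForm F r) (vertexForm x) := by
  intro m f hf
  have h1 : (vertexForm x : IntervalForm F r) (f ∘ σ) = vertexForm x f := by
    rw [vertexForm_apply, vertexForm_apply]
    exact Equiv.prod_comp σ fun k => f k (vertexFace x)
  rw [h1]
  by_cases h : ∀ i, m i = 0
  · simp [permExponent, h]
  · obtain ⟨i, hi⟩ := not_forall.1 h
    rw [vertexForm_apply,
      Finset.prod_eq_zero (Finset.mem_univ i) (apply_vertexFace_of_mem (hf i) hi x), smul_zero]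

/-- Left multiplication by `σ` relabels the order in which `H_w` takes the variables, and the
homotopies and projections in single variables are compatible with relabelling. -/
theorem isPermutedForm_edgeForm (σ : Perm (Fin r)) (ws : List (Perm (Fin r))) :
    IsPermutedForm σ (edgeForm ws : IntervalForm F r) (edgeForm (ws.map fun w => σ * w)) := by
  induction ws with
  | nil => exact isPermutedForm_vertexForm σ 1
  | cons w ws ih =>
    have : List.ofFn (σ * w) = (List.ofFn w).map σ := by
      rw [List.map_ofFn]; rfl
    rw [List.map_cons, edgeForm, edgeForm, this]
    exact ih.listH _

end IntervalOperations

/-! ### Composites -/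

section Insertion

variable {F : Type u} [CommRing F] {r s n : ℕ} (h : n + 1 = r + s) (k : Fin r)

theorem MultilinearMap.eq_smul_of_eq_smul {ι V : Type*} [AddCommGroup V] [Module F V]
    (G : MultilinearMap F (fun _ : ι => V) F) {a b : ι → V} (i : ι) (c : F) (hi : a i = c • b i)
    (hl : ∀ l, l ≠ i → a l = b l) : G a = c • G b := by
  classical
  have : a = Function.update b i (c • b i) := by
    ext1 l
    by_cases e : l = i
    · subst e; simp [hi]
    · simp [e, hl l e]
  rw [this, G.map_update_smul, Function.update_eq_self]

/-- The variables of a form in which `x`, multiplied by the value of another form, is inserted in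
the place `k`, and the preceding variables are modified by a power of the sign operator. -/
def insertVars (e : ℕ) (x : Face 1 → F) (Θ : IntervalForm F s) (f : Fin n → Face 1 → F) :
    Fin r → Face 1 → F :=
  fun j => if hj : j = k then Θ (fun i => f (inIdx h k i)) • x
    else if j < k then (intervalSgn F ^ e) (f (outIdx h k ⟨j, hj⟩)) else f (outIdx h k ⟨j, hj⟩)

theorem insertVars_self (e : ℕ) (x : Face 1 → F) (Θ : IntervalForm F s) (f : Fin n → Face 1 → F) :
    insertVars h k e x Θ f k = Θ (fun i => f (inIdx h k i)) • x := by
  simp [insertVars]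

theorem insertVars_of_lt (e : ℕ) (x : Face 1 → F) (Θ : IntervalForm F s) (f : Fin n → Face 1 → F)
    {j : Fin r} (hj : j < k) :
    insertVars h k e x Θ f j = (intervalSgn F ^ e) (f (outIdx h k ⟨j, hj.ne⟩)) := by
  simp [insertVars, hj, hj.ne]

theorem insertVars_of_gt (e : ℕ) (x : Face 1 → F) (Θ : IntervalForm F s) (f : Fin n → Face 1 → F)
    {j : Fin r} (hj : k < j) : insertVars h k e x Θ f j = f (outIdx h k ⟨j, hj.ne'⟩) := by
  simp [insertVars, hj.not_gt, hj.ne']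

theorem isMultilinear_insertVars (e : ℕ) (x : Face 1 → F) (Θ : IntervalForm F s)
    (G : IntervalForm F r) :
    IsMultilinear (F := F) fun f : Fin n → Face 1 → F => G (insertVars h k e x Θ f) := by
  have h1 := (G.isMultilinear.comp_linearMap
    (fun j => if j < k then intervalSgn F ^ e else (1 : Module.End F (Face 1 → F)))).circ h k
    (Θ.isMultilinear.linearMap_comp (LinearMap.toSpanSingleton F (Face 1 → F) x))
  refine (congrArg (IsMultilinear (F := F)) ?_).mpr h1
  funext f
  refine congrArg G (funext fun j => ?_)
  rcases lt_trichotomy j k with hj | hj | hj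
  · simp [insertVars_of_lt h k e x Θ f hj, hj, hj.ne]
  · subst hj; simp [insertVars_self]
  · simp [insertVars_of_gt h k e x Θ f hj, hj.not_gt, hj.ne']

theorem map_insertVars_smul (G : IntervalForm F r) (e : ℕ) (x : Face 1 → F) (Θ : IntervalForm F s)
    (f : Fin n → Face 1 → F) : G (insertVars h k e x Θ f) =
      Θ (fun i => f (inIdx h k i)) •
        G (Function.update (insertVars h k e x (0 : IntervalForm F s) f) k x) := by
  refine G.eq_smul_of_eq_smul k _ ?_ fun l hl => ?_
  · simp [insertVars_self]
  · simp [insertVars, hl]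

/-- The insertion in the place `k` of a form of the vector `x`, multiplied by the value of another
form. -/
def insertForm (e : ℕ) (x : Face 1 → F) :
    IntervalForm F s →ₗ[F] IntervalForm F r →ₗ[F] IntervalForm F n :=
  LinearMap.mk₂ F (fun Θ G => (isMultilinear_insertVars h k e x Θ G).toMultilinearMap)
    (fun Θ Θ' G => MultilinearMap.ext fun f => by
      change G (insertVars h k e x _ f) =
        G (insertVars h k e x _ f) + G (insertVars h k e x _ f)
      rw [map_insertVars_smul, map_insertVars_smul h k G e x Θ, map_insertVars_smul h k G e x Θ',
        add_apply, add_smul])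
    (fun c Θ G => MultilinearMap.ext fun f => by
      change G (insertVars h k e x _ f) = c • G (insertVars h k e x _ f)
      rw [map_insertVars_smul, map_insertVars_smul h k G e x Θ, smul_apply, smul_assoc])
    (fun Θ G G' => rfl) (fun c Θ G => rfl)

theorem insertForm_apply (e : ℕ) (x : Face 1 → F) (Θ : IntervalForm F s) (G : IntervalForm F r)
    (f : Fin n → Face 1 → F) :
    insertForm h k e x Θ G f = G (insertVars h k e x Θ f) := rfl

theorem insertForm_add (e : ℕ) (x y : Face 1 → F) (Θ : IntervalForm F s) (G : IntervalForm F r) :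
    (insertForm h k e (x + y) Θ G : IntervalForm F n) =
      insertForm h k e x Θ G + insertForm h k e y Θ G :=
  MultilinearMap.ext fun f => by
    have h1 : ∀ z, Function.update (insertVars h k e z (0 : IntervalForm F s) f) k z =
        Function.update (insertVars h k e 0 (0 : IntervalForm F s) f) k z := fun z => by
      funext l
      by_cases hl : l = k
      · subst hl; simp
      · simp [hl, insertVars]
    rw [add_apply, insertForm_apply, insertForm_apply, insertForm_apply, map_insertVars_smul,
      map_insertVars_smul h k G e x, map_insertVars_smul h k G e y, h1, h1 x, h1 y,
      G.map_update_add, smul_add]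

theorem insertForm_zero (e : ℕ) (Θ : IntervalForm F s) (G : IntervalForm F r) :
    (insertForm h k e 0 Θ G : IntervalForm F n) = 0 :=
  MultilinearMap.ext fun f => G.eq_zero k (by simp [insertVars_self])

theorem sgn_pow_apply_comm (e : ℕ) (f : Face 1 → F) :
    (intervalSgn F ^ e) (intervalSgn F f) = intervalSgn F ((intervalSgn F ^ e) f) := by
  rw [← Module.End.mul_apply, ← Module.End.mul_apply, ← pow_succ, ← pow_succ']

theorem intervalH_sgn_pow (e : ℕ) (f : Face 1 → F) :
    (intervalSgn F ^ e) (intervalH F f) = (-1 : F) ^ e • intervalH F ((intervalSgn F ^ e) f) := by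
  induction e generalizing f with
  | zero => simp
  | succ e ih =>
    have h1 := LinearMap.congr_fun (intervalH_sgn (F := F)) ((intervalSgn F ^ e) f)
    simp only [Module.End.mul_apply, LinearMap.neg_apply] at h1
    rw [pow_succ', Module.End.mul_apply, Module.End.mul_apply, ih, map_smul, h1, pow_succ,
      smul_neg, mul_neg_one, neg_smul, neg_neg]

theorem intervalP_sgn_pow (e : ℕ) (f : Face 1 → F) :
    (intervalSgn F ^ e) (intervalP F f) = intervalP F ((intervalSgn F ^ e) f) := by
  induction e generalizing f with
  | zero => simp
  | succ e ih =>
    have h1 := LinearMap.congr_fun (intervalP_sgn (F := F)) ((intervalSgn F ^ e) f)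
    simp only [Module.End.mul_apply] at h1
    rw [pow_succ', Module.End.mul_apply, Module.End.mul_apply, ih, h1]

/-- In the place `k` the homotopy acts on the inserted vector, and the sign operators that it puts
on the preceding variables raise the exponent `e`. -/
theorem insertForm_hOp_self (e : ℕ) (x : Face 1 → F) (Θ : IntervalForm F s)
    (G : IntervalForm F r) : (insertForm h k e x Θ (hOp k G) : IntervalForm F n) =
      insertForm h k (e + 1) (intervalH F x) Θ G :=
  MultilinearMap.ext fun f => by
    rw [insertForm_apply, insertForm_apply, hOp, oddOp_apply]
    congr 1
    funext j
    rcases lt_trichotomy j k with hj | hj | hj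
    · simp [insertVars_of_lt h k _ _ Θ f hj, hj, pow_succ']
    · subst hj; simp [insertVars_self]
    · simp [insertVars_of_gt h k _ _ Θ f hj, hj.not_gt, hj.ne']

theorem insertForm_pOp_self (e : ℕ) (x : Face 1 → F) (Θ : IntervalForm F s)
    (G : IntervalForm F r) : (insertForm h k e x Θ (pOp k G) : IntervalForm F n) =
      insertForm h k e (intervalP F x) Θ G :=
  MultilinearMap.ext fun f => by
    rw [insertForm_apply, insertForm_apply, pOp, evenOp_apply]
    congr 1
    funext j
    rcases lt_trichotomy j k with hj | hj | hj
    · simp [insertVars_of_lt h k _ _ Θ f hj, hj.ne]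
    · subst hj; simp [insertVars_self]
    · simp [insertVars_of_gt h k _ _ Θ f hj, hj.ne']

theorem inIdx_injective {i j : Fin s} : inIdx h k i = inIdx h k j ↔ i = j := by
  simp [inIdx, Fin.ext_iff]

theorem outIdx_injective {i j : {j : Fin r // j ≠ k}} : outIdx h k i = outIdx h k j ↔ i = j :=
  ⟨fun e => Sum.inl_injective ((blocks_bijective h k).1 (a₁ := Sum.inl i) (a₂ := Sum.inl j) e),
    fun e => by rw [e]⟩

theorem inIdx_ne_outIdx (i : Fin s) (j : {j : Fin r // j ≠ k}) : inIdx h k i ≠ outIdx h k j :=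
  fun e => by
    have := (blocks_bijective h k).1 (a₁ := Sum.inr i) (a₂ := Sum.inl j) e
    simp at this

/-- The variables which precede an inner one are the earlier inner ones, which belong to the
operator on `Θ`, and the outer ones before `k`, whose sign operators raise `e`. -/
theorem hOp_inIdx_insertForm (e : ℕ) (x : Face 1 → F) (Θ : IntervalForm F s)
    (G : IntervalForm F r) (i : Fin s) :
    (hOp (inIdx h k i) (insertForm h k e x Θ G) : IntervalForm F n) =
      insertForm h k (e + 1) x (hOp i Θ) G :=
  MultilinearMap.ext fun f => by
    rw [hOp, oddOp_apply, insertForm_apply, insertForm_apply]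
    congr 1
    funext j
    rcases lt_trichotomy j k with hj | hj | hj
    · simp [insertVars_of_lt h k _ _ _ _ hj, outIdx_lt_inIdx, hj, pow_succ]
    · subst hj
      rw [insertVars_self, insertVars_self, hOp, oddOp_apply]
      simp only [inIdx_lt_inIdx, inIdx_injective]
    · simp [insertVars_of_gt h k _ _ _ _ hj, outIdx_lt_inIdx, hj.not_gt,
        (inIdx_ne_outIdx h k _ _).symm]

theorem pOp_inIdx_insertForm (e : ℕ) (x : Face 1 → F) (Θ : IntervalForm F s)
    (G : IntervalForm F r) (i : Fin s) :
    (pOp (inIdx h k i) (insertForm h k e x Θ G) : IntervalForm F n) =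
      insertForm h k e x (pOp i Θ) G :=
  MultilinearMap.ext fun f => by
    rw [pOp, evenOp_apply, insertForm_apply, insertForm_apply]
    congr 1
    funext j
    rcases lt_trichotomy j k with hj | hj | hj
    · simp [insertVars_of_lt h k _ _ _ _ hj, (inIdx_ne_outIdx h k _ _).symm]
    · subst hj
      rw [insertVars_self, insertVars_self, pOp, evenOp_apply]
      simp only [inIdx_injective]
    · simp [insertVars_of_gt h k _ _ _ _ hj, (inIdx_ne_outIdx h k _ _).symm]

theorem listP_inIdx_insertForm (e : ℕ) (x : Face 1 → F) (Θ : IntervalForm F s)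
    (G : IntervalForm F r) (l : List (Fin s)) :
    (listP (l.map (inIdx h k)) (insertForm h k e x Θ G) : IntervalForm F n) =
      insertForm h k e x (listP l Θ) G := by
  induction l with
  | nil => rfl
  | cons i l ih => rw [List.map_cons, listP, listP, Module.End.mul_apply, Module.End.mul_apply, ih,
      pOp_inIdx_insertForm]

theorem listH_inIdx_insertForm (e : ℕ) (x : Face 1 → F) (Θ : IntervalForm F s)
    (G : IntervalForm F r) (l : List (Fin s)) :
    (listH (l.map (inIdx h k)) (insertForm h k e x Θ G) : IntervalForm F n) =
      insertForm h k (e + 1) x (listH l Θ) G := by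
  induction l with
  | nil => simp [listH]
  | cons i l ih =>
    rw [List.map_cons, listH, listH, LinearMap.add_apply, LinearMap.add_apply, Module.End.mul_apply,
      Module.End.mul_apply, ih, pOp_inIdx_insertForm, hOp_inIdx_insertForm, map_add,
      LinearMap.add_apply]

/-- The parity of a form and a vector differ by `e`. -/
def SgnCompatible (e : ℕ) (x : Face 1 → F) (Θ : IntervalForm F s) : Prop :=
  ∀ f : Fin s → Face 1 → F, Θ (fun i => intervalSgn F (f i)) • x =
    (-1 : F) ^ e • intervalSgn F (Θ f • x)

/-- For `j < k`, the sign is the commutation of the homotopy with the power `e` of the sign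
operator. For `j > k`, the homotopy puts the sign operator on all the inner variables on one side
and on the inserted vector on the other side, and `SgnCompatible` compares the two. -/
theorem hOp_outIdx_insertForm {e : ℕ} {x : Face 1 → F} {Θ : IntervalForm F s}
    (hΘ : SgnCompatible e x Θ) (G : IntervalForm F r) (j : {j : Fin r // j ≠ k}) :
    (hOp (outIdx h k j) (insertForm h k e x Θ G) : IntervalForm F n) =
      (-1 : F) ^ e • insertForm h k e x Θ (hOp j.1 G) :=
  MultilinearMap.ext fun f => by
    rw [smul_apply, hOp, oddOp_apply, insertForm_apply, insertForm_apply, hOp, oddOp_apply]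
    rcases lt_or_gt_of_ne j.2 with hj | hj
    · refine G.eq_smul_of_eq_smul j.1 _ ?_ fun l hl => ?_
      · simp [insertVars_of_lt h k _ _ _ _ hj, intervalH_sgn_pow]
      · rcases lt_trichotomy l k with hlk | hlk | hlk
        · have h1 : (⟨l, hlk.ne⟩ : {j : Fin r // j ≠ k}) ≠ j := fun e => hl (congrArg Subtype.val e)
          by_cases h2 : l < j.1
          · simp [insertVars_of_lt h k _ _ _ _ hlk, outIdx_lt_outIdx, h2, sgn_pow_apply_comm]
          · simp [insertVars_of_lt h k _ _ _ _ hlk, outIdx_lt_outIdx, outIdx_injective, h1, h2, hl]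
        · subst hlk
          simp [insertVars_self, inIdx_lt_outIdx, hj.not_gt, inIdx_ne_outIdx, hl]
        · have h1 : (⟨l, hlk.ne'⟩ : {j : Fin r // j ≠ k}) ≠ j := fun e =>
            hl (congrArg Subtype.val e)
          simp [insertVars_of_gt h k _ _ _ _ hlk, outIdx_lt_outIdx, outIdx_injective, h1, hl,
            (hj.trans hlk).not_gt]
    · refine G.eq_smul_of_eq_smul k _ ?_ fun l hl => ?_
      · have h1 := hΘ fun i => f (inIdx h k i)
        simp only [insertVars_self, inIdx_lt_outIdx, hj, if_true, h1]
      · rcases lt_or_gt_of_ne hl with hlk | hlk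
        · simp [insertVars_of_lt h k _ _ _ _ hlk, outIdx_lt_outIdx, hlk.trans hj,
            sgn_pow_apply_comm]
        · by_cases h2 : l < j.1
          · simp [insertVars_of_gt h k _ _ _ _ hlk, outIdx_lt_outIdx, h2]
          · by_cases h3 : l = j.1
            · subst h3
              simp [insertVars_of_gt h k _ _ _ _ hlk]
            · have h1 : (⟨l, hl⟩ : {j : Fin r // j ≠ k}) ≠ j := fun e => h3 (congrArg Subtype.val e)
              simp [insertVars_of_gt h k _ _ _ _ hlk, outIdx_lt_outIdx, outIdx_injective, h1, h2,
                h3]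

theorem pOp_outIdx_insertForm (e : ℕ) (x : Face 1 → F) (Θ : IntervalForm F s)
    (G : IntervalForm F r) (j : {j : Fin r // j ≠ k}) :
    (pOp (outIdx h k j) (insertForm h k e x Θ G) : IntervalForm F n) =
      insertForm h k e x Θ (pOp j.1 G) :=
  MultilinearMap.ext fun f => by
    rw [pOp, evenOp_apply, insertForm_apply, insertForm_apply, pOp, evenOp_apply]
    congr 1
    funext l
    by_cases h3 : l = j.1
    · subst h3
      rcases lt_or_gt_of_ne j.2 with hj | hj
      · simp [insertVars_of_lt h k _ _ _ _ hj, intervalP_sgn_pow]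
      · simp [insertVars_of_gt h k _ _ _ _ hj]
    · rcases lt_trichotomy l k with hlk | hlk | hlk
      · have h1 : (⟨l, hlk.ne⟩ : {j : Fin r // j ≠ k}) ≠ j := fun e => h3 (congrArg Subtype.val e)
        simp [insertVars_of_lt h k _ _ _ _ hlk, outIdx_injective, h1, h3]
      · subst hlk
        simp [insertVars_self, inIdx_ne_outIdx, h3]
      · have h1 : (⟨l, hlk.ne'⟩ : {j : Fin r // j ≠ k}) ≠ j := fun e => h3 (congrArg Subtype.val e)
        simp [insertVars_of_gt h k _ _ _ _ hlk, outIdx_injective, h1, h3]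

end Insertion

/-! ### Substitution of an operation in a form, and sums over shuffles -/

section InsertEdge

variable {F : Type u} [CommRing F] {r s n : ℕ} (h : n + 1 = r + s) (k : Fin r)

/-- The insertion, in the place `k` of a form, of the operation associated to a sequence of
permutations. -/
def insertEdge (v : List (Perm (Fin s))) : IntervalForm F r →ₗ[F] IntervalForm F n :=
  insertForm h k (v.length - 1) (Pi.single edgeFace 1) (edgeForm v) +
    if v.length = 1 then
      insertForm h k (v.length - 1) (Pi.single (vertexFace 0) 1) (vertexForm 0) +
        insertForm h k (v.length - 1) (Pi.single (vertexFace 1) 1) (vertexForm 1)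
    else 0

theorem intervalH_single (S : Face 1) : intervalH F (Pi.single S 1) =
    if S = edgeFace then Pi.single (vertexFace 1) 1 else 0 := by
  rcases face_interval_cases S with rfl | rfl | rfl
  · rw [if_neg (vertexFace_ne_edgeFace 0)]
    simp [intervalH, (vertexFace_ne_edgeFace 0).symm]
  · rw [if_neg (vertexFace_ne_edgeFace 1)]
    simp [intervalH, (vertexFace_ne_edgeFace 1).symm]
  · simp [intervalH]

theorem intervalP_single_zero : intervalP F (Pi.single (vertexFace 0) 1) =
    Pi.single (vertexFace 0) 1 + Pi.single (vertexFace 1) 1 := by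
  simp [intervalP]

theorem intervalP_single_of_ne {S : Face 1} (hS : S ≠ vertexFace 0) :
    intervalP F (Pi.single S 1) = 0 := by
  simp [intervalP, hS.symm]

theorem hOp_apply_sgn {G : IntervalForm F s} {e : ℕ}
    (hG : ∀ f, (G fun i => intervalSgn F (f i)) = (-1 : F) ^ e • G f) (j : Fin s)
    (f : Fin s → Face 1 → F) :
    (hOp j G fun i => intervalSgn F (f i)) = (-1 : F) ^ (e + 1) • hOp j G f := by
  rw [hOp, oddOp_apply, oddOp_apply, pow_succ, mul_neg_one, neg_smul, ← hG]
  refine G.eq_neg j ?_ fun i hi => ?_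
  · have h1 := LinearMap.congr_fun (intervalH_sgn (F := F)) (f j)
    simpa only [Module.End.mul_apply, LinearMap.neg_apply, lt_irrefl, if_false, if_true] using h1
  · by_cases h : i < j <;> simp [h, hi]

theorem pOp_apply_sgn {G : IntervalForm F s} {e : ℕ}
    (hG : ∀ f, (G fun i => intervalSgn F (f i)) = (-1 : F) ^ e • G f) (j : Fin s)
    (f : Fin s → Face 1 → F) :
    (pOp j G fun i => intervalSgn F (f i)) = (-1 : F) ^ e • pOp j G f := by
  rw [pOp, evenOp_apply, evenOp_apply, ← hG]
  congr 1
  funext i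
  by_cases h : i = j
  · have h1 := LinearMap.congr_fun (intervalP_sgn (F := F)) (f i)
    simpa only [Module.End.mul_apply, h, if_true] using h1
  · simp [h]

theorem listH_apply_sgn {G : IntervalForm F s} {e : ℕ}
    (hG : ∀ f, (G fun i => intervalSgn F (f i)) = (-1 : F) ^ e • G f) (l : List (Fin s))
    (f : Fin s → Face 1 → F) :
    (listH l G fun i => intervalSgn F (f i)) = (-1 : F) ^ (e + 1) • listH l G f := by
  induction l generalizing f with
  | nil => simp [listH]
  | cons j l ih =>
    rw [listH, LinearMap.add_apply, add_apply, add_apply, Module.End.mul_apply, hOp_apply_sgn hG,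
      pOp_apply_sgn ih, smul_add]

theorem edgeForm_apply_sgn (v : List (Perm (Fin s))) (f : Fin s → Face 1 → F) :
    (edgeForm v fun i => intervalSgn F (f i)) = (-1 : F) ^ v.length • edgeForm v f := by
  induction v generalizing f with
  | nil => simp [edgeForm, vertexForm_apply, intervalSgn_apply]
  | cons w v ih => exact listH_apply_sgn ih _ f

/-- The form has the parity of the length of `v` and the edge is odd, whence the difference
`v.length - 1`, the degree of the operation. -/
theorem sgnCompatible_edgeForm (v : List (Perm (Fin s))) (hv : v ≠ []) :
    SgnCompatible (F := F) (v.length - 1) (Pi.single edgeFace 1) (edgeForm v) := by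
  intro f
  have h1 : intervalSgn F (Pi.single edgeFace 1) = -Pi.single edgeFace (1 : F) := by
    rw [intervalSgn_of_mem (m := 1), Int.negOnePow_one, Units.neg_smul, one_smul]
    intro S hS
    have : S ≠ edgeFace := fun e => hS (by rw [e, faceDim_edgeFace])
    simp [this]
  have h2 : v.length = v.length - 1 + 1 := (Nat.sub_add_cancel (List.length_pos_iff.2 hv)).symm
  conv_lhs => rw [edgeForm_apply_sgn, h2]
  rw [map_smul, h1, pow_succ, mul_neg_one, smul_assoc, neg_smul, smul_neg, smul_neg]

theorem sgnCompatible_vertexForm (x : Fin 2) :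
    SgnCompatible (F := F) 0 (Pi.single (vertexFace x) 1) (vertexForm x : IntervalForm F s) := by
  intro f
  have h1 : intervalSgn F (Pi.single (vertexFace x) 1) = Pi.single (vertexFace x) (1 : F) := by
    rw [intervalSgn_of_mem (m := 0), Int.negOnePow_zero, one_smul]
    intro S hS
    have : S ≠ vertexFace x := fun e => hS (by rw [e, faceDim_vertexFace])
    simp [this]
  have h2 : ∀ g : Face 1 → F, intervalSgn F g (vertexFace x) = g (vertexFace x) := by
    intro g
    fin_cases x <;> simp [intervalSgn_apply]
  rw [vertexForm_apply, vertexForm_apply, map_smul, h1]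
  simp [h2]

theorem hOp_outIdx_insertEdge {v : List (Perm (Fin s))} (hv : v ≠ []) (G : IntervalForm F r)
    (j : {j : Fin r // j ≠ k}) :
    (hOp (outIdx h k j) (insertEdge h k v G) : IntervalForm F n) =
      (-1 : F) ^ (v.length - 1) • insertEdge h k v (hOp j.1 G) := by
  unfold insertEdge
  rw [LinearMap.add_apply, LinearMap.add_apply, map_add, smul_add,
    hOp_outIdx_insertForm h k (sgnCompatible_edgeForm v hv)]
  congr 1
  split_ifs with h1
  · rw [h1, LinearMap.add_apply, LinearMap.add_apply, map_add, smul_add,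
      hOp_outIdx_insertForm h k (sgnCompatible_vertexForm 0),
      hOp_outIdx_insertForm h k (sgnCompatible_vertexForm 1)]
  · simp

theorem pOp_outIdx_insertEdge (v : List (Perm (Fin s))) (G : IntervalForm F r)
    (j : {j : Fin r // j ≠ k}) :
    (pOp (outIdx h k j) (insertEdge h k v G) : IntervalForm F n) =
      insertEdge h k v (pOp j.1 G) := by
  unfold insertEdge
  rw [LinearMap.add_apply, LinearMap.add_apply, map_add, pOp_outIdx_insertForm]
  congr 1
  split_ifs with h1
  · rw [LinearMap.add_apply, LinearMap.add_apply, map_add, pOp_outIdx_insertForm,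
      pOp_outIdx_insertForm]
  · simp

theorem listP_outIdx_insertEdge (v : List (Perm (Fin s))) (G : IntervalForm F r)
    (l : List {j : Fin r // j ≠ k}) :
    (listP (l.map (outIdx h k)) (insertEdge h k v G) : IntervalForm F n) =
      insertEdge h k v (listP (l.map Subtype.val) G) := by
  induction l with
  | nil => rfl
  | cons j l ih => rw [List.map_cons, List.map_cons, listP, listP, Module.End.mul_apply,
      Module.End.mul_apply, ih, pOp_outIdx_insertEdge]

theorem listH_outIdx_insertEdge {v : List (Perm (Fin s))} (hv : v ≠ []) (G : IntervalForm F r)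
    (l : List {j : Fin r // j ≠ k}) :
    (listH (l.map (outIdx h k)) (insertEdge h k v G) : IntervalForm F n) =
      (-1 : F) ^ (v.length - 1) • insertEdge h k v (listH (l.map Subtype.val) G) := by
  induction l with
  | nil => simp [listH]
  | cons j l ih =>
    rw [List.map_cons, List.map_cons, listH, listH, LinearMap.add_apply, LinearMap.add_apply,
      Module.End.mul_apply, Module.End.mul_apply, ih, map_smul, pOp_outIdx_insertEdge, map_add,
      smul_add, hOp_outIdx_insertEdge h k hv]

/-- On the component along the edge, `H_b` just extends the sequence `v`. The correction comes from
the vertex components, present for a sequence of one term: `H_b` kills the form at the vertex `0`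
and turns the form at the vertex `1` into the edge form of `[b]`, still inserted at the vertex `1`.
As `h` takes the indicator of the edge to that of the vertex `1`, this is the insertion of `[b]` in
`h_k G`. -/
theorem listH_inIdx_insertEdge {v : List (Perm (Fin s))} (hv : v ≠ []) (G : IntervalForm F r)
    (b : Perm (Fin s)) :
    (listH ((List.ofFn b).map (inIdx h k)) (insertEdge h k v G) : IntervalForm F n) =
      insertEdge h k (b :: v) G + if v.length = 1 then insertEdge h k [b] (hOp k G) else 0 := by
  have hl : 0 < v.length := List.length_pos_iff.2 hv
  unfold insertEdge
  rw [LinearMap.add_apply, map_add, listH_inIdx_insertForm, List.length_cons, edgeForm,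
    if_neg (show ¬ v.length + 1 = 1 by omega), add_zero, Nat.add_sub_cancel, Nat.sub_add_cancel hl]
  congr 1
  by_cases h1 : v.length = 1
  · rw [if_pos h1, if_pos h1, if_pos (by simp), LinearMap.add_apply, map_add,
      listH_inIdx_insertForm, listH_inIdx_insertForm, listH_vertexForm_zero, LinearMap.add_apply,
      LinearMap.add_apply, insertForm_hOp_self, insertForm_hOp_self, insertForm_hOp_self,
      intervalH_single, intervalH_single, intervalH_single, if_pos rfl,
      if_neg (vertexFace_ne_edgeFace 0), if_neg (vertexFace_ne_edgeFace 1), insertForm_zero,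
      insertForm_zero, map_zero, LinearMap.zero_apply, h1]
    simp [edgeForm]
  · rw [if_neg h1, if_neg h1, LinearMap.zero_apply, map_zero]

/-- The projection kills the edge form and moves both vertex forms to the vertex `0`. What is left
is inserted along the sum of the indicators of the two vertices, which is `p` applied to the
indicator of the vertex `0`, while `p` kills the other two indicators. -/
theorem listP_inIdx_insertEdge {v : List (Perm (Fin s))} (hv : v ≠ []) (G : IntervalForm F r)
    (b : Perm (Fin s)) :
    (listP ((List.ofFn b).map (inIdx h k)) (insertEdge h k v G) : IntervalForm F n) =
      insertEdge h k v (pOp k G) := by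
  have h0 : listP (List.ofFn b) (edgeForm v : IntervalForm F s) = 0 := by
    cases v with
    | nil => exact absurd rfl hv
    | cons w v => exact listP_listH_ofFn b w _
  have h1 : listP (List.ofFn b) (vertexForm 0 : IntervalForm F s) = vertexForm 0 := by
    rw [← listP_ofFn_vertexForm b, ← Module.End.mul_apply, listP_self]
  unfold insertEdge
  rw [LinearMap.add_apply, LinearMap.add_apply, map_add, listP_inIdx_insertForm, h0, map_zero,
    LinearMap.zero_apply, insertForm_pOp_self,
    intervalP_single_of_ne (vertexFace_ne_edgeFace 0).symm, insertForm_zero]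
  congr 1
  split_ifs
  · rw [LinearMap.add_apply, LinearMap.add_apply, map_add, listP_inIdx_insertForm,
      listP_inIdx_insertForm, h1, listP_ofFn_vertexForm, insertForm_pOp_self, insertForm_pOp_self,
      intervalP_single_of_ne vertexFace_zero_ne_one.symm, insertForm_zero, intervalP_single_zero,
      insertForm_add, add_zero]
  · rw [LinearMap.zero_apply, LinearMap.zero_apply, map_zero]

/-- A sequence of at least two terms is only inserted along the edge, which `p` kills. -/
theorem insertEdge_pOp (v : List (Perm (Fin s))) (hv : v ≠ []) (b : Perm (Fin s))
    (G : IntervalForm F r) :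
    (insertEdge h k (b :: v) (pOp k G) : IntervalForm F n) = 0 := by
  have hl : 0 < v.length := List.length_pos_iff.2 hv
  unfold insertEdge
  rw [List.length_cons, if_neg (show ¬ v.length + 1 = 1 by omega), add_zero, insertForm_pOp_self,
    intervalP_single_of_ne (vertexFace_ne_edgeFace 0).symm, insertForm_zero]

theorem insertEdge_cons_cons (v : List (Perm (Fin s))) (b : Perm (Fin s)) :
    (insertEdge h k (b :: b :: v) : IntervalForm F r →ₗ[F] IntervalForm F n) = 0 := by
  unfold insertEdge
  rw [edgeForm_of_not_isChain (by simp), if_neg (by simp), map_zero, add_zero]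

-- The order of the variables is: outer ones before `k`, the inserted block, outer ones after `k`.
-- The formula combines `listH_append` with the rules for a homotopy or a projection over each of
-- these segments.
variable {k} in
theorem listH_cons_insertEdge {v : List (Perm (Fin s))} (hv : v ≠ []) (b : Perm (Fin s))
    (G : IntervalForm F r) (l₁ l₂ : List {j : Fin r // j ≠ k}) :
    (listH (l₁.map (outIdx h k) ++ ((List.ofFn b).map (inIdx h k) ++ l₂.map (outIdx h k)))
      (insertEdge h k v G) : IntervalForm F n) =
    (-1 : F) ^ (v.length - 1) • insertEdge h k v (listH (l₁.map Subtype.val) G +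
        listP (l₁.map Subtype.val) (pOp k (listH (l₂.map Subtype.val) G))) +
      insertEdge h k (b :: v) (listP (l₁.map Subtype.val) G) +
      if v.length = 1 then insertEdge h k [b] (listP (l₁.map Subtype.val) (hOp k G)) else 0 := by
  rw [listH_append, listH_append, LinearMap.add_apply, Module.End.mul_apply, LinearMap.add_apply,
    Module.End.mul_apply, listH_outIdx_insertEdge h k hv, listH_outIdx_insertEdge h k hv, map_smul,
    listP_inIdx_insertEdge h k hv, map_add, listH_inIdx_insertEdge h k hv, map_add, map_smul,
    listP_outIdx_insertEdge, listP_outIdx_insertEdge, map_add, smul_add,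
    apply_ite (listP (l₁.map (outIdx h k))), listP_outIdx_insertEdge, map_zero]
  abel

-- This is the identity behind the composition product. Write `I_v` for `insertEdge`, `H` for the
-- homotopy of the outer permutation, with segments `H₁`, `k`, `H₂`, and `P` for the projection over
-- the first segment, so that `H = H₁ + P h_k + P p_k H₂`. The composite homotopy sends `(-1)^|v|
-- I_{b::v} X` to `I_{b::v}` of the parts `H₁ + P p_k H₂` of `H X`. The missing part `P h_k X` comes
-- from `I_v (H X)` through `I_{b::v}(P H X)`, the rest of that term being killed by `H² = 0`. If
-- `v` is empty, it comes instead from the vertex components of `I_{[b]}`.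
variable {k} in
theorem listH_listH_insertEdge (v : List (Perm (Fin s))) (b : Perm (Fin s)) (X : IntervalForm F r)
    (l₁ l₂ : List {j : Fin r // j ≠ k})
    (hl : (l₁.map Subtype.val ++ k :: l₂.map Subtype.val).Nodup) :
    (listH (l₁.map (outIdx h k) ++ ((List.ofFn b).map (inIdx h k) ++ l₂.map (outIdx h k)))
      ((-1 : F) ^ v.length • insertEdge h k (b :: v) X +
        if v = [] then 0 else
          insertEdge h k v (listH (l₁.map Subtype.val ++ k :: l₂.map Subtype.val) X)) :
      IntervalForm F n) =
    insertEdge h k (b :: v) (listH (l₁.map Subtype.val ++ k :: l₂.map Subtype.val) X) := by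
  have hk : k ∉ l₁.map Subtype.val := by
    rintro hk
    obtain ⟨x, -, hx⟩ := List.mem_map.1 hk
    exact x.2 hx
  have hl₁ : (l₁.map Subtype.val).Nodup := (List.nodup_append.1 hl).1
  set P := (listP (l₁.map Subtype.val) : Module.End F (IntervalForm F r)) with hP
  set H₁ := (listH (l₁.map Subtype.val) : Module.End F (IntervalForm F r)) with hH₁
  set H₂ := (listH (l₂.map Subtype.val) : Module.End F (IntervalForm F r)) with hH₂
  set H := (listH (l₁.map Subtype.val ++ k :: l₂.map Subtype.val) :
    Module.End F (IntervalForm F r)) with hH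
  have eH : H = H₁ + P * (hOp k + pOp k * H₂) := by rw [hH, listH_append, listH]
  have eHX : ∀ Y, H Y = H₁ Y + P (hOp k Y) + P (pOp k (H₂ Y)) := fun Y => by
    rw [eH]
    simp only [LinearMap.add_apply, Module.End.mul_apply, map_add]
    abel
  have hPp : ∀ Y, P (pOp k Y) = pOp k (P Y) := fun Y => by
    rw [← Module.End.mul_apply, ← Module.End.mul_apply, pOp_listP]
  rw [map_add, map_smul, listH_cons_insertEdge h (List.cons_ne_nil b v), List.length_cons,
    Nat.add_sub_cancel, insertEdge_cons_cons, LinearMap.zero_apply, add_zero]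
  by_cases hv : v = []
  · subst hv
    rw [if_pos rfl, if_pos (by simp), map_zero, eHX]
    simp only [List.length_nil, pow_zero, one_smul, map_add, add_zero]
    abel
  · have hlv : 0 < v.length := List.length_pos_iff.2 hv
    -- After `h_k` has been moved across `H₁` and `P`, every term contains one of `P H₁`, `h_k²` and
    -- `h_k p_k`, which vanish.
    have h1 : P (hOp k (H X)) = 0 := by
      have e1 : P * hOp k * H = 0 := by
        rw [eH, mul_add, mul_assoc, hH₁, hOp_listH hk, mul_smul_comm, ← mul_assoc,
          listP_listH hl₁, zero_mul, smul_zero, zero_add, ← mul_assoc, mul_assoc P, hOp_listP hk,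
          ← mul_assoc, mul_assoc, mul_add, hOp_self, ← mul_assoc, hOp_pOp_self, zero_mul, add_zero,
          mul_zero]
      have := LinearMap.congr_fun e1 X
      simpa only [Module.End.mul_apply, LinearMap.zero_apply] using this
    -- This is `H² = 0` without the middle term, which is zero by `h1`.
    have h2 : H₁ (H X) + P (pOp k (H₂ (H X))) = 0 := by
      have e2 := LinearMap.congr_fun (listH_self (F := F) hl) X
      rw [Module.End.mul_apply, LinearMap.zero_apply, ← hH, eHX, h1, add_zero] at e2
      exact e2
    -- The last term is in the image of `p_k`, hence disappears after the insertion of `b :: v` with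
    -- `v` non-empty (`insertEdge_pOp`).
    have h3 : P (H X) = P (hOp k X) + pOp k (P (H₂ X)) := by
      have e3 : P (H₁ X) = 0 := by
        rw [← Module.End.mul_apply, listP_listH hl₁, LinearMap.zero_apply]
      have e4 : ∀ Y, P (P Y) = P Y := fun Y => by rw [← Module.End.mul_apply, listP_self]
      rw [eHX, map_add, map_add, e3, e4, e4, zero_add, hPp]
    rw [if_neg hv, if_neg (show ¬ v.length + 1 = 1 by omega), listH_cons_insertEdge h hv, h2, h1,
      h3, eHX, hPp, map_add, map_add, map_add, map_add, insertEdge_pOp h k v hv]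
    simp only [map_zero, smul_zero, add_zero, zero_add, ite_self, smul_smul, ← mul_pow, mul_neg,
      mul_one, neg_neg, one_pow, one_smul]
    rfl

/-- In a composite of permutations, the value `k` is replaced by a sequence of values. -/
theorem ofFn_permCirc (u : Perm (Fin r)) (v : Perm (Fin s)) :
    ∃ l₁ l₂ : List {j : Fin r // j ≠ k},
      List.ofFn u = l₁.map Subtype.val ++ k :: l₂.map Subtype.val ∧
      List.ofFn (permCirc h k u v) =
        l₁.map (outIdx h k) ++ ((List.ofFn v).map (inIdx h k) ++ l₂.map (outIdx h k)) := by
  set p := u.symm k with hp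
  have hup : u p = k := by simp [hp]
  have hr : (p : ℕ) < r := p.2
  let U : {j : Fin r // j ≠ p} → {j : Fin r // j ≠ k} := fun j =>
    ⟨u j.1, fun e => j.2 (u.injective (e.trans hup.symm))⟩
  have hout : ∀ j, permCirc h k u v (outIdx h p j) = outIdx h k (U j) := by
    intro j
    have : (blocks h p).symm (outIdx h p j) = Sum.inl j := by
      rw [Equiv.symm_apply_eq]; rfl
    change (blocks h k) ((Equiv.sumCongr _ v) ((blocks h p).symm _)) = _
    rw [this]
    rfl
  have hin : ∀ i, permCirc h k u v (inIdx h p i) = inIdx h k (v i) := by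
    intro i
    have : (blocks h p).symm (inIdx h p i) = Sum.inr i := by
      rw [Equiv.symm_apply_eq]; rfl
    change (blocks h k) ((Equiv.sumCongr _ v) ((blocks h p).symm _)) = _
    rw [this]
    rfl
  -- The values of `u` at the positions before and after the position `p` of the value `k`.
  refine ⟨List.ofFn fun j : Fin p => U ⟨⟨j, by omega⟩, fun e => by
      have := congrArg Fin.val e
      simp at this
      omega⟩,
    List.ofFn fun j : Fin (r - p - 1) => U ⟨⟨p + 1 + j, by omega⟩, fun e => by
      have := congrArg Fin.val e
      simp at this
      omega⟩, ?_, ?_⟩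
  · refine List.ext_getElem (by simp; omega) fun i h1 h2 => ?_
    rw [List.getElem_ofFn]
    simp only [List.getElem_append, List.getElem_cons, List.length_map, List.length_ofFn,
      List.getElem_map, List.getElem_ofFn]
    split_ifs with e1 e2
    · rfl
    · rw [← hup]
      congr 1
      exact Fin.ext (show i = p by omega)
    · change u _ = u _
      congr 1
      exact Fin.ext (show i = p + 1 + (i - p - 1) by omega)
  · refine List.ext_getElem (by simp; omega) fun i h1 h2 => ?_
    rw [List.getElem_ofFn]
    simp only [List.getElem_append, List.length_map, List.length_ofFn, List.getElem_map,
      List.getElem_ofFn]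
    split_ifs with e1 e2
    · rw [← hout]
      congr 1
      refine Fin.ext ?_
      simp [outIdx, Fin.lt_def, e1]
    · rw [← hin]
      congr 1
      refine Fin.ext ?_
      simp only [inIdx]
      omega
    · rw [← hout]
      congr 1
      refine Fin.ext ?_
      simp only [outIdx, Fin.lt_def]
      rw [if_neg (by omega)]
      omega

theorem prod_blocks {M : Type*} [CommMonoid M] (f : Fin n → M) :
    ∏ i, f i = (∏ j : {j : Fin r // j ≠ k}, f (outIdx h k j)) * ∏ i : Fin s, f (inIdx h k i) :=
  sum_blocks (M := Additive M) h k f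

theorem sgn_pow_apply_vertexFace (e : ℕ) (x : Fin 2) (f : Face 1 → F) :
    (intervalSgn F ^ e) f (vertexFace x) = f (vertexFace x) := by
  induction e with
  | zero => rfl
  | succ e ih =>
    rw [pow_succ', Module.End.mul_apply, ← ih]
    fin_cases x
    · exact (intervalSgn_apply _).1
    · exact (intervalSgn_apply _).2.1

theorem vertexForm_insertVars (y : Fin 2) (e : ℕ) (x : Face 1 → F) (Θ : IntervalForm F s)
    (f : Fin n → Face 1 → F) :
    vertexForm y (insertVars h k e x Θ f) = Θ (fun i => f (inIdx h k i)) * x (vertexFace y) *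
      ∏ j : {j : Fin r // j ≠ k}, f (outIdx h k j) (vertexFace y) := by
  rw [vertexForm_apply, ← Finset.mul_prod_erase _ _ (Finset.mem_univ k), insertVars_self]
  congr 1
  rw [Finset.prod_subtype (p := fun j => j ≠ k) _ (by simp)]
  refine Finset.prod_congr rfl fun j _ => ?_
  rcases lt_or_gt_of_ne j.2 with hj | hj
  · rw [insertVars_of_lt h k _ _ _ _ hj, sgn_pow_apply_vertexFace]
  · rw [insertVars_of_gt h k _ _ _ _ hj]

/-- All the paths start at the same vertex, so the homotopy of the composite of the two first
permutations factors out. A path continues with a horizontal or with a vertical segment, and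
`listH_listH_insertEdge` is the corresponding recursion for the right side. -/
theorem shuffles_edgeForm (u : List (Perm (Fin r))) (v : List (Perm (Fin s))) (hu : u ≠ [])
    (hv : v ≠ []) :
    (((shuffles u v).map fun t =>
      t.1 • (edgeForm (t.2.map fun y => permCirc h k y.1 y.2) : IntervalForm F n)).sum) =
      (-1 : F) ^ ((u.length - 1) * (v.length - 1)) • insertEdge h k v (edgeForm u) := by
  have key : ∀ (a : Perm (Fin r)) (b : Perm (Fin s)) (v : List (Perm (Fin s)))
      (X : IntervalForm F r), listH (List.ofFn (permCirc h k a b))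
        ((-1 : F) ^ v.length • insertEdge h k (b :: v) X +
          if v = [] then 0 else insertEdge h k v (listH (List.ofFn a) X)) =
        insertEdge h k (b :: v) (listH (List.ofFn a) X) := by
    intro a b v X
    obtain ⟨l₁, l₂, h1, h2⟩ := ofFn_permCirc h k a b
    rw [h1, h2]
    exact listH_listH_insertEdge h v b X l₁ l₂ (h1 ▸ nodup_ofFn_perm a)
  have cons : ∀ (a : Perm (Fin r)) (b : Perm (Fin s)) (c : ℤ)
      (L : List (ℤ × List (Perm (Fin r) × Perm (Fin s)))),
      ((L.map fun t => ((c * t.1, (a, b) :: t.2) : ℤ × List (Perm (Fin r) × Perm (Fin s)))).map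
        fun t => t.1 • (edgeForm (t.2.map fun y => permCirc h k y.1 y.2) : IntervalForm F n)).sum =
      listH (List.ofFn (permCirc h k a b)) (c • (L.map fun t =>
        t.1 • (edgeForm (t.2.map fun y => permCirc h k y.1 y.2) : IntervalForm F n)).sum) := by
    intro a b c L
    induction L with
    | nil => simp
    | cons t L ih =>
      simp only [List.map_cons, List.sum_cons, smul_add, map_add, ih, edgeForm, map_zsmul, mul_smul]
  have cons' : ∀ (a : Perm (Fin r)) (b : Perm (Fin s))
      (L : List (ℤ × List (Perm (Fin r) × Perm (Fin s)))),
      ((L.map fun t => ((t.1, (a, b) :: t.2) : ℤ × List (Perm (Fin r) × Perm (Fin s)))).map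
        fun t => t.1 • (edgeForm (t.2.map fun y => permCirc h k y.1 y.2) : IntervalForm F n)).sum =
      listH (List.ofFn (permCirc h k a b)) ((L.map fun t =>
        t.1 • (edgeForm (t.2.map fun y => permCirc h k y.1 y.2) : IntervalForm F n)).sum) := by
    intro a b L
    simpa using cons a b 1 L
  -- The form at the vertex `1` only reads the value of the inserted cochain at this vertex, which
  -- is again a product of values; an operation of positive degree has no such value (`base'`).
  have base : ∀ b : Perm (Fin s),
      (insertEdge h k [b] (vertexForm 1 : IntervalForm F r)) =
          (vertexForm 1 : IntervalForm F n) := by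
    intro b
    refine MultilinearMap.ext fun f => ?_
    unfold insertEdge
    rw [LinearMap.add_apply, add_apply, if_pos (by simp), LinearMap.add_apply, add_apply,
      insertForm_apply, insertForm_apply, insertForm_apply, vertexForm_insertVars,
      vertexForm_insertVars, vertexForm_insertVars, vertexForm_apply 1 f, prod_blocks h k,
      vertexForm_apply]
    simp [vertexForm_apply, vertexFace_ne_edgeFace, vertexFace_zero_ne_one.symm, mul_comm]
  have base' : ∀ (b b' : Perm (Fin s)) (v : List (Perm (Fin s))),
      (insertEdge h k (b :: b' :: v) (vertexForm 1 : IntervalForm F r) : IntervalForm F n) = 0 := by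
    intro b b' v
    refine MultilinearMap.ext fun f => ?_
    unfold insertEdge
    rw [if_neg (by simp), add_zero, insertForm_apply, vertexForm_insertVars]
    simp [vertexFace_ne_edgeFace]
  induction u, v using shuffles.induct with
  | case1 v => exact absurd rfl hu
  | case2 a u => exact absurd rfl hv
  | case3 a b =>
    have := key a b [] (vertexForm 1)
    rw [base] at this
    simpa [shuffles, edgeForm] using this
  | case4 a b b' v ih =>
    have := key a b (b' :: v) (vertexForm 1)
    rw [base', smul_zero, zero_add, if_neg (List.cons_ne_nil _ _)] at this
    rw [shuffles, cons', ih hu (List.cons_ne_nil _ _)]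
    simpa [edgeForm] using this
  | case5 a a' u b ih =>
    have := key a b [] (edgeForm (a' :: u))
    rw [shuffles, cons', ih (List.cons_ne_nil _ _) hv]
    simpa [edgeForm] using this
  | case6 a a' u b b' v ih₁ ih₂ =>
    have := key a b (b' :: v) (edgeForm (a' :: u))
    rw [shuffles, List.map_append, List.sum_append, cons', cons, ih₁ (List.cons_ne_nil _ _) hv,
      ih₂ hu (List.cons_ne_nil _ _), ← map_add]
    have hz : ∀ (m : ℕ) (Y : IntervalForm F n), ((-1 : ℤ) ^ m) • Y = (-1 : F) ^ m • Y := by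
      intro m Y
      rw [← Int.cast_smul_eq_zsmul F]
      push_cast
      rfl
    rw [show (edgeForm (a :: a' :: u) : IntervalForm F r) =
      listH (List.ofFn a) (edgeForm (a' :: u)) from rfl, ← this,
      ← LinearMap.map_smul (listH (List.ofFn (permCirc h k a b))),
      if_neg (List.cons_ne_nil _ _), smul_add, smul_smul, hz, smul_smul, ← pow_add, ← pow_add]
    simp only [List.length_cons, Nat.add_sub_cancel]
    congr 3
    -- Horizontal first segment: the sign `(-1)^|b' :: v|` of the key identity makes up for the
    -- shorter first sequence. In the other case, the sign in the definition of `shuffles` does so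
    -- for the second sequence.
    · rw [show (u.length + 1) * (v.length + 1) + (v.length + 1) =
        u.length * (v.length + 1) + 2 * (v.length + 1) by ring, pow_add, pow_mul _ 2]
      simp
    · congr 1
      ring

end InsertEdge

/-! ## Table reduction and the forms on the edge -/

section Rows

variable {α M N : Type*}

/-- The sum of the values of a function on the decompositions `b ++ x :: l` of a list, where `b` is
preceded by a given list. -/
def rowSum [AddCommMonoid M] (Y : List α → α → List α → M) : List α → List α → M
  | _, [] => 0
  | a, x :: l => Y a x l + rowSum Y (a ++ [x]) l

variable [AddCommMonoid M] [AddCommMonoid N]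

theorem rowSum_congr {Y Z : List α → α → List α → M} {a l : List α}
    (h : ∀ b x l', a ++ l = b ++ x :: l' → Y b x l' = Z b x l') : rowSum Y a l = rowSum Z a l := by
  induction l generalizing a with
  | nil => rfl
  | cons x l ih =>
    rw [rowSum, rowSum, h a x l rfl, ih fun b y l' e => h b y l' (by simpa using e)]

theorem rowSum_append_left (Y : List α → α → List α → M) (q a l : List α) :
    rowSum Y (q ++ a) l = rowSum (fun b => Y (q ++ b)) a l := by
  induction l generalizing a with
  | nil => rfl
  | cons x l ih => rw [rowSum, rowSum, List.append_assoc, ih]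

theorem map_rowSum (g : M →+ N) (Y : List α → α → List α → M) (a l : List α) :
    g (rowSum Y a l) = rowSum (fun b x l => g (Y b x l)) a l := by
  induction l generalizing a with
  | nil => exact map_zero g
  | cons x l ih => rw [rowSum, rowSum, map_add, ih]

theorem rowSum_append_of_eq_zero (Y : List α → α → List α → M) (a l l' : List α)
    (h : ∀ b x l'', l = b ++ x :: l'' → Y (a ++ b) x (l'' ++ l') = 0) :
    rowSum Y a (l ++ l') = rowSum Y (a ++ l) l' := by
  induction l generalizing a with
  | nil => simp
  | cons x l ih =>
    have h0 := h [] x l rfl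
    rw [List.append_nil] at h0
    rw [List.cons_append, rowSum, h0, zero_add, ih]
    · simp
    · intro b y l'' e
      simpa using h (x :: b) y l'' (by rw [e]; rfl)

theorem rowSum_eq_sum_fin (Y : List α → α → List α → M) (a l : List α) :
    rowSum Y a l = ∑ i : Fin l.length, Y (a ++ l.take i) l[i] (l.drop (i + 1)) := by
  induction l generalizing a with
  | nil => rfl
  | cons x l ih =>
    rw [rowSum, ih]
    simp only [List.length_cons]
    rw [Fin.sum_univ_succ]
    simp

/-- The choice of `j` in a row of the table amounts to a decomposition of the row: the terms before
the index `j` get their final occurrence, the term with index `j` will be repeated. -/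
theorem sum_flatMap_range {β : Type*} (g : List α → List β) (φ : List α → β → M) (a l : List α) :
    (((List.range l.length).flatMap fun j =>
      (g (a ++ l.take j)).map (φ (a ++ l.take (j + 1)))).sum) =
      rowSum (fun b x _ => ((g b).map (φ (b ++ [x]))).sum) a l := by
  induction l generalizing a with
  | nil => rfl
  | cons x l ih =>
    have := ih (a ++ [x])
    simp only [List.append_assoc, List.singleton_append] at this
    rw [rowSum, List.length_cons, List.range_succ_eq_map, List.flatMap_cons, List.sum_append,
      List.flatMap_map]
    simp only [Function.comp_def, List.take_succ_cons, List.take_zero, List.append_nil, this]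

end Rows

section Table

variable {F : Type u} [CommRing F] {r : ℕ}

/-- The product of the homotopies in the variables of a list. -/
def prodH (c : List (Fin r)) : Module.End F (IntervalForm F r) := (c.map hOp).prod

theorem prodH_cons (j : Fin r) (c : List (Fin r)) :
    (prodH (j :: c) : Module.End F (IntervalForm F r)) = hOp j * prodH c := by
  simp [prodH]

theorem prodH_append (c c' : List (Fin r)) :
    (prodH (c ++ c') : Module.End F (IntervalForm F r)) = prodH c * prodH c' := by
  simp [prodH]

theorem prodH_listP {c l : List (Fin r)} (h : ∀ j ∈ c, j ∉ l) :
    (prodH c * listP l : Module.End F (IntervalForm F r)) = listP l * prodH c := by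
  induction c with
  | nil => simp [prodH]
  | cons j c ih =>
    rw [prodH_cons, mul_assoc, ih fun i hi => h i (List.mem_cons_of_mem _ hi), ← mul_assoc,
      hOp_listP (h j List.mem_cons_self), mul_assoc]

theorem prodH_pOp_of_mem {c : List (Fin r)} {j : Fin r} (h : j ∈ c) :
    (prodH c * pOp j : Module.End F (IntervalForm F r)) = 0 := by
  induction c with
  | nil => simp at h
  | cons i c ih =>
    by_cases hj : j ∈ c
    · rw [prodH_cons, mul_assoc, ih hj, mul_zero]
    · obtain rfl : j = i := by simpa [hj] using h
      have h1 : (prodH c * pOp j : Module.End F (IntervalForm F r)) = pOp j * prodH c := by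
        have := prodH_listP (F := F) (c := c) (l := [j]) (fun i hi e => hj (by
          rw [List.mem_singleton] at e; rwa [← e]))
        simpa [listP] using this
      rw [prodH_cons, mul_assoc, h1, ← mul_assoc, hOp_pOp_self, zero_mul]

theorem prodH_hOp_of_mem {c : List (Fin r)} {j : Fin r} (h : j ∈ c) :
    (prodH c * hOp j : Module.End F (IntervalForm F r)) = 0 := by
  induction c with
  | nil => simp at h
  | cons i c ih =>
    by_cases hj : j ∈ c
    · rw [prodH_cons, mul_assoc, ih hj, mul_zero]
    · obtain rfl : j = i := by simpa [hj] using h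
      have h1 : ∀ c : List (Fin r), j ∉ c →
          (hOp j * prodH c * hOp j : Module.End F (IntervalForm F r)) = 0 := by
        intro c hc
        induction c with
        | nil => simp [prodH, hOp_self]
        | cons i c ih =>
          rw [List.mem_cons, not_or] at hc
          rw [prodH_cons, ← mul_assoc, hOp_hOp hc.1, smul_mul_assoc, smul_mul_assoc, mul_assoc,
            mul_assoc, ← mul_assoc (hOp j), ih hc.2, mul_zero, smul_zero]
      rw [prodH_cons, h1 c hj]

theorem prodH_listP_of_mem {c l : List (Fin r)} {j : Fin r} (h : j ∈ c) (hl : j ∈ l) :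
    (prodH c * listP l : Module.End F (IntervalForm F r)) = 0 := by
  rw [← pOp_listP_of_mem hl, ← mul_assoc, prodH_pOp_of_mem h, zero_mul]

theorem listP_hOp_of_mem {l : List (Fin r)} {j : Fin r} (h : j ∈ l) :
    (listP l * hOp j : Module.End F (IntervalForm F r)) = 0 := by
  rw [← pOp_listP_of_mem h, pOp_listP, mul_assoc, pOp_hOp_self, mul_zero]

/-- For `j` in `U`, the projection over `U` kills `h_j` and absorbs `p_j`. This is why table
reduction omits the values which are already used. -/
theorem listP_listH_filter (U l : List (Fin r)) :
    (listP U * listH l : Module.End F (IntervalForm F r)) =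
      listP U * listH (l.filter fun x => x ∉ U) := by
  induction l with
  | nil => rfl
  | cons j l ih =>
    by_cases h : j ∈ U
    · rw [List.filter_cons_of_neg (by simpa using h), listH, mul_add, listP_hOp_of_mem h, zero_add,
        ← mul_assoc, ← pOp_listP, pOp_listP_of_mem h, ih]
    · rw [List.filter_cons_of_pos (by simpa using h), listH, listH, mul_add, mul_add, ← mul_assoc,
        ← pOp_listP, mul_assoc, ih, ← mul_assoc, ← mul_assoc (listP U), pOp_listP]

theorem listP_listH_eq_rowSum (a l : List (Fin r)) :
    (listP a * listH l : Module.End F (IntervalForm F r)) =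
      rowSum (fun b x _ => listP b * hOp x) a l := by
  induction l generalizing a with
  | nil => simp [listH, rowSum]
  | cons j l ih =>
    rw [rowSum, ← ih, listH, mul_add, listP_append, listP, listP, mul_one, mul_assoc]

/-- The form given by a decomposition `b ++ x :: l` of a surjection: the interval `x` contains the
two vertices, the preceding intervals are reduced to the vertex `0`, and the following intervals are
reduced to the vertex `1`. -/
def splitTerm (γ : ℕ → F) (b : List (Fin r)) (x : Fin r) (l : List (Fin r)) : IntervalForm F r :=
  if (b ++ [x]).Nodup ∧ (x :: l).Nodup then
    γ ((b.filter fun y => y ∈ l).length + 1) •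
      listP (b.filter fun y => y ∉ l) (prodH ((b.filter fun y => y ∈ l) ++ [x]) (vertexForm 1))
  else 0

/-- A value which is not used either is kept in the first row or remains unused in the next one, and
the last row takes all that remains. -/
theorem mem_of_mem_tableReduction {used : List (Fin r)} {ws : List (Perm (Fin r))}
    {t : List (Fin r)} (ht : t ∈ tableReduction used ws) (hws : ws ≠ []) {k : Fin r}
    (hk : k ∉ used) : k ∈ t := by
  induction ws generalizing used t with
  | nil => exact absurd rfl hws
  | cons w ws ih =>
    have hrow : k ∈ (List.ofFn w).filter fun x => x ∉ used := by
      simpa [mem_ofFn_perm] using hk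
    cases ws with
    | nil =>
      rw [tableReduction, List.mem_singleton] at ht
      rwa [ht]
    | cons w' ws =>
      rw [tableReduction, List.mem_flatMap] at ht
      obtain ⟨j, -, ht⟩ := ht
      obtain ⟨t', ht', rfl⟩ := List.mem_map.1 ht
      rw [List.mem_append]
      by_cases hj : k ∈ ((List.ofFn w).filter fun x => x ∉ used).take j
      · left
        rw [List.take_add_one, List.mem_append]
        exact Or.inl hj
      · right
        exact ih ht' (List.cons_ne_nil _ _) fun e => (List.mem_append.1 e).elim hk hj

theorem splitTerm_of_not_nodup (γ : ℕ → F) {b : List (Fin r)} (x : Fin r) (l : List (Fin r))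
    (h : ¬ (b ++ [x]).Nodup) : splitTerm γ b x l = 0 := if_neg fun h' => h h'.1

theorem rowSum_splitTerm_of_not_nodup (γ : ℕ → F) {q : List (Fin r)} (t : List (Fin r))
    (h : ¬ q.Nodup) : rowSum (splitTerm γ) q t = 0 := by
  induction t generalizing q with
  | nil => rfl
  | cons x t ih =>
    have h' : ¬ (q ++ [x]).Nodup := fun e => h (List.nodup_append.1 e).1
    rw [rowSum, splitTerm_of_not_nodup γ x t h', ih h', add_zero]

/-- Expansion of `H_{w₀} ⋯ H_{w_d}` matches table reduction term by term. Here `q` is the part of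
the surjection already written and `U` consists of the values in `q` which have had their final
occurrence; a value of `q` outside `U` has ended a row, contributes a homotopy, and occurs again
below, so that its interval cut contains the edge. The function `γ` stands for a sign which only
depends on the number of inputs evaluated on the edge. With empty `U` and `q`, the right side is a
multiple of the edge form. -/
theorem sum_tableReduction (γ : ℕ → F) (ws : List (Perm (Fin r))) (hws : ws ≠ [])
    (U q : List (Fin r)) (hq : q.Nodup) (hU : ∀ j ∈ U, j ∈ q) :
    ((tableReduction U ws).map (rowSum (splitTerm γ) q)).sum =
      γ ((q.filter fun x => x ∉ U).length + ws.length) •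
        listP U (prodH (q.filter fun x => x ∉ U) (edgeForm ws)) := by
  induction ws generalizing U q with
  | nil => exact absurd rfl hws
  | cons w ws ih =>
    set cs := q.filter fun x => x ∉ U with hcs
    set row := (List.ofFn w).filter fun x => x ∉ U with hrow
    have hdis : ∀ j ∈ cs, j ∉ U := fun j hj => by simpa using (List.mem_filter.1 hj).2
    have hrow_nodup : row.Nodup := (nodup_ofFn_perm w).filter _
    have hrowU : ∀ j, j ∈ row ↔ j ∉ U := fun j => by simp [hrow, mem_ofFn_perm]
    -- Only the row of unused values matters in the first homotopy, and its expansion `∑ P_b h_x`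
    -- runs over the decompositions of this row.
    have expand : γ (cs.length + (w :: ws).length) •
        listP U (prodH cs (edgeForm (w :: ws) : IntervalForm F r)) =
        rowSum (fun b x _ => γ (cs.length + (w :: ws).length) •
          listP U (prodH cs (listP b (hOp x (edgeForm ws))))) [] row := by
      have h1 : (listP U * prodH cs * listH (List.ofFn w) : Module.End F (IntervalForm F r)) =
          listP U * prodH cs * (listP [] * listH row) := by
        rw [← prodH_listP hdis, mul_assoc, listP_listH_filter, listP, one_mul, mul_assoc]
      have h2 := LinearMap.congr_fun h1 (edgeForm ws)
      rw [listP_listH_eq_rowSum] at h2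
      simp only [Module.End.mul_apply] at h2
      rw [edgeForm, h2]
      have h3 := map_rowSum
        ((γ (cs.length + (w :: ws).length) • ((listP U * prodH cs : Module.End F
            (IntervalForm F r)) ∘ₗ
          LinearMap.applyₗ (edgeForm ws : IntervalForm F r)) :
            Module.End F (IntervalForm F r) →ₗ[F] IntervalForm F r).toAddMonoidHom)
        (fun b x _ => listP b * hOp x) [] row
      exact h3
    -- the terms vanish if a value is repeated
    have vanish : ∀ (b : List (Fin r)) (x : Fin r) (G : IntervalForm F r),
        (∃ l, row = b ++ x :: l) → ¬ (q ++ (b ++ [x])).Nodup → prodH cs (listP b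
            (hOp x G)) = 0 := by
      rintro b x G ⟨l, hl⟩ hnd
      have hbx : (b ++ [x]).Nodup := by
        rw [hl] at hrow_nodup
        refine hrow_nodup.sublist ?_
        simp
      have hmem : ∀ j ∈ b ++ [x], j ∈ row := by
        intro j hj
        rw [hl]
        simp only [List.mem_append, List.mem_singleton, List.mem_cons] at hj ⊢
        tauto
      obtain ⟨j, hj, hjb⟩ : ∃ j ∈ cs, j ∈ b ++ [x] := by
        by_contra hcon
        refine hnd (List.nodup_append.2 ⟨hq, hbx, fun i hi j hj e => hcon ⟨i, ?_, e ▸ hj⟩⟩)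
        rw [hcs, List.mem_filter]
        exact ⟨hi, by simpa using (hrowU i).1 (hmem i (e ▸ hj))⟩
      rw [← Module.End.mul_apply, ← Module.End.mul_apply]
      by_cases hjb' : j ∈ b
      · rw [prodH_listP_of_mem hj hjb', zero_mul, LinearMap.zero_apply]
      · have : j = x := by
          rw [List.mem_append, List.mem_singleton] at hjb
          exact hjb.resolve_left hjb'
        subst this
        rw [mul_assoc, ← hOp_listP hjb', ← mul_assoc, prodH_hOp_of_mem hj, zero_mul,
            LinearMap.zero_apply]
    -- Without repetition, the projections over `b` commute with the homotopies already present, and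
    -- the new values can be added to `U` and to the list of pending values.
    have combine : ∀ (b : List (Fin r)) (x : Fin r) (G : IntervalForm F r),
        (q ++ (b ++ [x])).Nodup → listP (U ++ b) (prodH (cs ++ [x]) G) =
          listP U (prodH cs (listP b (hOp x G))) := by
      intro b x G hnd
      have h1 : ∀ j ∈ cs, j ∉ b := fun j hj hjb =>
        (List.nodup_append.1 hnd).2.2 j (List.mem_filter.1 hj).1 j
          (List.mem_append_left _ hjb) rfl
      have h2 := LinearMap.congr_fun (prodH_listP (F := F) h1) (hOp x G)
      simp only [Module.End.mul_apply] at h2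
      rw [h2, listP_append, prodH_append, Module.End.mul_apply, Module.End.mul_apply]
      simp [prodH]
    rw [expand]
    cases ws with
    | nil =>
      rw [tableReduction, List.map_singleton, List.sum_singleton]
      have h1 := rowSum_append_left (splitTerm γ) q [] row
      rw [List.append_nil] at h1
      rw [h1]
      refine rowSum_congr fun b x l hl => ?_
      rw [List.nil_append] at hl
      by_cases hnd : (q ++ (b ++ [x])).Nodup
      · have hl' := hrow_nodup
        rw [hl] at hl'
        obtain ⟨hb, hxl, hbl⟩ := List.nodup_append.1 hl'
        have hbl' : ∀ y ∈ b, y ∉ l := fun y hy hyl => hbl y hy y (List.mem_cons_of_mem _ hyl) rfl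
        have hqb : ∀ y ∈ q, y ∉ b ∧ y ≠ x := fun y hy =>
          ⟨fun hyb => (List.nodup_append.1 hnd).2.2 y hy y (List.mem_append_left _ hyb) rfl,
            fun hyx => (List.nodup_append.1 hnd).2.2 y hy x (by simp) hyx⟩
        have hlU : ∀ y ∈ l, y ∉ U := fun y hy => (hrowU y).1 (by rw [hl]; simp [hy])
        -- In the last row all the unused values occur, and a value of `q` cannot be in `b` nor
        -- equal to `x`; hence the pending values are those found to the right of the cut.
        have hqU : ∀ y ∈ q, (y ∈ l ↔ y ∉ U) := fun y hy =>
          ⟨hlU y, fun hyU => by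
            have := (hrowU y).2 hyU
            rw [hl, List.mem_append, List.mem_cons] at this
            obtain ⟨h2, h3⟩ := hqb y hy
            tauto⟩
        have hf : (q ++ b).filter (fun y => y ∈ l) = cs := by
          rw [List.filter_append, (List.filter_eq_nil_iff (l := b)).2 (by simpa using hbl'),
            List.append_nil]
          exact List.filter_congr fun y hy => by simp only [hqU y hy]
        have hP : (listP ((q ++ b).filter fun y => y ∉ l) : Module.End F (IntervalForm F r)) =
            listP (U ++ b) := by
          refine listP_eq_of_mem_iff fun y => ?_
          simp only [List.mem_filter, List.mem_append, decide_eq_true_eq]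
          constructor
          · rintro ⟨hy | hy, hyl⟩
            · rw [hqU y hy, not_not] at hyl
              exact Or.inl hyl
            · exact Or.inr hy
          · rintro (hy | hy)
            · exact ⟨Or.inl (hU y hy), fun hyl => hlU y hyl hy⟩
            · exact ⟨Or.inr hy, hbl' y hy⟩
        rw [splitTerm, if_pos ⟨by rwa [List.append_assoc], hxl⟩, hf, hP, combine b x _ hnd]
        rfl
      · rw [vanish b x _ ⟨l, hl⟩ hnd, map_zero, smul_zero, splitTerm_of_not_nodup]
        rwa [List.append_assoc]
    | cons w' ws =>
      have h1 := sum_flatMap_range (fun b => tableReduction (U ++ b) (w' :: ws))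
        (fun b t => rowSum (splitTerm γ) q (b ++ t)) [] row
      simp only [List.nil_append] at h1
      have h2 : (tableReduction U (w :: w' :: ws)).map (rowSum (splitTerm γ) q) =
          (List.range row.length).flatMap fun j => (tableReduction (U ++ row.take j) (w' :: ws)).map
            fun t => rowSum (splitTerm γ) q (row.take (j + 1) ++ t) := by
        rw [tableReduction, List.map_flatMap]
        simp only [List.map_map]
        rfl
      rw [h2, h1]
      refine rowSum_congr fun b x l hl => ?_
      rw [List.nil_append] at hl
      have hl' := hrow_nodup
      rw [hl] at hl'
      obtain ⟨hb, hxl, hbl⟩ := List.nodup_append.1 hl'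
      have hxb : x ∉ b := fun hx => hbl x hx x List.mem_cons_self rfl
      have hxU : x ∉ U := (hrowU x).1 (by rw [hl]; simp)
      -- No cut inside `b ++ [x]` contributes, as `x` occurs again in `t` and would be found twice
      -- from the cut on. Only the cuts in the last row survive.
      have h3 : ∀ t ∈ tableReduction (U ++ b) (w' :: ws),
          rowSum (splitTerm γ) q (b ++ [x] ++ t) =
            rowSum (splitTerm γ) (q ++ (b ++ [x])) t := by
        intro t ht
        have hxt : x ∈ t := mem_of_mem_tableReduction ht (List.cons_ne_nil _ _) fun e =>
          (List.mem_append.1 e).elim hxU hxb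
        refine rowSum_append_of_eq_zero _ _ _ _ fun b' y l' e => if_neg fun hnd => ?_
        have hx : x ∈ y :: l' := by
          have := congrArg List.getLast? e
          rw [List.getLast?_append_of_ne_nil _ (List.cons_ne_nil _ _),
            List.getLast?_append_of_ne_nil _ (List.cons_ne_nil _ _),
                List.getLast?_singleton] at this
          exact List.mem_of_getLast? this.symm
        have hnd' : ((y :: l') ++ t).Nodup := hnd.2
        exact (List.nodup_append.1 hnd').2.2 x hx x hxt rfl
      rw [List.map_congr_left h3]
      by_cases hnd : (q ++ (b ++ [x])).Nodup
      · have hqb : ∀ y ∈ q, y ∉ b := fun y hy hyb =>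
          (List.nodup_append.1 hnd).2.2 y hy y (List.mem_append_left _ hyb) rfl
        have hf : (q ++ (b ++ [x])).filter (fun y => y ∉ U ++ b) = cs ++ [x] := by
          rw [List.filter_append, List.filter_append,
            (List.filter_eq_nil_iff (l := b)).2 (by simp +contextual), List.nil_append,
            List.filter_cons_of_pos (by simp [hxU, hxb]), List.filter_nil]
          congr 1
          exact List.filter_congr fun y hy => by simp [hqb y hy]
        rw [ih (List.cons_ne_nil _ _) (U ++ b) (q ++ (b ++ [x])) hnd, hf, combine b x _ hnd,
          List.length_append]
        · congr 2
          simp only [List.length_cons, List.length_nil]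
          omega
        · intro j hj
          rcases List.mem_append.1 hj with hj | hj
          · exact List.mem_append_left _ (hU j hj)
          · exact List.mem_append_right _ (List.mem_append_left _ hj)
      · rw [vanish b x _ ⟨l, hl⟩ hnd, map_zero, smul_zero]
        refine List.sum_eq_zero fun y hy => ?_
        obtain ⟨t, -, rfl⟩ := List.mem_map.1 hy
        exact rowSum_splitTerm_of_not_nodup γ t hnd

end Table

/-! ### Inversions of weighted sequences -/

section PairSum

variable {r : ℕ}

/-- The sum of the products of the weights in the inversions of a sequence. -/
def pairSum : List (Fin r × ℕ) → ℕ
  | [] => 0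
  | y :: l => (l.map fun z => if z.1 < y.1 then y.2 * z.2 else 0).sum + pairSum l

theorem sum_inversions_eq_pairSum {L : ℕ} (a : Fin L → Fin r) (b : Fin L → ℕ) :
    ∑ x : Fin L × Fin L with x.1 < x.2 ∧ a x.2 < a x.1, b x.1 * b x.2 =
      pairSum (List.ofFn fun i => (a i, b i)) := by
  induction L with
  | zero => rfl
  | succ L ih =>
    have h1 := ih (fun i => a i.succ) (fun i => b i.succ)
    rw [Finset.sum_filter, Fintype.sum_prod_type] at h1 ⊢
    rw [List.ofFn_succ, pairSum, ← h1, Fin.sum_univ_succ, Fin.sum_univ_succ, List.map_ofFn,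
      List.sum_ofFn]
    congr 1
    · simp
    · refine Finset.sum_congr rfl fun i _ => ?_
      rw [Fin.sum_univ_succ]
      simp

theorem pairSum_filter (v : List (Fin r × ℕ)) :
    pairSum (v.filter fun z => z.2 ≠ 0) = pairSum v := by
  induction v with
  | nil => rfl
  | cons y v ih =>
    by_cases hy : y.2 = 0
    · rw [List.filter_cons_of_neg (by simpa using hy), ih, pairSum, List.sum_eq_zero, zero_add]
      intro z hz
      obtain ⟨z, -, rfl⟩ := List.mem_map.1 hz
      simp [hy]
    · rw [List.filter_cons_of_pos (by simpa using hy), pairSum, pairSum, ih]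
      congr 1
      clear ih
      induction v with
      | nil => rfl
      | cons z v ih =>
        by_cases hz : z.2 = 0
        · rw [List.filter_cons_of_neg (by simpa using hz), ih]
          simp [hz]
        · rw [List.filter_cons_of_pos (by simpa using hz), List.map_cons, List.map_cons,
            List.sum_cons, List.sum_cons, ih]

/-- The square of the sum of the indicator function counts each pair twice, plus the diagonal. -/
theorem sum_pairs_indicator (E : Finset (Fin r)) :
    ∑ y : Fin r × Fin r with y.1 < y.2, (if y.1 ∈ E then 1 else 0) * (if y.2 ∈ E then 1 else 0) =
      E.card.choose 2 := by
  set g : Fin r → ℕ := fun a => if a ∈ E then 1 else 0 with hg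
  have hE : ∑ a, g a = E.card := by simp [hg]
  have h1 : ∀ a b, g a * g b = (if a < b then g a * g b else 0) + (if a = b then g a else 0) +
      if b < a then g b * g a else 0 := by
    intro a b
    rcases lt_trichotomy a b with e | e | e
    · simp [e, e.ne, e.not_gt]
    · subst e
      by_cases h : a ∈ E <;> simp [hg, h]
    · simp [e, e.ne', e.not_gt, mul_comm]
  have h2 : (∑ a, g a) * ∑ b, g b = 2 * (∑ a, ∑ b, if a < b then g a * g b else 0) + ∑ a, g a := by
    rw [Finset.sum_mul_sum, Finset.sum_congr rfl fun a _ => Finset.sum_congr rfl fun b _ => h1 a b]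
    simp only [Finset.sum_add_distrib]
    rw [Finset.sum_comm (f := fun a b => if b < a then g b * g a else 0)]
    simp only [Finset.sum_ite_eq, Finset.mem_univ, if_true]
    ring
  rw [Finset.sum_filter, Fintype.sum_prod_type, Nat.choose_two_right]
  rw [hE] at h2
  have h3 : E.card * (E.card - 1) = 2 * (∑ a, ∑ b, if a < b then g a * g b else 0) := by
    rw [Nat.mul_sub, mul_one, h2, Nat.add_sub_cancel]
  rw [h3, Nat.mul_div_cancel_left _ two_pos]

end PairSum

/-! ### Values of products of homotopies and projections -/

section Evaluation

variable {F : Type u} [CommRing F] {r : ℕ}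

theorem listP_apply (l : List (Fin r)) (G : IntervalForm F r) (f : Fin r → Face 1 → F) :
    listP l G f = G fun k => if k ∈ l then intervalP F (f k) else f k := by
  induction l generalizing f with
  | nil => simp [listP]
  | cons j l ih =>
    rw [listP, Module.End.mul_apply, pOp, evenOp_eq_update, ih]
    congr 1
    funext k
    have hp : intervalP F (intervalP F (f k)) = intervalP F (f k) :=
      LinearMap.congr_fun intervalP_P (f k)
    by_cases h : k = j
    · subst h
      simp [hp]
    · simp [h]

/-- Each homotopy `h_j` replaces the vertex `1` by the edge in the variable `j`. Its sign operators
are only felt in the variables `k < j` which are evaluated on the edge, so there is one sign for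
each inversion of `c`. -/
theorem prodH_vertexForm (c : List (Fin r)) (hc : c.Nodup) (f : Fin r → Face 1 → F) :
    prodH c (vertexForm 1) f = (-1) ^ pairSum (c.map fun a => (a, 1)) *
      ∏ k, if k ∈ c then f k edgeFace else f k (vertexFace 1) := by
  induction c generalizing f with
  | nil => simp [prodH, pairSum, vertexForm_apply]
  | cons j c ih =>
    rw [List.nodup_cons] at hc
    obtain ⟨hj, hc⟩ := hc
    have h1 : ∀ k, (if k ∈ c then
          (if k < j then intervalSgn F else if k = j then intervalH F else 1) (f k) edgeFace
        else (if k < j then intervalSgn F else if k = j then intervalH F else 1) (f k)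
          (vertexFace 1)) =
        (if k ∈ c ∧ k < j then (-1 : F) else 1) *
          if k ∈ j :: c then f k edgeFace else f k (vertexFace 1) := by
      intro k
      by_cases hk : k ∈ c
      · have hkj : k ≠ j := fun e => hj (e ▸ hk)
        by_cases h : k < j <;> simp [hk, h, hkj, intervalSgn_apply]
      · by_cases h : k = j
        · subst h
          simp [hk, intervalH_apply]
        · by_cases h' : k < j <;> simp [hk, h, h', intervalSgn_apply]
    have h2 : ∏ k : Fin r, (if k ∈ c ∧ k < j then (-1 : F) else 1) =
        (-1) ^ ((c.map fun a => (a, 1)).map fun z : Fin r × ℕ =>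
          if z.1 < j then 1 * z.2 else 0).sum := by
      clear ih h1
      induction c with
      | nil => simp
      | cons i c ih =>
        rw [List.nodup_cons] at hc
        obtain ⟨hi, hc⟩ := hc
        rw [List.mem_cons, not_or] at hj
        have h3 : ∀ k, (if k ∈ i :: c ∧ k < j then (-1 : F) else 1) =
            (if k = i then (if i < j then (-1 : F) else 1) else 1) *
              if k ∈ c ∧ k < j then (-1 : F) else 1 := by
          intro k
          by_cases h : k = i
          · subst h; simp [hi]
          · simp [h]
        simp only [h3, Finset.prod_mul_distrib, List.map_cons, List.sum_cons, pow_add]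
        rw [ih hj.2 hc, Finset.prod_ite_eq' Finset.univ i]
        congr 1
        by_cases h : i < j <;> simp [h]
    rw [prodH_cons, Module.End.mul_apply, hOp, oddOp_apply, ih hc, List.map_cons, pairSum,
      Finset.prod_congr rfl fun k _ => h1 k, Finset.prod_mul_distrib, h2, pow_add]
    ring

theorem listP_prodH_vertexForm (A c : List (Fin r)) (hc : c.Nodup) (hA : ∀ k ∈ A, k ∉ c)
    (f : Fin r → Face 1 → F) :
    listP A (prodH c (vertexForm 1)) f = (-1) ^ pairSum (c.map fun a => (a, 1)) *
      ∏ k, if k ∈ c then f k edgeFace else if k ∈ A then f k (vertexFace 0)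
        else f k (vertexFace 1) := by
  rw [listP_apply, prodH_vertexForm c hc]
  congr 1
  refine Finset.prod_congr rfl fun k _ => ?_
  by_cases hk : k ∈ A
  · simp [hk, hA k hk, intervalP_apply]
  · simp [hk]

end Evaluation

/-! ### Interval cuts of the edge -/

section EdgeCuts

variable {F : Type u} [CommRing F] {r : ℕ}

/-- The cut of the edge in which the interval `i` contains the two vertices. -/
def edgeCut {L : ℕ} (i : Fin L) (j : Fin (L + 1)) : Fin (1 + 1) := if j.val ≤ i.val then 0 else 1

theorem edgeCut_injective (L : ℕ) : Function.Injective (edgeCut (L := L)) := by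
  intro i i' h
  have key : ∀ i i' : Fin L, edgeCut i = edgeCut i' → i ≤ i' := by
    intro i i' h
    have := congrFun h i.castSucc
    by_contra hlt
    have h1 : ¬ (i : ℕ) ≤ i' := hlt
    simp [edgeCut, h1] at this
  exact le_antisymm (key _ _ h) (key _ _ h.symm)

/-- A monotone sequence from `0` to `1` jumps exactly once, and `i` is the place of the jump. -/
theorem mem_intervalCuts_one {L : ℕ} (c : Fin (L + 1) → Fin (1 + 1)) :
    c ∈ intervalCuts L 1 ↔ ∃ i, edgeCut i = c := by
  simp only [intervalCuts, Finset.mem_filter, Finset.mem_univ, true_and]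
  constructor
  · rintro ⟨hm, h0, h1⟩
    obtain ⟨i, hi, hi'⟩ : ∃ i : Fin L, c i.castSucc = 0 ∧ c i.succ ≠ 0 := by
      by_contra! hcon
      have : ∀ j, c j = 0 := Fin.induction h0 hcon
      rw [this] at h1
      exact absurd h1 (by decide)
    refine ⟨i, funext fun j => ?_⟩
    have h01 : ∀ z : Fin (1 + 1), z ≠ 0 → z = 1 := by decide
    by_cases hj : j.val ≤ i.val
    · have : c j ≤ c i.castSucc := hm (Fin.le_def.2 hj)
      rw [edgeCut, if_pos hj]
      rw [hi] at this
      exact (Fin.le_zero_iff.1 this).symm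
    · have : c i.succ ≤ c j := hm (Fin.le_def.2 (by rw [Fin.val_succ]; omega))
      rw [edgeCut, if_neg hj]
      rw [h01 _ hi'] at this
      exact (h01 _ fun e => by rw [e] at this; exact absurd this (by decide)).symm
  · rintro ⟨i, rfl⟩
    refine ⟨fun a b hab => ?_, ?_, ?_⟩
    · have : (a : ℕ) ≤ b := hab
      unfold edgeCut
      split_ifs
      · exact le_rfl
      · exact Fin.zero_le _
      · omega
      · exact le_rfl
    · simp [edgeCut]
    · have : ¬ L ≤ i := by omega
      simp [edgeCut, this, Fin.last]

theorem sum_intervalCuts_one {M : Type*} [AddCommMonoid M] {L : ℕ}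
    (g : (Fin (L + 1) → Fin (1 + 1)) → M) :
    ∑ c ∈ intervalCuts L 1, g c = ∑ i : Fin L, g (edgeCut i) := by
  symm
  refine Finset.sum_bij (fun i _ => edgeCut i) (fun i _ => (mem_intervalCuts_one _).2 ⟨i, rfl⟩)
    (fun i _ j _ h => edgeCut_injective L h) (fun c hc => ?_) (fun _ _ => rfl)
  obtain ⟨i, hi⟩ := (mem_intervalCuts_one c).1 hc
  exact ⟨i, Finset.mem_univ i, hi⟩

theorem List.ofFn_eq_of_split {α β : Type*} {b l : List α} {x : α}
    (g : Fin (b ++ x :: l).length → β) (g₁ g₂ : α → β) (y : β)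
    (h₁ : ∀ i, i.val < b.length → g i = g₁ ((b ++ x :: l).get i))
    (h₂ : ∀ i, i.val = b.length → g i = y)
    (h₃ : ∀ i, b.length < i.val → g i = g₂ ((b ++ x :: l).get i)) :
    List.ofFn g = b.map g₁ ++ y :: l.map g₂ := by
  refine List.ext_getElem (by simp; omega) fun i hi hi' => ?_
  rw [List.getElem_ofFn]
  simp only [List.getElem_append, List.getElem_cons, List.length_map, List.getElem_map]
  split_ifs with e1 e2
  · rw [h₁ _ e1, List.get_eq_getElem, List.getElem_append_left]
  · exact h₂ _ (by simp only; omega)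
  · rw [h₃ _ (by simp only; omega), List.get_eq_getElem, List.getElem_append_right
      (by simpa using e1),
      List.getElem_cons, dif_neg e2]

end EdgeCuts

/-! ### The contribution of one cut of the edge -/

section EdgeTerm

variable {F : Type u} [CommRing F] {r : ℕ}

theorem flatten_map_ite {α β : Type*} [DecidableEq α] (l : List α) (k : α) (z : β) :
    (l.map fun a => if a = k then [z] else []).flatten = List.replicate (l.count k) z := by
  induction l with
  | nil => rfl
  | cons a l ih =>
    rw [List.map_cons, List.flatten_cons, ih]
    by_cases h : a = k
    · subst h
      simp [List.replicate_succ]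
    · simp [h, List.count_cons_of_ne h]

theorem intervalCut_eq_flatten {L m : ℕ} (u : Fin L → Fin r) (c : Fin (L + 1) → Fin (m + 1))
    {β : Type} (x : List β) (k : Fin r) : intervalCut u c x k = (List.ofFn fun i => if u i = k then
      (x.drop (c i.castSucc)).take ((c i.succ : ℕ) + 1 - (c i.castSucc : ℕ)) else []).flatten := by
  rw [intervalCut, List.flatMap, List.ofFn_eq_map]

variable {b l : List (Fin r)} {x : Fin r}

/-- The position of the middle term of a decomposition. -/
def splitPos (b : List (Fin r)) (x : Fin r) (l : List (Fin r)) : Fin (b ++ x :: l).length :=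
  ⟨b.length, by simp⟩

theorem intervalCut_edgeCut (k : Fin r) :
    intervalCut (b ++ x :: l).get (edgeCut (splitPos b x l)) [(0 : Fin 2), 1] k =
      List.replicate (b.count k) 0 ++ ((if x = k then [0, 1] else []) ++
        List.replicate (l.count k) 1) := by
  rw [intervalCut_eq_flatten, List.ofFn_eq_of_split _ (fun a => if a = k then [0] else [])
    (fun a => if a = k then [1] else []) (if x = k then [0, 1] else []), List.flatten_append,
    List.flatten_cons, flatten_map_ite, flatten_map_ite]
  · intro i hi
    have h1 : edgeCut (splitPos b x l) i.castSucc = 0 := if_pos hi.le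
    have h2 : edgeCut (splitPos b x l) i.succ = 0 := if_pos (by
      change (i : ℕ) + 1 ≤ b.length
      omega)
    rw [h1, h2]
    rfl
  · intro i hi
    have h1 : edgeCut (splitPos b x l) i.castSucc = 0 := if_pos hi.le
    have h2 : edgeCut (splitPos b x l) i.succ = 1 := if_neg (by simp [splitPos, hi])
    have h3 : (b ++ x :: l).get i = x := by
      rw [List.get_eq_getElem]
      simp [hi]
    rw [h1, h2, h3]
    rfl
  · intro i hi
    have h1 : edgeCut (splitPos b x l) i.castSucc = 1 := if_neg (by simpa [splitPos] using hi)
    have h2 : edgeCut (splitPos b x l) i.succ = 1 := if_neg (by simp [splitPos]; omega)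
    rw [h1, h2]
    rfl

theorem seqEval_replicate_of_two_le {n : ℕ} {x : Fin (n + 1)} {c : ℕ} (hc : 2 ≤ c)
    (l l' : List (Fin (n + 1))) (f : Face n → F) :
    seqEval F (l ++ (List.replicate c x ++ l')) f = 0 := by
  rw [seqEval, if_neg, LinearMap.zero_apply]
  intro h
  have h1 := (List.pairwise_append.1 (List.pairwise_append.1 h).2.1).1
  rw [List.pairwise_replicate] at h1
  rcases h1 with h1 | h1
  · omega
  · exact lt_irrefl _ h1

theorem seqEval_edge (f : Face 1 → F) : seqEval F [(0 : Fin 2), 1] f = f edgeFace := by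
  have : [(0 : Fin 2), 1].toFinset = Finset.univ := by decide
  rw [seqEval, if_pos (by simp), this]
  simp [faceEval, edgeFace]

theorem seqEval_singleton {n : ℕ} (x : Fin (n + 1)) (f : Face n → F) :
    seqEval F [x] f = f (vertexFace x) := by
  rw [seqEval, if_pos (by simp)]
  simp [faceEval, vertexFace]

/-- A value repeated on the same side of the cut, or shared with the middle interval, makes a vertex
occur twice in some `C_(k)`, which is then degenerate. -/
theorem edgeCut_prod_eq_zero (h : ¬ ((b ++ [x]).Nodup ∧ (x :: l).Nodup)) (f : Fin r → Face 1 → F) :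
    ∏ k, seqEval F (intervalCut (b ++ x :: l).get (edgeCut (splitPos b x l)) [(0 : Fin 2), 1] k)
      (f k) = 0 := by
  obtain ⟨k, hk⟩ : ∃ k, 2 ≤ b.count k ∨ 2 ≤ l.count k ∨ (x = k ∧ (k ∈ b ∨ k ∈ l)) := by
    by_contra! hcon
    refine h ⟨?_, ?_⟩
    · refine List.nodup_append.2 ⟨List.nodup_iff_count_le_one.2 fun k => ?_,
        List.nodup_singleton x, ?_⟩
      · have := (hcon k).1
        omega
      · rintro a ha y hy rfl
        rw [List.mem_singleton] at hy
        subst hy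
        exact ((hcon a).2.2 rfl).1 ha
    · refine List.nodup_cons.2 ⟨((hcon x).2.2 rfl).2, List.nodup_iff_count_le_one.2 fun k => ?_⟩
      have := (hcon k).2.1
      omega
  refine Finset.prod_eq_zero (Finset.mem_univ k) ?_
  rw [intervalCut_edgeCut]
  rcases hk with hk | hk | ⟨rfl, hk⟩
  · exact seqEval_replicate_of_two_le hk [] _ _
  · have := seqEval_replicate_of_two_le (F := F) (x := (1 : Fin 2)) hk
      (List.replicate (b.count k) (0 : Fin 2) ++
      if x = k then [0, 1] else []) [] (f k)
    rwa [List.append_nil, List.append_assoc] at this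
  · rw [if_pos rfl, seqEval, if_neg, LinearMap.zero_apply]
    intro hp
    rw [List.pairwise_append] at hp
    obtain ⟨-, h2, h3⟩ := hp
    rcases hk with hk | hk
    · have := h3 0 (List.mem_replicate.2 ⟨(List.count_pos_iff.2 hk).ne', rfl⟩) 0 (by simp)
      exact lt_irrefl _ this
    · have := (List.pairwise_append.1 h2).2.2 1 (by simp) 1
        (List.mem_replicate.2 ⟨(List.count_pos_iff.2 hk).ne', rfl⟩)
      exact lt_irrefl _ this

theorem get_left {i : Fin (b ++ x :: l).length} (hi : i.val < b.length) :
    (b ++ x :: l).get i = b[i.val] := by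
  rw [List.get_eq_getElem, List.getElem_append_left]

theorem get_middle {i : Fin (b ++ x :: l).length} (hi : i.val = b.length) :
    (b ++ x :: l).get i = x := by
  rw [List.get_eq_getElem]
  simp [hi]

theorem get_right {i : Fin (b ++ x :: l).length} (hi : b.length < i.val)
    (hi' : i.val - b.length - 1 < l.length) : (b ++ x :: l).get i = l[i.val - b.length - 1] := by
  rw [List.get_eq_getElem, List.getElem_append_right hi.le, List.getElem_cons,
    dif_neg (by omega)]

theorem right_lt {i : Fin (b ++ x :: l).length} (hi : b.length < i.val) :
    i.val - b.length - 1 < l.length := by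
  have h1 := i.2
  simp only [List.length_append, List.length_cons] at h1
  omega

/-- The value does not occur again before or at the cut, so a later occurrence can only be on the
right. -/
theorem isInner_left (hb : (b ++ [x]).Nodup) {i : Fin (b ++ x :: l).length}
    (hi : i.val < b.length) :
    IsInner (b ++ x :: l).get i ↔ (b ++ x :: l).get i ∈ l := by
  obtain ⟨hb, -, hbx⟩ := List.nodup_append.1 hb
  constructor
  · rintro ⟨j, hij, hj⟩
    rcases lt_trichotomy j.val b.length with h | h | h
    · rw [get_left hi, get_left h, hb.getElem_inj_iff] at hj
      exact absurd (Fin.ext hj) hij.ne'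
    · rw [get_left hi, get_middle h] at hj
      exact absurd hj.symm (hbx _ (List.getElem_mem hi) x (by simp))
    · rw [← hj, get_right h (right_lt h)]
      exact List.getElem_mem _
  · intro h
    obtain ⟨m, hm, e⟩ := List.mem_iff_getElem.1 h
    refine ⟨⟨b.length + 1 + m, by simp; omega⟩, Fin.lt_def.2 (by simp only; omega), ?_⟩
    rw [get_right (by simp only; omega) (by simp only; omega), ← e]
    congr 1
    simp only
    omega

theorem not_isInner (hl : (x :: l).Nodup) {i : Fin (b ++ x :: l).length}
    (hi : b.length ≤ i.val) : ¬ IsInner (b ++ x :: l).get i := by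
  obtain ⟨hx, hl⟩ := List.nodup_cons.1 hl
  rintro ⟨j, hij, hj⟩
  have hij' : i.val < j.val := hij
  have h : b.length < j.val := by omega
  rcases hi.eq_or_lt with e | e
  · rw [get_middle e.symm, get_right h (right_lt h)] at hj
    exact hx (hj ▸ List.getElem_mem _)
  · rw [get_right e (right_lt e), get_right h (right_lt h), hl.getElem_inj_iff] at hj
    omega

theorem edgeCut_castSucc_of_le {i : Fin (b ++ x :: l).length} (hi : i.val ≤ b.length) :
    edgeCut (splitPos b x l) i.castSucc = 0 := if_pos hi

theorem edgeCut_castSucc_of_gt {i : Fin (b ++ x :: l).length} (hi : b.length < i.val) :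
    edgeCut (splitPos b x l) i.castSucc = 1 := if_neg (not_le.2 hi)

theorem edgeCut_succ_of_lt {i : Fin (b ++ x :: l).length} (hi : i.val < b.length) :
    edgeCut (splitPos b x l) i.succ = 0 := if_pos hi

theorem edgeCut_succ_of_ge {i : Fin (b ++ x :: l).length} (hi : b.length ≤ i.val) :
    edgeCut (splitPos b x l) i.succ = 1 :=
  if_neg (by change ¬ (i : ℕ) + 1 ≤ b.length; omega)

/-- Without repetition from `x` on, inner intervals lie strictly before the cut, and their right end
point is `0`. -/
theorem positionExponent_edgeCut (hl : (x :: l).Nodup) :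
    positionExponent (b ++ x :: l).get (edgeCut (splitPos b x l)) = 0 := by
  classical
  refine Finset.sum_eq_zero fun i hi => ?_
  rw [Finset.mem_filter] at hi
  have h1 : IsInner (b ++ x :: l).get i := hi.2
  rw [edgeCut_succ_of_lt (not_le.1 fun h => not_isInner hl h h1)]
  rfl

/-- The intervals of length `1` are the edge itself, at `x`, and the inner intervals, which carry
the values of `b` that occur again in `l`; all the others have length `0`. The exponent thus counts
the inversions of the inputs evaluated on the edge, in agreement with `prodH_vertexForm`. -/
theorem permutationExponent_edgeCut (hb : (b ++ [x]).Nodup) (hl : (x :: l).Nodup) :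
    permutationExponent (b ++ x :: l).get (edgeCut (splitPos b x l)) =
      pairSum (((b.filter fun y => y ∈ l) ++ [x]).map fun a => (a, 1)) := by
  rw [permutationExponent, sum_inversions_eq_pairSum, List.ofFn_eq_of_split _
    (fun a => (a, if a ∈ l then 1 else 0)) (fun a => (a, 0)) (x, 1), ← pairSum_filter]
  · congr 1
    rw [List.filter_append, List.filter_cons_of_pos (by simp), List.map_append]
    congr 1
    · rw [List.filter_map]
      have : ((fun z : Fin r × ℕ => decide (z.2 ≠ 0)) ∘ fun a => (a, if a ∈ l then 1 else 0)) =
          fun a => decide (a ∈ l) := by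
        funext a
        by_cases h : a ∈ l <;> simp [h]
      rw [this]
      refine List.map_congr_left fun a ha => ?_
      have : a ∈ l := by simpa using (List.mem_filter.1 ha).2
      simp [this]
    · simp
  · intro i hi
    simp only [intervalLength, edgeCut_castSucc_of_le hi.le, edgeCut_succ_of_lt hi,
        isInner_left hb hi]
    simp
  · intro i hi
    simp only [intervalLength, edgeCut_castSucc_of_le hi.le, edgeCut_succ_of_ge hi.ge,
      not_isInner hl hi.ge, get_middle hi]
    simp
  · intro i hi
    simp only [intervalLength, edgeCut_castSucc_of_gt hi, edgeCut_succ_of_ge hi.le,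
      not_isInner hl hi.le]
    simp

theorem intervalCut_edgeCut_of_nodup (hb : (b ++ [x]).Nodup) (hl : (x :: l).Nodup) (k : Fin r) :
    intervalCut (b ++ x :: l).get (edgeCut (splitPos b x l)) [(0 : Fin 2), 1] k =
      if k ∈ (b.filter fun y => y ∈ l) ++ [x] then [0, 1]
      else if k ∈ b.filter fun y => y ∉ l then [0] else if k ∈ l then [1] else [] := by
  obtain ⟨hb, -, hbx⟩ := List.nodup_append.1 hb
  obtain ⟨hx, hl⟩ := List.nodup_cons.1 hl
  have hxb : x ∉ b := fun h => hbx x h x (by simp) rfl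
  rw [intervalCut_edgeCut, hb.count, hl.count]
  by_cases h1 : x = k
  · subst h1
    simp [hx, hxb]
  · by_cases h2 : k ∈ b <;> by_cases h3 : k ∈ l <;> simp [h1, h2, h3, Ne.symm h1]

theorem length_intervalCut_edgeCut (hb : (b ++ [x]).Nodup) (hl : (x :: l).Nodup) (k : Fin r) :
    (intervalCut (b ++ x :: l).get (edgeCut (splitPos b x l)) [(0 : Fin 2), 1] k).length - 1 =
      if k ∈ ((b.filter fun y => y ∈ l) ++ [x]).toFinset then 1 else 0 := by
  rw [intervalCut_edgeCut_of_nodup hb hl]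
  simp only [List.mem_toFinset]
  split_ifs <;> rfl

/-- The sign of the pairing of an interval cut of the edge, which depends on the number of inputs
where the edge is inserted. -/
def edgeSign (d e : ℕ) : F := (-1) ^ (e.choose 2 + d * e)

/-- Without repetition, let `e` be the number of inputs evaluated on the edge. The permutation sign
is the sign of the product of homotopies, the position sign is trivial, the pairing gives one sign
for each pair of such inputs, and the operation of degree `d` crosses `e` cochains of degree `1`;
the last two form `edgeSign`. -/
theorem edgeCut_term (hk : ∀ k, k ∈ b ++ x :: l) (d : ℕ) (f : Fin r → Face 1 → F) :
    (-1 : F) ^ (permutationExponent (b ++ x :: l).get (edgeCut (splitPos b x l)) +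
        positionExponent (b ++ x :: l).get (edgeCut (splitPos b x l)) +
        pairingExponent (b ++ x :: l).get (edgeCut (splitPos b x l)) [(0 : Fin 2), 1] +
        operationExponent (b ++ x :: l).get (edgeCut (splitPos b x l)) d [(0 : Fin 2), 1]) *
      ∏ k, seqEval F (intervalCut (b ++ x :: l).get (edgeCut (splitPos b x l)) [(0 : Fin 2), 1] k)
        (f k) = splitTerm (edgeSign d) b x l f := by
  by_cases h : (b ++ [x]).Nodup ∧ (x :: l).Nodup
  · obtain ⟨hb, hl⟩ := h
    have hc : ((b.filter fun y => y ∈ l) ++ [x]).Nodup := by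
      refine hb.sublist ?_
      exact List.Sublist.append List.filter_sublist (List.Sublist.refl _)
    have hcard : ((b.filter fun y => y ∈ l) ++ [x]).toFinset.card =
        (b.filter fun y => y ∈ l).length + 1 := by
      rw [List.toFinset_card_of_nodup hc, List.length_append, List.length_singleton]
    rw [splitTerm, if_pos ⟨hb, hl⟩, smul_apply, listP_prodH_vertexForm _ _ hc,
      permutationExponent_edgeCut hb hl, positionExponent_edgeCut hl, pairingExponent,
      operationExponent]
    · simp only [length_intervalCut_edgeCut hb hl]
      rw [sum_pairs_indicator, hcard, Finset.sum_boole, Finset.filter_mem_eq_inter,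
        Finset.univ_inter, hcard, add_zero, add_assoc, pow_add, edgeSign, smul_eq_mul, Nat.cast_id,
        mul_comm ((-1 : F) ^ pairSum _), mul_assoc]
      congr 2
      refine Finset.prod_congr rfl fun k _ => ?_
      have hk' := hk k
      rw [intervalCut_edgeCut_of_nodup hb hl]
      split_ifs with h1 h2 h3
      · exact seqEval_edge _
      · exact seqEval_singleton _ _
      · exact seqEval_singleton _ _
      · exfalso
        simp only [List.mem_append, List.mem_cons, List.mem_filter, List.not_mem_nil, or_false,
          decide_eq_true_eq] at h1 h2 hk'
        tauto
    · intro y hy hy'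
      simp only [List.mem_append, List.mem_singleton, List.mem_filter, decide_eq_true_eq] at hy hy'
      rcases hy' with hy' | hy'
      · exact hy.2 hy'.2
      · exact (List.nodup_append.1 hb).2.2 y hy.1 x (by simp) hy'
  · rw [edgeCut_prod_eq_zero h, mul_zero, splitTerm, if_neg h]
    rfl

theorem intervalCutDual_edgeFace (u : List (Fin r)) (hu : ∀ k, k ∈ u) (d : ℕ) :
    intervalCutDual F u.get d edgeFace = rowSum (splitTerm (edgeSign d)) [] u := by
  refine MultilinearMap.ext fun f => ?_
  have h1 : ∀ (m : ℕ) (y : List (Fin 2)), m = 1 → y = [0, 1] →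
      (∑ c ∈ intervalCuts u.length m,
        (-1 : F) ^ (permutationExponent u.get c + positionExponent u.get c +
          pairingExponent u.get c y + operationExponent u.get c d y) •
        ∏ k, seqEval F (intervalCut u.get c y k) (f k)) =
      rowSum (splitTerm (edgeSign d)) [] u f := by
    rintro m y rfl rfl
    rw [sum_intervalCuts_one, rowSum_eq_sum_fin, sum_apply]
    refine Finset.sum_congr rfl fun i _ => ?_
    have key : ∀ (b l : List (Fin r)) (x : Fin r) (i : Fin u.length), u = b ++ x :: l →
        i.val = b.length → (-1 : F) ^ (permutationExponent u.get (edgeCut i) +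
            positionExponent u.get (edgeCut i) + pairingExponent u.get (edgeCut i) [(0 : Fin 2),
                1] +
            operationExponent u.get (edgeCut i) d [(0 : Fin 2), 1]) •
          ∏ k, seqEval F (intervalCut u.get (edgeCut i) [(0 : Fin 2), 1] k) (f k) =
          splitTerm (edgeSign d) b x l f := by
      rintro b l x i rfl hi
      obtain rfl : i = splitPos b x l := Fin.ext hi
      exact edgeCut_term hu d f
    have := key (u.take i) (u.drop (i + 1)) u[i] i (by simp) (by simp)
    rw [this]
    rfl
  have h2 := h1 (edgeFace.1.card - 1) (edgeFace.1.sort (· ≤ ·)) (by simp [edgeFace]) (by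
    have e : (Finset.univ : Finset (Fin 2)) = insert 0 {1} := by decide
    change Finset.sort (Finset.univ : Finset (Fin 2)) (· ≤ ·) = _
    rw [e, Finset.sort_insert _ (by simp) (by simp), Finset.sort_singleton])
  rw [← h2, intervalCutDual, sum_apply]
  refine Finset.sum_congr rfl fun c _ => ?_
  rw [smul_apply]
  simp

end EdgeTerm

/-! ### The action on the edge and on the vertices -/

section ActionFormulas

variable {F : Type u} [CommRing F] {r : ℕ}

/-- For a simplex of dimension `d` the number of inputs on the edge is `d + 1`, and `d(d + 1)` is
even. -/
theorem edgeSign_length (w : List (Perm (Fin r))) (hw : w ≠ []) :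
    (edgeSign (w.length - 1) w.length : F) = (-1) ^ w.length.choose 2 := by
  obtain ⟨d, hd⟩ : ∃ d, w.length = d + 1 := ⟨w.length - 1, by
    have := List.length_pos_iff.2 hw
    omega⟩
  rw [edgeSign, hd, Nat.add_sub_cancel, pow_add, (Nat.even_mul_succ_self d).neg_one_pow, mul_one]

theorem cochainAction_single {n : ℕ} (w : NDSeq (Perm (Fin r))) (f : Fin r → Face n → F)
    (S : Face n) : (cochainAction F n r (Finsupp.single w 1 : NDSeq (Perm (Fin r)) →₀ F) f :
      Face n → F) S =
      ((tableReduction [] w.1).map fun u => intervalCutDual F u.get (w.1.length - 1) S f).sum := by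
  have h1 : cochainAction F n r (Finsupp.single w 1 : NDSeq (Perm (Fin r)) →₀ F) =
      MultilinearMap.pi fun S =>
        ((tableReduction [] w.1).map fun u => intervalCutDual F u.get (w.1.length - 1) S).sum :=
    (Finsupp.linearCombination_single ..).trans (one_smul _ _)
  rw [h1]
  change ((tableReduction [] w.1).map fun u => intervalCutDual F u.get (w.1.length - 1) S).sum f = _
  induction tableReduction [] w.1 with
  | nil => rfl
  | cons u l ih => rw [List.map_cons, List.sum_cons, List.map_cons, List.sum_cons, ← ih]; rfl

/-- The definition by table reduction and interval cuts is replaced here by iterated homotopies: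
`intervalCutDual_edgeFace` evaluates each surjection, and `sum_tableReduction` adds them up. -/
theorem cochainAction_edgeFace (w : NDSeq (Perm (Fin r))) (f : Fin r → Face 1 → F) :
    (cochainAction F 1 r (Finsupp.single w 1 : NDSeq (Perm (Fin r)) →₀ F) f : Face 1 → F) edgeFace =
      (-1) ^ w.1.length.choose 2 * edgeForm w.1 f := by
  have h1 := sum_tableReduction (edgeSign (F := F) (w.1.length - 1)) w.1 w.2.1 [] [] List.nodup_nil
    (by simp)
  have h2 : ((tableReduction [] w.1).map fun u =>
      intervalCutDual F u.get (w.1.length - 1) edgeFace f) =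
      ((tableReduction [] w.1).map (rowSum (splitTerm (edgeSign (w.1.length - 1))) [])).map
        fun G => G f := by
    rw [List.map_map]
    refine List.map_congr_left fun u hu => ?_
    rw [intervalCutDual_edgeFace u fun k => mem_of_mem_tableReduction hu w.2.1 (by simp)]
    rfl
  have h3 : ∀ l : List (IntervalForm F r), (l.map fun G => G f).sum = l.sum f := by
    intro l
    induction l with
    | nil => rfl
    | cons G l ih => rw [List.map_cons, List.sum_cons, ih]; rfl
  rw [cochainAction_single, h2, h3, h1]
  simp only [List.filter_nil, List.length_nil, zero_add, listP, prodH, List.map_nil, List.prod_nil,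
    Module.End.one_apply, smul_apply, smul_eq_mul, edgeSign_length w.1 w.2.1]

theorem sum_intervalCuts_zero {M : Type*} [AddCommMonoid M] {L : ℕ}
    (g : (Fin (L + 1) → Fin (0 + 1)) → M) : ∑ c ∈ intervalCuts L 0, g c = g 0 := by
  have h1 : intervalCuts L 0 = {0} := by
    ext c
    have hc : c = 0 := funext fun j => Subsingleton.elim (α := Fin 1) _ _
    subst hc
    have h2 : Monotone (0 : Fin (L + 1) → Fin (0 + 1)) := fun _ _ _ => le_rfl
    simp [intervalCuts, Fin.last, h2]
    rfl
  rw [h1, Finset.sum_singleton]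

theorem intervalCut_zero {β : Type} (u : List (Fin r)) (y : β) (k : Fin r) :
    intervalCut u.get (0 : Fin (u.length + 1) → Fin (0 + 1)) [y] k =
      List.replicate (u.count k) y := by
  rw [intervalCut_eq_flatten, ← flatten_map_ite]
  congr 1
  refine List.ext_getElem (by simp) fun i hi hi' => ?_
  simp

theorem intervalCutDual_vertexFace {n : ℕ} (u : List (Fin r)) (d : ℕ) (x : Fin (n + 1))
    (f : Fin r → Face n → F) :
    intervalCutDual F u.get d (vertexFace x) f =
      (-1 : F) ^ (permutationExponent u.get (0 : Fin (u.length + 1) → Fin (0 + 1)) +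
        positionExponent u.get (0 : Fin (u.length + 1) → Fin (0 + 1)) +
        pairingExponent u.get (0 : Fin (u.length + 1) → Fin (0 + 1)) [x] +
        operationExponent u.get (0 : Fin (u.length + 1) → Fin (0 + 1)) d [x]) *
      ∏ k, seqEval F (List.replicate (u.count k) x) (f k) := by
  have h1 : ∀ (m : ℕ) (y : List (Fin (n + 1))), m = 0 → y = [x] →
      (∑ c ∈ intervalCuts u.length m,
        (-1 : F) ^ (permutationExponent u.get c + positionExponent u.get c +
          pairingExponent u.get c y + operationExponent u.get c d y) •
        ∏ k, seqEval F (intervalCut u.get c y k) (f k)) = 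
      (-1 : F) ^ (permutationExponent u.get (0 : Fin (u.length + 1) → Fin (0 + 1)) +
        positionExponent u.get (0 : Fin (u.length + 1) → Fin (0 + 1)) +
        pairingExponent u.get (0 : Fin (u.length + 1) → Fin (0 + 1)) [x] +
        operationExponent u.get (0 : Fin (u.length + 1) → Fin (0 + 1)) d [x]) *
      ∏ k, seqEval F (List.replicate (u.count k) x) (f k) := by
    rintro m y rfl rfl
    rw [sum_intervalCuts_zero]
    simp only [intervalCut_zero, smul_eq_mul]
  have h2 := h1 ((vertexFace x).1.card - 1) ((vertexFace x).1.sort (· ≤ ·)) (by simp [vertexFace])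
    (by simp [vertexFace])
  rw [← h2, intervalCutDual, sum_apply]
  refine Finset.sum_congr rfl fun c _ => ?_
  rw [smul_apply]
  simp

/-- The value which ends the first row is not marked as used, hence occurs again below. -/
theorem exists_two_le_count_of_mem_tableReduction {used : List (Fin r)} {w w' : Perm (Fin r)}
    {ws : List (Perm (Fin r))} {u : List (Fin r)}
    (hu : u ∈ tableReduction used (w :: w' :: ws)) : ∃ k, 2 ≤ u.count k := by
  rw [tableReduction, List.mem_flatMap] at hu
  obtain ⟨j, hj, hu⟩ := hu
  obtain ⟨t, ht, rfl⟩ := List.mem_map.1 hu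
  set row := (List.ofFn w).filter fun x => x ∉ used with hrow
  have hj' : j < row.length := List.mem_range.1 hj
  have hnd : row.Nodup := (nodup_ofFn_perm w).filter _
  have h1 : row[j] ∉ row.take j := by
    intro h
    obtain ⟨i, hi, e⟩ := List.mem_iff_getElem.1 h
    rw [List.getElem_take, hnd.getElem_inj_iff] at e
    simp at hi
    omega
  have h2 : row[j] ∉ used := by
    have := List.getElem_mem hj'
    simpa using (List.mem_filter.1 this).2
  have h3 : row[j] ∈ t := mem_of_mem_tableReduction ht (List.cons_ne_nil _ _) fun e =>
    (List.mem_append.1 e).elim h2 h1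
  have h4 : row[j] ∈ row.take (j + 1) := by
    rw [List.take_add_one, List.mem_append, List.getElem?_eq_getElem hj']
    right
    simp
  refine ⟨row[j], ?_⟩
  rw [List.count_append]
  have := List.count_pos_iff.2 h3
  have := List.count_pos_iff.2 h4
  omega

/-- All the cuts of a vertex are trivial, so each input receives the vertex as many times as its
value occurs. In positive dimension some value is repeated and the term is degenerate; in dimension
`0` all values occur once and all signs are trivial. -/
theorem cochainAction_vertexFace {n : ℕ} (w : NDSeq (Perm (Fin r))) (f : Fin r → Face n → F)
    (x : Fin (n + 1)) :
    (cochainAction F n r (Finsupp.single w 1 : NDSeq (Perm (Fin r)) →₀ F) f : Face n → F)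
      (vertexFace x) = if w.1.length = 1 then vertexForm x f else 0 := by
  rw [cochainAction_single]
  obtain ⟨w, hw, hc⟩ := w
  change ((tableReduction [] w).map fun u =>
    intervalCutDual F u.get (w.length - 1) (vertexFace x) f).sum =
      if w.length = 1 then vertexForm x f else 0
  match w, hw, hc with
  | [w], hw, hc =>
    have hfil : (List.ofFn w).filter (fun x => x ∉ ([] : List (Fin r))) = List.ofFn w := by simp
    have hcount : ∀ k, (List.ofFn w).count k = 1 := fun k =>
      List.count_eq_one_of_mem (nodup_ofFn_perm w) (mem_ofFn_perm w k)
    have hin : ∀ i, ¬ IsInner (List.ofFn w).get i := by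
      rintro i ⟨j, hij, hj⟩
      rw [List.get_eq_getElem, List.get_eq_getElem, (nodup_ofFn_perm w).getElem_inj_iff] at hj
      exact hij.ne' (Fin.ext hj)
    have hlen : ∀ i, intervalLength (List.ofFn w).get
        (0 : Fin ((List.ofFn w).length + 1) → Fin (0 + 1)) i = 0 := by
      intro i
      simp [intervalLength, hin]
    rw [tableReduction, hfil, List.map_singleton, List.sum_singleton, intervalCutDual_vertexFace,
      if_pos List.length_singleton, vertexForm_apply]
    have h1 : permutationExponent (List.ofFn w).get
        (0 : Fin ((List.ofFn w).length + 1) → Fin (0 + 1)) = 0 := by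
      simp [permutationExponent, hlen]
    have h2 : positionExponent (List.ofFn w).get
        (0 : Fin ((List.ofFn w).length + 1) → Fin (0 + 1)) = 0 := by
      simp [positionExponent]
    have h3 : pairingExponent (List.ofFn w).get
        (0 : Fin ((List.ofFn w).length + 1) → Fin (0 + 1)) [x] = 0 := by
      simp [pairingExponent, intervalCut_zero, hcount]
    have h4 : operationExponent (List.ofFn w).get
        (0 : Fin ((List.ofFn w).length + 1) → Fin (0 + 1)) ([w].length - 1) [x] = 0 := by
      simp [operationExponent]
    rw [h1, h2, h3, h4, add_zero, add_zero, add_zero, pow_zero, one_mul]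
    refine Finset.prod_congr rfl fun k _ => ?_
    rw [hcount k]
    exact seqEval_singleton x (f k)
  | w :: w' :: ws, hw, hc =>
    rw [if_neg (by simp)]
    refine List.sum_eq_zero fun y hy => ?_
    obtain ⟨u, hu, rfl⟩ := List.mem_map.1 hy
    obtain ⟨k, hk⟩ := exists_two_le_count_of_mem_tableReduction hu
    rw [intervalCutDual_vertexFace, Finset.prod_eq_zero (Finset.mem_univ k), mul_zero]
    have := seqEval_replicate_of_two_le (F := F) (x := x) hk [] [] (f k)
    rwa [List.nil_append, List.append_nil] at this

end ActionFormulas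

/-! ### Degrees and differentials of the operations on the interval -/

section ActionLaws

variable {F : Type u} [CommRing F]

theorem supported_induction {B : Type*} {s : Set B}
    {C : (p : B →₀ F) → p ∈ Finsupp.supported F F s → Prop} (zero : C 0 (Submodule.zero_mem _))
    (add : ∀ p q hp hq, C p hp → C q hq → C (p + q) (Submodule.add_mem _ hp hq))
    (smul : ∀ (c : F) p hp, C p hp → C (c • p) (Submodule.smul_mem _ c hp))
    (single : ∀ b (hb : b ∈ s), C (Finsupp.single b 1) (Finsupp.single_mem_supported F 1 hb))
    {p : B →₀ F} (hp : p ∈ Finsupp.supported F F s) : C p hp := by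
  have hp' := hp
  rw [Finsupp.supported_eq_span_single] at hp'
  suffices ∃ h, C p h from this.2
  induction hp' using Submodule.span_induction with
  | zero => exact ⟨_, zero⟩
  | add x y hx' hy' hx hy =>
    rw [← Finsupp.supported_eq_span_single] at hx' hy'
    obtain ⟨hx, hx''⟩ := hx hx'
    obtain ⟨hy, hy''⟩ := hy hy'
    exact ⟨_, add x y hx hy hx'' hy''⟩
  | smul c x hx' hx =>
    rw [← Finsupp.supported_eq_span_single] at hx'
    obtain ⟨hx, hx''⟩ := hx hx'
    exact ⟨_, smul c x hx hx''⟩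
  | mem x hx =>
    obtain ⟨b, hb, rfl⟩ := hx
    exact ⟨_, single b hb⟩

variable (F) in
/-- The action of the Barratt-Eccles operad, as a map between modules of functions. -/
def cochainOp (n r : ℕ) : (NDSeq (Perm (Fin r)) →₀ F) →ₗ[F]
    MultilinearMap F (fun _ : Fin r => Face n → F) (Face n → F) := cochainAction F n r

variable {r : ℕ}

theorem cochainOp_single_edgeFace (w : NDSeq (Perm (Fin r))) (f : Fin r → Face 1 → F) :
    cochainOp F 1 r (Finsupp.single w 1) f edgeFace = (-1) ^ w.1.length.choose 2 * edgeForm w.1 f :=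
  cochainAction_edgeFace w f

theorem cochainOp_single_vertexFace {n : ℕ} (w : NDSeq (Perm (Fin r))) (f : Fin r → Face n → F)
    (x : Fin (n + 1)) : cochainOp F n r (Finsupp.single w 1) f (vertexFace x) =
      if w.1.length = 1 then vertexForm x f else 0 :=
  cochainAction_vertexFace w f x

/-- Degenerate sequences are harmless by `edgeForm_of_not_isChain`. The empty sequence has to be
excluded, since its class is zero but its edge form is the form at the vertex `1`. -/
theorem cochainOp_normSeq_edgeFace (w : List (Perm (Fin r))) (hw : w ≠ [])
    (f : Fin r → Face 1 → F) :
    cochainOp F 1 r (normSeq F w) f edgeFace = (-1) ^ w.length.choose 2 * edgeForm w f := by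
  by_cases hc : w.IsChain (· ≠ ·)
  · rw [normSeq, dif_pos ⟨hw, hc⟩]
    exact cochainOp_single_edgeFace _ f
  · rw [normSeq, dif_neg fun h => hc h.2, map_zero, edgeForm_of_not_isChain hc]
    simp

theorem cochainOp_normSeq_vertexFace {n : ℕ} (w : List (Perm (Fin r))) (f : Fin r → Face n → F)
    (x : Fin (n + 1)) : cochainOp F n r (normSeq F w) f (vertexFace x) =
      if w.length = 1 then vertexForm x f else 0 := by
  by_cases hc : w ≠ [] ∧ w.IsChain (· ≠ ·)
  · rw [normSeq, dif_pos hc]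
    exact cochainOp_single_vertexFace _ f x
  · rw [normSeq, dif_neg hc, map_zero, if_neg]
    · rfl
    · intro h
      obtain ⟨a, rfl⟩ := List.length_eq_one_iff.1 h
      exact hc ⟨by simp, List.IsChain.singleton a⟩

/-- For `L = 1` the only possible sequence is the empty one, which is discarded in the normalized
complex. -/
theorem cochainOp_linearCombination_edgeFace (L : ℕ) {x : List (Perm (Fin r)) →₀ F}
    (hx : x ∈ Finsupp.supported F F {k : List (Perm (Fin r)) | k.length + 1 = L})
    (f : Fin r → Face 1 → F) :
    cochainOp F 1 r (Finsupp.linearCombination F (normSeq F) x) f edgeFace =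
      if L = 1 then 0 else (-1) ^ (L - 1).choose 2 * Finsupp.linearCombination F edgeForm x f := by
  induction hx using supported_induction with
  | zero => simp
  | add p q _ _ hp hq =>
    rw [map_add, map_add, map_add, add_apply, Pi.add_apply, hp, hq, add_apply]
    split_ifs
    · simp
    · ring
  | smul c p _ hp =>
    rw [map_smul, map_smul, map_smul, smul_apply, Pi.smul_apply, hp, smul_apply]
    split_ifs
    · simp
    · simp only [smul_eq_mul]; ring
  | single w hw =>
    have hw' : w.length + 1 = L := hw
    rw [Finsupp.linearCombination_single, Finsupp.linearCombination_single, one_smul, one_smul]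
    by_cases h : w = []
    · subst h
      rw [if_pos (by simpa using hw'.symm), normSeq, dif_neg (by simp), map_zero]
      rfl
    · have := List.length_pos_iff.2 h
      rw [cochainOp_normSeq_edgeFace w h, if_neg (by omega), ← hw', Nat.add_sub_cancel]

theorem cochainOp_barD_vertexFace {n : ℕ} (w : NDSeq (Perm (Fin r))) (f : Fin r → Face n → F)
    (x : Fin (n + 1)) :
    cochainOp F n r (barD F _ (Finsupp.single w 1)) f (vertexFace x) = 0 := by
  rw [barD, Finsupp.linearCombination_single, one_smul]
  obtain ⟨w, hw, hc⟩ := w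
  change cochainOp F n r (Finsupp.linearCombination F (normSeq F) (seqFaces F w)) f _ = 0
  match w with
  | [] => exact absurd rfl hw
  | [a] =>
    simp only [seqFaces, Finsupp.mapDomain_zero, sub_zero, Finsupp.linearCombination_single,
      one_smul, cochainOp_normSeq_vertexFace]
    rfl
  -- Dimension `1` is the only case in which the faces have values at a vertex; these do not depend
  -- on the permutation, so the two faces cancel.
  | [a, b] =>
    simp only [seqFaces, Finsupp.mapDomain_zero, sub_zero, Finsupp.mapDomain_single, map_sub,
      Finsupp.linearCombination_single, one_smul]
    change cochainOp F n r (normSeq F [b]) f (vertexFace x) -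
      cochainOp F n r (normSeq F [a]) f (vertexFace x) = 0
    rw [cochainOp_normSeq_vertexFace, cochainOp_normSeq_vertexFace]
    simp
  | a :: b :: c :: w =>
    have h1 := seqFaces_length F (a :: b :: c :: w)
    generalize seqFaces F (a :: b :: c :: w) = z at h1 ⊢
    induction h1 using supported_induction with
    | zero => simp
    | add p q _ _ hp hq => rw [map_add, map_add, add_apply, Pi.add_apply, hp, hq, add_zero]
    | smul c p _ hp => rw [map_smul, map_smul, smul_apply, Pi.smul_apply, hp, smul_zero]
    | single k hk =>
      have hk' : k.length + 1 = (a :: b :: c :: w).length := hk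
      simp only [List.length_cons] at hk'
      rw [Finsupp.linearCombination_single, one_smul, cochainOp_normSeq_vertexFace,
        if_neg (by omega)]

theorem cochainOp_barD_edgeFace (w : NDSeq (Perm (Fin r))) (f : Fin r → Face 1 → F) :
    cochainOp F 1 r (barD F _ (Finsupp.single w 1)) f edgeFace =
      if w.1.length = 1 then 0 else (-1) ^ (w.1.length - 1).choose 2 *
        Finsupp.linearCombination F edgeForm (seqFaces F w.1) f := by
  rw [barD, Finsupp.linearCombination_single, one_smul]
  exact cochainOp_linearCombination_edgeFace _ (seqFaces_length F w.1) f

theorem totalD_apply_of_mem (G : IntervalForm F r) {m : Fin r → ℤ} {f : Fin r → Face 1 → F}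
    (hf : ∀ i, f i ∈ cochainGr F 1 (m i)) : totalD G f =
      ∑ i, (∑ j with j < i, m j).negOnePow • G (Function.update f i (cochainD F 1 (f i))) := by
  rw [totalD, LinearMap.sum_apply, sum_apply]
  exact Finset.sum_congr rfl fun i _ => oddOp_apply_of_mem _ _ _ hf

theorem barDeg_eq (w : NDSeq (Perm (Fin r))) {e : ℤ} (hw : barDeg w = e) :
    e = -((w.1.length - 1 : ℕ) : ℤ) := by
  have := List.length_pos_iff.2 w.2.1
  rw [← hw, barDeg]
  omega

theorem cochainOp_mem (e : ℤ) (m : Fin r → ℤ) (p : NDSeq (Perm (Fin r)) →₀ F)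
    (f : Fin r → Face 1 → F) (hp : p ∈ Finsupp.supported F F {w | barDeg w = e})
    (hf : ∀ i, f i ∈ cochainGr F 1 (m i)) :
    cochainOp F 1 r p f ∈ cochainGr F 1 (e + ∑ i, m i) := by
  induction hp using supported_induction with
  | zero => rw [map_zero]; exact Submodule.zero_mem _
  | add p q _ _ hp hq => rw [map_add]; exact Submodule.add_mem _ hp hq
  | smul c p _ hp => rw [map_smul]; exact Submodule.smul_mem _ _ hp
  | single w hw =>
    have he := barDeg_eq w hw
    have hlen := List.length_pos_iff.2 w.2.1
    have hv : ∀ x, e + ∑ i, m i ≠ 0 → cochainOp F 1 r (Finsupp.single w 1) f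
        (vertexFace x) = 0 := by
      intro x h0
      rw [cochainOp_single_vertexFace]
      split_ifs with h1
      · refine hasDegree_vertexForm x m f hf ?_
        rw [he, h1] at h0
        simpa using h0
      · rfl
    refine mem_cochainGr_interval (hv 0) (hv 1) fun h1 => ?_
    rw [cochainOp_single_edgeFace, hasDegree_edgeForm w.1 m f hf, mul_zero]
    intro h2
    apply h1
    omega

theorem neg_one_pow_smul_eq {V : Type*} [AddCommGroup V] [Module F V] (d : ℕ) (x : V) :
    (-(d : ℤ)).negOnePow • x = (-1 : F) ^ d • x := by
  rw [Int.negOnePow_neg]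
  rcases Nat.even_or_odd d with h | h
  · rw [Int.negOnePow_even _ (by exact_mod_cast h), h.neg_one_pow, one_smul, one_smul]
  · rw [Int.negOnePow_odd _ (by exact_mod_cast h), h.neg_one_pow, Units.neg_smul, one_smul,
      neg_smul,
      one_smul]

/-- At a vertex both sides vanish. On the edge the statement is `totalD_edgeForm` up to signs. -/
theorem cochainD_cochainOp (e : ℤ) (m : Fin r → ℤ) (p : NDSeq (Perm (Fin r)) →₀ F)
    (f : Fin r → Face 1 → F) (hp : p ∈ Finsupp.supported F F {w | barDeg w = e})
    (hf : ∀ i, f i ∈ cochainGr F 1 (m i)) :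
    cochainD F 1 (cochainOp F 1 r p f) = cochainOp F 1 r (barD F _ p) f +
      ∑ i, (e + ∑ j with j < i, m j).negOnePow •
        cochainOp F 1 r p (Function.update f i (cochainD F 1 (f i))) := by
  induction hp using supported_induction with
  | zero => simp
  | add p q _ _ hp hq =>
    simp only [map_add, add_apply, hp, hq, smul_add, Finset.sum_add_distrib]
    abel
  | smul c p _ hp =>
    simp only [map_smul, smul_apply, hp, smul_add, Finset.smul_sum, smul_intUnits_smul_comm]
  | single w hw =>
    have he := barDeg_eq w hw
    have hlen := List.length_pos_iff.2 w.2.1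
    have hv : ∀ x, cochainD F 1 (cochainOp F 1 r (Finsupp.single w 1) f) (vertexFace x) =
        (cochainOp F 1 r (barD F _ (Finsupp.single w 1)) f + ∑ i, (e + ∑ j with j < i,
            m j).negOnePow •
          cochainOp F 1 r (Finsupp.single w 1) (Function.update f i (cochainD F 1 (f i))))
            (vertexFace x) := by
      intro x
      rw [cochainD_vertexFace, Pi.add_apply, cochainOp_barD_vertexFace, zero_add, Finset.sum_apply,
        Finset.sum_eq_zero]
      intro i _
      rw [Pi.smul_apply, cochainOp_single_vertexFace, vertexForm_apply,
        Finset.prod_eq_zero (Finset.mem_univ i), ite_self, smul_zero]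
      rw [Function.update_self, cochainD_vertexFace]
    refine interval_ext (hv 0) (hv 1) ?_
    rw [cochainD_edgeFace, Pi.add_apply, cochainOp_barD_edgeFace, Finset.sum_apply,
      cochainOp_single_vertexFace, cochainOp_single_vertexFace]
    have h1 : ∑ i, ((e + ∑ j with j < i, m j).negOnePow •
        cochainOp F 1 r (Finsupp.single w 1) (Function.update f i (cochainD F 1 (f i)))) edgeFace =
        (-1) ^ (w.1.length - 1) * ((-1) ^ w.1.length.choose 2 * totalD (edgeForm w.1) f) := by
      rw [totalD_apply_of_mem _ hf, Finset.mul_sum, Finset.mul_sum]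
      refine Finset.sum_congr rfl fun i _ => ?_
      rw [Pi.smul_apply, cochainOp_single_edgeFace, Int.negOnePow_add, mul_smul, he,
        neg_one_pow_smul_eq (F := F), smul_eq_mul]
      rcases Int.units_eq_one_or (∑ j with j < i, m j).negOnePow with h | h <;> simp [h]
    have h2 : totalD (edgeForm w.1) f = (if w.1.length = 1 then vertexForm 0 f else 0) -
        Finsupp.linearCombination F edgeForm (seqFaces F w.1) f := by
      rw [totalD_edgeForm]
      split_ifs <;> rfl
    rw [h1, h2]
    by_cases hw1 : w.1.length = 1
    · obtain ⟨a, ha⟩ := List.length_eq_one_iff.1 hw1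
      -- In dimension `0`, the face of `[a]` is the empty sequence: it is absent from the bar
      -- complex, but its edge form supplies the value at the vertex `1` in the differential of the
      -- cochain.
      have h3 : Finsupp.linearCombination F edgeForm (seqFaces F w.1) f = vertexForm 1 f := by
        rw [ha]
        simp [seqFaces, edgeForm]
      rw [h3]
      simp [hw1]
    · obtain ⟨d, hd⟩ : ∃ d, w.1.length = d + 2 := ⟨w.1.length - 2, by omega⟩
      rw [hd, if_neg (by omega), if_neg (by omega), if_neg (by omega)]
      -- The normalizing signs of consecutive lengths differ by the parity of the degree of the
      -- operation, which is the sign in the Leibniz rule.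
      have h4 : (d + 2).choose 2 = (d + 1).choose 2 + (d + 1) := by
        rw [Nat.choose_succ_succ' (d + 1) 1, Nat.choose_one_right, add_comm]
      have h5 : (-1 : F) ^ (d + 1) * (-1) ^ (d + 1) = 1 := by
        rw [← mul_pow, neg_mul_neg, one_mul, one_pow]
      rw [show d + 2 - 1 = d + 1 from rfl, h4, pow_add]
      linear_combination (-(-1 : F) ^ (d + 1).choose 2 *
        Finsupp.linearCombination F edgeForm (seqFaces F w.1) f) * (1 - h5)

end ActionLaws

/-! ### Composition, equivariance and unit on the interval -/

section CompositionLaw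

variable {F : Type u} [CommRing F] {r s n : ℕ}

theorem length_of_mem_shuffles {α β : Type} (u : List α) (v : List β) :
    ∀ t ∈ shuffles u v, t.2.length + 1 = u.length + v.length := by
  fun_induction shuffles u v with
  | case1 => simp
  | case2 => simp
  | case3 => simp
  | case4 a b b' v ih =>
    intro t ht
    obtain ⟨t', ht', rfl⟩ := List.mem_map.1 ht
    have := ih t' ht'
    simp only [List.length_cons] at this ⊢
    omega
  | case5 a a' u b ih =>
    intro t ht
    obtain ⟨t', ht', rfl⟩ := List.mem_map.1 ht
    have := ih t' ht'
    simp only [List.length_cons] at this ⊢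
    omega
  | case6 a a' u b b' v ih₁ ih₂ =>
    intro t ht
    rcases List.mem_append.1 ht with ht | ht
    · obtain ⟨t', ht', rfl⟩ := List.mem_map.1 ht
      have := ih₁ t' ht'
      simp only [List.length_cons] at this ⊢
      omega
    · obtain ⟨t', ht', rfl⟩ := List.mem_map.1 ht
      have := ih₂ t' ht'
      simp only [List.length_cons] at this ⊢
      omega

theorem cochainOp_list_sum {m : ℕ} {T : Type*} (l : List T) (c : T → ℤ)
    (g : T → NDSeq (Perm (Fin r)) →₀ F) (f : Fin r → Face m → F) (S : Face m) :
    cochainOp F m r ((l.map fun t => c t • g t).sum) f S =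
      (l.map fun t => c t • cochainOp F m r (g t) f S).sum := by
  induction l with
  | nil => simp
  | cons t l ih =>
    rw [List.map_cons, List.sum_cons, map_add, add_apply, Pi.add_apply, ih, List.map_cons,
      List.sum_cons, map_zsmul]
    congr 1

theorem prod_eq_mul_prod_ne {M : Type*} [CommMonoid M] (k : Fin r) (f : Fin r → M) :
    ∏ i, f i = f k * ∏ j : {j : Fin r // j ≠ k}, f j :=
  sum_eq_add_sum_ne (M := Additive M) k f

variable (h : n + 1 = r + s) (k : Fin r)

/-- The variables of an operation in which another operation is substituted. -/
def circVars {V : Type*} (y : V) (f : Fin n → V) : Fin r → V :=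
  fun j => if hj : j = k then y else f (outIdx h k ⟨j, hj⟩)

/-- On homogeneous cochains, the powers of the sign operator on the variables before `k` give the
Koszul sign for moving an operation of degree `e` past them. -/
theorem update_insertVars (e : ℕ) (m : Fin n → ℤ) (f : Fin n → Face 1 → F)
    (hf : ∀ i, f i ∈ cochainGr F 1 (m i)) (x y : Face 1 → F) (Θ : IntervalForm F s)
    (G : IntervalForm F r) : G (Function.update (insertVars h k e x Θ f) k y) =
      ((e : ℤ) * ∑ i : Fin n with i.val < k.val, m i).negOnePow • G (circVars h k y f) := by
  have hpow : ∀ (a : ℤ) (g : Face 1 → F), g ∈ cochainGr F 1 a →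
      (intervalSgn F ^ e) g = ((e : ℤ) * a).negOnePow • g := by
    intro a g hg
    induction e with
    | zero => simp
    | succ e ih =>
      rw [pow_succ', Module.End.mul_apply, ih, LinearMap.map_intUnits_smul,
        intervalSgn_of_mem hg, smul_smul, ← Int.negOnePow_add]
      congr 2
      push_cast
      ring
  have h1 : Function.update (insertVars h k e x Θ f) k y = fun j =>
      (if hj : j = k then 1 else if j < k then
        ((e : ℤ) * m (outIdx h k ⟨j, hj⟩)).negOnePow else 1 : ℤˣ) • circVars h k y f j := by
    funext j
    by_cases hj : j = k
    · subst hj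
      simp [circVars]
    · by_cases hjk : j < k
      · simp [hj, hjk, circVars, insertVars_of_lt h k e x Θ f hjk, hpow _ _ (hf _)]
      · have hkj : k < j := lt_of_le_of_ne (not_lt.1 hjk) (Ne.symm hj)
        simp [hj, hjk, circVars, insertVars_of_gt h k e x Θ f hkj]
  rw [h1, MultilinearMap.map_intUnits_smul_univ]
  congr 1
  rw [Finset.mul_sum, Finset.sum_filter, Int.negOnePow_sum, prod_blocks h k]
  simp only [inIdx_val_lt, if_false, Int.negOnePow_zero, Finset.prod_const_one, mul_one,
    outIdx_val_lt]
  rw [prod_eq_mul_prod_ne k, dif_pos rfl, one_mul]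
  refine Finset.prod_congr rfl fun j _ => ?_
  rw [dif_neg j.2]
  split_ifs <;> rfl

theorem insertForm_of_mem (e : ℕ) (m : Fin n → ℤ) (f : Fin n → Face 1 → F)
    (hf : ∀ i, f i ∈ cochainGr F 1 (m i)) (x : Face 1 → F) (Θ : IntervalForm F s)
    (G : IntervalForm F r) : insertForm h k e x Θ G f =
      ((e : ℤ) * ∑ i : Fin n with i.val < k.val, m i).negOnePow •
        (Θ (fun i => f (inIdx h k i)) * G (circVars h k x f)) := by
  rw [insertForm_apply, map_insertVars_smul, update_insertVars h k e m f hf, smul_eq_mul,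
    mul_smul_comm]

theorem circVars_eq_update {V : Type*} (x y : V) (f : Fin n → V) :
    circVars h k x f = Function.update (circVars h k y f) k x := by
  funext j
  by_cases hj : j = k
  · subst hj
    simp [circVars]
  · simp [circVars, hj]

theorem map_circVars (G : IntervalForm F r) (y : Face 1 → F) (f : Fin n → Face 1 → F) :
    G (circVars h k y f) = y (vertexFace 0) * G (circVars h k (Pi.single (vertexFace 0) 1) f) +
      y (vertexFace 1) * G (circVars h k (Pi.single (vertexFace 1) 1) f) +
      y edgeFace * G (circVars h k (Pi.single edgeFace 1) f) := by
  have hy : y = y (vertexFace 0) • Pi.single (vertexFace 0) 1 +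
      y (vertexFace 1) • Pi.single (vertexFace 1) 1 + y edgeFace • Pi.single edgeFace 1 := by
    refine interval_ext ?_ ?_ ?_ <;>
      simp [vertexFace_zero_ne_one, vertexFace_zero_ne_one.symm, vertexFace_ne_edgeFace,
        fun x => (vertexFace_ne_edgeFace x).symm]
  conv_lhs => rw [hy]
  rw [circVars_eq_update h k (_ + _) y f, MultilinearMap.map_update_add,
    MultilinearMap.map_update_add, MultilinearMap.map_update_smul, MultilinearMap.map_update_smul,
    MultilinearMap.map_update_smul, ← circVars_eq_update, ← circVars_eq_update,
    ← circVars_eq_update]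
  rfl

/-- The inserted cochain is expanded on the indicators of the two vertices and of the edge; these
are the components of `insertEdge`, except that its edge component lacks the normalizing sign, whose
square is `1`. -/
theorem insertEdge_of_mem (v : NDSeq (Perm (Fin s))) (m : Fin n → ℤ) (f : Fin n → Face 1 → F)
    (hf : ∀ i, f i ∈ cochainGr F 1 (m i)) (G : IntervalForm F r) :
    insertEdge h k v.1 G f = (((v.1.length - 1 : ℕ) : ℤ) *
      ∑ i : Fin n with i.val < k.val, m i).negOnePow • ((-1) ^ v.1.length.choose 2 *
        G (circVars h k (cochainOp F 1 s (Finsupp.single v 1) fun i => f (inIdx h k i)) f)) := by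
  have hsq : (-1 : F) ^ v.1.length.choose 2 * (-1) ^ v.1.length.choose 2 = 1 := by
    rw [← mul_pow, neg_mul_neg, one_mul, one_pow]
  rw [map_circVars, cochainOp_single_edgeFace, cochainOp_single_vertexFace,
    cochainOp_single_vertexFace, insertEdge, LinearMap.add_apply, add_apply,
    insertForm_of_mem h k _ m f hf]
  by_cases hv : v.1.length = 1
  · rw [if_pos hv, if_pos hv, if_pos hv, LinearMap.add_apply, add_apply,
      insertForm_of_mem h k _ m f hf, insertForm_of_mem h k _ m f hf, ← smul_add, ← smul_add]
    congr 1
    rw [hv, Nat.choose_eq_zero_of_lt (by norm_num)]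
    ring
  · rw [if_neg hv, if_neg hv, if_neg hv, LinearMap.zero_apply, zero_apply, add_zero]
    congr 1
    linear_combination (-(edgeForm v.1 fun i => f (inIdx h k i)) *
      G (circVars h k (Pi.single edgeFace 1) f)) * hsq

theorem barrattEcclesCirc_single (u : NDSeq (Perm (Fin r))) (v : NDSeq (Perm (Fin s))) :
    barrattEcclesCirc F h k (Finsupp.single u 1) (Finsupp.single v 1) =
      ((shuffles u.1 v.1).map fun t =>
        t.1 • normSeq F (t.2.map fun y => permCirc h k y.1 y.2)).sum := by
  rw [barrattEcclesCirc, Finsupp.linearCombination_single, one_smul,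
    Finsupp.linearCombination_single, one_smul]

theorem choose_two_add (a b : ℕ) : (a + b).choose 2 = a.choose 2 + b.choose 2 + a * b := by
  induction a with
  | zero => simp
  | succ a ih =>
    rw [show a + 1 + b = a + b + 1 by ring, Nat.choose_succ_succ' (a + b) 1,
      Nat.choose_succ_succ' a 1, Nat.choose_one_right, Nat.choose_one_right, ih]
    ring

/-- After `shuffles_edgeForm`, only the normalizing signs remain: they are compatible with
composition because `(a + b) choose 2` is `a choose 2 + b choose 2 + ab`. -/
theorem cochainOp_circ_edgeFace (u : NDSeq (Perm (Fin r))) (v : NDSeq (Perm (Fin s)))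
    (m : Fin n → ℤ) (f : Fin n → Face 1 → F) (hf : ∀ i, f i ∈ cochainGr F 1 (m i)) :
    cochainOp F 1 n (barrattEcclesCirc F h k (Finsupp.single u 1) (Finsupp.single v 1)) f
      edgeFace = (((v.1.length - 1 : ℕ) : ℤ) *
      ∑ i : Fin n with i.val < k.val, m i).negOnePow • cochainOp F 1 r (Finsupp.single u 1)
        (circVars h k (cochainOp F 1 s (Finsupp.single v 1) fun i => f (inIdx h k i)) f)
          edgeFace := by
  have hu := List.length_pos_iff.2 u.2.1
  have hv := List.length_pos_iff.2 v.2.1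
  have key : cochainOp F 1 n (barrattEcclesCirc F h k (Finsupp.single u 1) (Finsupp.single v 1)) f
      edgeFace = (-1) ^ (u.1.length + v.1.length - 1).choose 2 *
        (((shuffles u.1 v.1).map fun t =>
          t.1 • (edgeForm (t.2.map fun y => permCirc h k y.1 y.2) : IntervalForm F n)).sum) f := by
    have hl := length_of_mem_shuffles u.1 v.1
    rw [barrattEcclesCirc_single, cochainOp_list_sum]
    generalize shuffles u.1 v.1 = l at hl ⊢
    induction l with
    | nil => simp
    | cons t l ih =>
      have ht := hl t (List.mem_cons_self ..)
      have hne : (t.2.map fun y => permCirc h k y.1 y.2) ≠ [] := by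
        rw [← List.length_pos_iff, List.length_map]
        omega
      rw [List.map_cons, List.sum_cons, List.map_cons, List.sum_cons, add_apply, mul_add,
        ih fun t ht => hl t (List.mem_cons_of_mem _ ht), cochainOp_normSeq_edgeFace _ hne,
        List.length_map, show t.2.length = u.1.length + v.1.length - 1 by omega,
        ← Int.cast_smul_eq_zsmul F, ← Int.cast_smul_eq_zsmul F, smul_apply, smul_eq_mul,
        smul_eq_mul]
      ring
  rw [key, shuffles_edgeForm h k u.1 v.1 u.2.1 v.2.1, smul_apply, smul_eq_mul,
    insertEdge_of_mem h k v m f hf, cochainOp_single_edgeFace, mul_smul_comm, mul_smul_comm]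
  congr 1
  obtain ⟨a, ha⟩ : ∃ a, u.1.length = a + 1 := ⟨u.1.length - 1, by omega⟩
  obtain ⟨b, hb⟩ : ∃ b, v.1.length = b + 1 := ⟨v.1.length - 1, by omega⟩
  rw [ha, hb, show a + 1 + (b + 1) - 1 = a + (b + 1) by omega, choose_two_add a (b + 1),
    choose_two_add a 1, Nat.add_sub_cancel, Nat.add_sub_cancel,
    Nat.choose_eq_zero_of_lt (show 1 < 2 by norm_num), ← mul_assoc, ← mul_assoc, ← pow_add,
    ← pow_add]
  congr 1
  rw [show a.choose 2 + (b + 1).choose 2 + a * (b + 1) + a * b + (b + 1).choose 2 =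
    a.choose 2 + 0 + a * 1 + 2 * ((b + 1).choose 2 + a * b) by ring, pow_add _ _ (2 * _), pow_mul,
    neg_one_sq, one_pow, mul_one]

/-- At a vertex only operations of dimension `0` have a value, and these take products of values; if
one of the dimensions is positive, so is the dimension of every term of the composite. -/
theorem cochainOp_circ_vertexFace (u : NDSeq (Perm (Fin r))) (v : NDSeq (Perm (Fin s)))
    (m : Fin n → ℤ) (f : Fin n → Face 1 → F) (x : Fin 2) :
    cochainOp F 1 n (barrattEcclesCirc F h k (Finsupp.single u 1) (Finsupp.single v 1)) f
      (vertexFace x) = (((v.1.length - 1 : ℕ) : ℤ) *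
      ∑ i : Fin n with i.val < k.val, m i).negOnePow • cochainOp F 1 r (Finsupp.single u 1)
        (circVars h k (cochainOp F 1 s (Finsupp.single v 1) fun i => f (inIdx h k i)) f)
          (vertexFace x) := by
  have hu := List.length_pos_iff.2 u.2.1
  have hv := List.length_pos_iff.2 v.2.1
  rw [barrattEcclesCirc_single, cochainOp_list_sum, cochainOp_single_vertexFace]
  have hvars : v.1.length ≠ 1 → vertexForm x (circVars h k
      (cochainOp F 1 s (Finsupp.single v 1) fun i => f (inIdx h k i)) f) = 0 := by
    intro hv1
    rw [vertexForm_apply, Finset.prod_eq_zero (Finset.mem_univ k)]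
    simp [circVars, cochainOp_single_vertexFace, hv1]
  by_cases huv : u.1.length = 1 ∧ v.1.length = 1
  · obtain ⟨a, ha⟩ := List.length_eq_one_iff.1 huv.1
    obtain ⟨b, hb⟩ := List.length_eq_one_iff.1 huv.2
    rw [if_pos huv.1, ha, hb, shuffles]
    simp only [List.map_cons, List.map_nil, List.sum_singleton, one_smul, List.length_singleton,
      Nat.sub_self, Nat.cast_zero, zero_mul, Int.negOnePow_zero]
    rw [cochainOp_normSeq_vertexFace, if_pos List.length_singleton, vertexForm_apply,
      vertexForm_apply, prod_blocks h k, prod_eq_mul_prod_ne k, mul_comm]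
    congr 1
    · simp [circVars, cochainOp_single_vertexFace, huv.2, vertexForm_apply]
    · exact Finset.prod_congr rfl fun j _ => by simp [circVars, j.2]
  · have h0 : (if u.1.length = 1 then vertexForm x (circVars h k
      (cochainOp F 1 s (Finsupp.single v 1) fun i => f (inIdx h k i)) f) else 0) = 0 := by
      split_ifs with hu1
      · exact hvars fun hv1 => huv ⟨hu1, hv1⟩
      · rfl
    rw [h0, smul_zero]
    refine List.sum_eq_zero fun y hy => ?_
    obtain ⟨t, ht, rfl⟩ := List.mem_map.1 hy
    have := length_of_mem_shuffles u.1 v.1 t ht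
    rw [cochainOp_normSeq_vertexFace, List.length_map, if_neg (by omega), smul_zero]

theorem cochainOp_circ (e : ℤ) (m : Fin n → ℤ) (p : NDSeq (Perm (Fin r)) →₀ F)
    (q : NDSeq (Perm (Fin s)) →₀ F) (f : Fin n → Face 1 → F)
    (hq : q ∈ Finsupp.supported F F {w | barDeg w = e}) (hf : ∀ i, f i ∈ cochainGr F 1 (m i)) :
    cochainOp F 1 n (barrattEcclesCirc F h k p q) f =
      (e * ∑ i : Fin n with i.val < k.val, m i).negOnePow •
        cochainOp F 1 r p (circVars h k (cochainOp F 1 s q fun i => f (inIdx h k i)) f) := by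
  have hadd : ∀ (G : MultilinearMap F (fun _ : Fin r => Face 1 → F) (Face 1 → F))
      (x y : Face 1 → F), G (circVars h k (x + y) f) =
        G (circVars h k x f) + G (circVars h k y f) := by
    intro G x y
    rw [circVars_eq_update h k (x + y) 0 f, MultilinearMap.map_update_add,
      ← circVars_eq_update, ← circVars_eq_update]
  have hsmul : ∀ (G : MultilinearMap F (fun _ : Fin r => Face 1 → F) (Face 1 → F)) (c : F)
      (x : Face 1 → F), G (circVars h k (c • x) f) = c • G (circVars h k x f) := by
    intro G c x
    rw [circVars_eq_update h k (c • x) 0 f, MultilinearMap.map_update_smul,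
      ← circVars_eq_update]
  induction hq using supported_induction with
  | zero =>
    have := hsmul (cochainOp F 1 r p) 0 0
    simp only [zero_smul] at this
    simp [this]
  | add q q' _ _ hq hq' =>
    rw [map_add, map_add, add_apply, hq, hq', map_add, add_apply, hadd, smul_add]
  | smul c q _ hq =>
    rw [map_smul, map_smul, smul_apply, hq, map_smul, smul_apply, hsmul, smul_intUnits_smul_comm]
  | single v hv =>
    have hp : p ∈ Finsupp.supported F F Set.univ := by
      rw [Finsupp.supported_univ]; trivial
    induction hp using supported_induction with
    | zero => simp
    | add q q' _ _ hq hq' => simp only [map_add, LinearMap.add_apply, add_apply, hq, hq', smul_add]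
    | smul c q _ hq =>
      simp only [map_smul, LinearMap.smul_apply, smul_apply, hq, smul_intUnits_smul_comm]
    | single u _ =>
      have he : (e * ∑ i : Fin n with i.val < k.val, m i).negOnePow =
          (((v.1.length - 1 : ℕ) : ℤ) * ∑ i : Fin n with i.val < k.val, m i).negOnePow := by
        rw [barDeg_eq v hv, neg_mul, Int.negOnePow_neg]
      rw [he]
      exact interval_ext (cochainOp_circ_vertexFace h k u v m f 0)
        (cochainOp_circ_vertexFace h k u v m f 1) (cochainOp_circ_edgeFace h k u v m f hf)

theorem cochainOp_rep (σ : Perm (Fin r)) (m : Fin r → ℤ) (p : NDSeq (Perm (Fin r)) →₀ F)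
    (f : Fin r → Face 1 → F) (hf : ∀ i, f i ∈ cochainGr F 1 (m i)) :
    cochainOp F 1 r (barrattEcclesRep F σ p) f =
      (permExponent σ m).negOnePow • cochainOp F 1 r p (f ∘ σ) := by
  have hp : p ∈ Finsupp.supported F F Set.univ := by
    rw [Finsupp.supported_univ]; trivial
  induction hp using supported_induction with
  | zero => simp
  | add q q' _ _ hq hq' => simp only [map_add, add_apply, hq, hq', smul_add]
  | smul c q _ hq => simp only [map_smul, smul_apply, hq, smul_intUnits_smul_comm]
  | single w _ =>
    have hv : ∀ x, cochainOp F 1 r (barrattEcclesRep F σ (Finsupp.single w 1)) f (vertexFace x) =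
        ((permExponent σ m).negOnePow • cochainOp F 1 r (Finsupp.single w 1) (f ∘ σ))
          (vertexFace x) := by
      intro x
      rw [barrattEcclesRep, Finsupp.linearCombination_single, one_smul,
        cochainOp_normSeq_vertexFace, Pi.smul_apply, cochainOp_single_vertexFace, List.length_map]
      split_ifs
      · exact isPermutedForm_vertexForm σ x m f hf
      · rw [smul_zero]
    refine interval_ext (hv 0) (hv 1) ?_
    rw [barrattEcclesRep, Finsupp.linearCombination_single, one_smul,
      cochainOp_normSeq_edgeFace _ (by simpa using w.2.1), Pi.smul_apply,
      cochainOp_single_edgeFace, List.length_map, isPermutedForm_edgeForm σ w.1 m f hf,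
      mul_smul_comm]

theorem cochainOp_one (f : Fin 1 → Face 1 → F) : cochainOp F 1 1 (normSeq F [1]) f = f 0 := by
  refine interval_ext ?_ ?_ ?_
  · rw [cochainOp_normSeq_vertexFace, if_pos List.length_singleton, vertexForm_apply]
    simp
  · rw [cochainOp_normSeq_vertexFace, if_pos List.length_singleton, vertexForm_apply]
    simp
  · rw [cochainOp_normSeq_edgeFace _ (by simp)]
    -- With a single variable the homotopy is `h`, which reads the edge at the vertex `1`.
    have h1 : List.ofFn (1 : Perm (Fin 1)) = [0] := rfl
    rw [edgeForm, edgeForm, h1, listH, listH, mul_zero, add_zero, hOp, oddOp_apply,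
      vertexForm_apply]
    simp [intervalH_apply]

theorem isAlgebra_cochainAction_interval :
    OperadData.IsAlgebra (cochainAction F 1) where
  mem e m p a hp ha := cochainOp_mem e m p a hp ha
  d_apply e m p a hp ha := cochainD_cochainOp e m p a hp ha
  one_apply a := cochainOp_one a
  rep_apply σ m p a ha := cochainOp_rep σ m p a ha
  circ_apply h k e m p q a hq ha := cochainOp_circ h k e m p q a hq ha

end CompositionLaw

/-! ### Maps between the point and the interval -/

section CochainMaps

variable {F : Type u} [CommRing F]

theorem cochainMap_vertexFace {m n : ℕ} (θ : Fin (m + 1) →o Fin (n + 1)) (f : Face n → F)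
    (x : Fin (m + 1)) : cochainMap F θ f (vertexFace x) = f (vertexFace (θ x)) := by
  simp [cochainMap, vertexFace, faceEval]

theorem cochainMap_edgeFace (θ : Fin (1 + 1) →o Fin (0 + 1)) (f : Face 0 → F) :
    cochainMap F θ f edgeFace = 0 := by
  have h1 : ¬ Set.InjOn θ (edgeFace : Face 1).1 := fun h =>
    zero_ne_one (α := Fin 2) (h (by simp [edgeFace]) (by simp [edgeFace]) (Subsingleton.elim
        (α := Fin 1) _ _))
  simp only [cochainMap, LinearMap.pi_apply, if_neg h1, LinearMap.zero_apply]

theorem point_ext {f g : Face 0 → F} (h : f (vertexFace 0) = g (vertexFace 0)) : f = g := by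
  funext S
  rwa [Subsingleton.elim S (vertexFace 0)]

theorem cochainD_point (f : Face 0 → F) : cochainD F 0 f = 0 :=
  point_ext (cochainD_vertexFace 0 f)

theorem mem_cochainGr_point {f : Face 0 → F} {m : ℤ} (h : m ≠ 0 → f (vertexFace 0) = 0) :
    f ∈ cochainGr F 0 m := by
  intro S hS
  rw [Subsingleton.elim S (vertexFace 0), faceDim_vertexFace] at hS
  rw [Subsingleton.elim S (vertexFace 0)]
  exact h hS.symm

theorem cochainMap_mem_interval (θ : Fin (1 + 1) →o Fin (0 + 1)) {n : ℤ} {f : Face 0 → F}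
    (hf : f ∈ cochainGr F 0 n) : cochainMap F θ f ∈ cochainGr F 1 n := by
  have h0 : ∀ x, n ≠ 0 → cochainMap F θ f (vertexFace x) = 0 := fun x hn => by
    rw [cochainMap_vertexFace]
    exact apply_vertexFace_of_mem hf hn _
  exact mem_cochainGr_interval (h0 0) (h0 1) fun _ => cochainMap_edgeFace θ f

theorem cochainMap_mem_point (θ : Fin (0 + 1) →o Fin (1 + 1)) {n : ℤ} {f : Face 1 → F}
    (hf : f ∈ cochainGr F 1 n) : cochainMap F θ f ∈ cochainGr F 0 n :=
  mem_cochainGr_point fun hn => by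
    rw [cochainMap_vertexFace]
    exact apply_vertexFace_of_mem hf hn _

theorem cochainMap_cochainD_interval (θ : Fin (1 + 1) →o Fin (0 + 1)) (f : Face 0 → F) :
    cochainMap F θ (cochainD F 0 f) = cochainD F 1 (cochainMap F θ f) := by
  rw [cochainD_point, map_zero]
  refine interval_ext ?_ ?_ ?_
  · rw [cochainD_vertexFace]; rfl
  · rw [cochainD_vertexFace]; rfl
  · rw [cochainD_edgeFace, cochainMap_vertexFace, cochainMap_vertexFace,
      Subsingleton.elim (α := Fin 1) (θ 0) (θ 1), sub_self]
    rfl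

theorem cochainMap_cochainD_point (θ : Fin (0 + 1) →o Fin (1 + 1)) (f : Face 1 → F) :
    cochainMap F θ (cochainD F 1 f) = cochainD F 0 (cochainMap F θ f) := by
  rw [cochainD_point]
  refine point_ext ?_
  rw [cochainMap_vertexFace, cochainD_vertexFace]
  rfl

theorem isHom_cochainMap_point_interval (θ : Fin (0 + 1) →o Fin (1 + 1)) :
    DGModule.IsHom (V := cochains F 1) (W := cochains F 0) (cochainMap F θ) where
  map_mem _ _ hf := cochainMap_mem_point θ hf
  map_d f := cochainMap_cochainD_point θ f

theorem cochainOp_cochainMap_vertexFace {m n r : ℕ} (θ : Fin (m + 1) →o Fin (n + 1))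
    (w : NDSeq (Perm (Fin r))) (f : Fin r → Face n → F) (x : Fin (m + 1)) :
    cochainMap F θ (cochainOp F n r (Finsupp.single w 1) f) (vertexFace x) =
      cochainOp F m r (Finsupp.single w 1) (fun i => cochainMap F θ (f i)) (vertexFace x) := by
  rw [cochainMap_vertexFace, cochainOp_single_vertexFace, cochainOp_single_vertexFace,
    vertexForm_apply, vertexForm_apply]
  simp only [cochainMap_vertexFace]

theorem cochainMap_cochainOp {m n r : ℕ} (θ : Fin (m + 1) →o Fin (n + 1))
    (h : ∀ (w : NDSeq (Perm (Fin r))) (f : Fin r → Face n → F),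
      cochainMap F θ (cochainOp F n r (Finsupp.single w 1) f) =
        cochainOp F m r (Finsupp.single w 1) fun i => cochainMap F θ (f i))
    (p : NDSeq (Perm (Fin r)) →₀ F) (f : Fin r → Face n → F) :
    cochainMap F θ (cochainOp F n r p f) = cochainOp F m r p fun i => cochainMap F θ (f i) := by
  have hp : p ∈ Finsupp.supported F F Set.univ := by
    rw [Finsupp.supported_univ]; trivial
  induction hp using supported_induction with
  | zero => simp
  | add q q' _ _ hq hq' => simp only [map_add, add_apply, hq, hq']
  | smul c q _ hq => simp only [map_smul, smul_apply, hq]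
  | single w _ => exact h w f

/-- Vertices are carried to vertices. The pulled back cochains have degree `0` and vanish on the
edge; so do the results of the operations, since edge forms of non-empty sequences require a
positive total degree. -/
theorem isAlgebraHom_cochainMap_interval_point (θ : Fin (1 + 1) →o Fin (0 + 1)) :
    OperadData.IsAlgebraHom (cochainAction F 0) (cochainAction F 1) (cochainMap F θ) where
  hom :=
    { map_mem := fun _ _ hf => cochainMap_mem_interval θ hf
      map_d := fun f => cochainMap_cochainD_interval θ f }
  map_apply {r} p a := by
    refine cochainMap_cochainOp θ (fun w f => ?_) p a
    refine interval_ext (cochainOp_cochainMap_vertexFace θ w f 0)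
      (cochainOp_cochainMap_vertexFace θ w f 1) ?_
    have hf : ∀ i, cochainMap F θ (f i) ∈ cochainGr F 1 ((0 : Fin r → ℤ) i) := fun i =>
      mem_cochainGr_interval (fun h => absurd rfl h) (fun h => absurd rfl h)
        fun _ => cochainMap_edgeFace θ _
    have hw := List.length_pos_iff.2 w.2.1
    rw [cochainMap_edgeFace, cochainOp_single_edgeFace, hasDegree_edgeForm w.1 0 _ hf, mul_zero]
    simp only [Pi.zero_apply, Finset.sum_const_zero]
    omega

/-- The point is a retract of the interval, so the laws already proved on the interval restrict to
it. -/
theorem isAlgebra_cochainAction_point : OperadData.IsAlgebra (cochainAction F 0) := by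
  have h : cochainMap F (⟨fun _ => 0, monotone_const⟩ : Fin (0 + 1) →o Fin (1 + 1)) ∘ₗ
      cochainMap F (⟨fun _ => 0, monotone_const⟩ : Fin (1 + 1) →o Fin (0 + 1)) =
        LinearMap.id := by
    refine LinearMap.ext fun f => point_ext ?_
    rw [LinearMap.comp_apply, cochainMap_vertexFace, cochainMap_vertexFace]
    rfl
  exact OperadData.IsAlgebraHom.isAlgebra_of_retract isAlgebra_cochainAction_interval
    (isAlgebraHom_cochainMap_interval_point _) (isHom_cochainMap_point_interval _) h

end CochainMaps

/-! ### Deformation retracts -/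

section Homotopy

variable {F : Type u} [CommRing F]

/-- The left inverse `g` detects coboundaries, and `H` shows that a cocycle `y` is cohomologous to
`f (g y)`. -/
theorem DGModule.isWeakEquivalence_of_homotopy {V : DGModule.{u, v} F} {W : DGModule.{u, w} F}
    {f : V →ₗ[F] W} {g : W →ₗ[F] V} (hf : IsHom f) (hg : IsHom g) (hgf : g ∘ₗ f = LinearMap.id)
    (H : W →ₗ[F] W) (hH : ∀ n, ∀ x ∈ W.gr n, H x ∈ W.gr (n - 1))
    (hdH : ∀ x, W.d (H x) + H (W.d x) = f (g x) - x) : IsWeakEquivalence f := by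
  refine ⟨hf, fun n => ⟨?_, ?_⟩⟩
  · refine (injective_iff_map_eq_zero _).2 fun x hx => ?_
    obtain ⟨⟨x, hx'⟩, rfl⟩ := Submodule.Quotient.mk_surjective _ x
    obtain ⟨y, hy, hyx⟩ := (Submodule.Quotient.mk_eq_zero _).1 hx
    refine (Submodule.Quotient.mk_eq_zero _).2 ⟨g y, hg.map_mem _ y hy, ?_⟩
    have hyx' : W.d y = f x := hyx
    rw [← hg.map_d, hyx']
    exact LinearMap.congr_fun hgf x
  · intro y
    obtain ⟨⟨y, hy⟩, rfl⟩ := Submodule.Quotient.mk_surjective _ y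
    have hd : W.d y = 0 := hy.2
    refine ⟨Submodule.Quotient.mk ⟨g y, hg.map_cocycles n y hy⟩, ?_⟩
    refine (Submodule.Quotient.eq _).2 ⟨H y, hH n y hy.1, ?_⟩
    have := hdH y
    rw [hd, map_zero, add_zero] at this
    exact this

theorem DGModule.IsTensor.isHom {V : DGModule.{u, v} F} {W : DGModule.{u, w} F}
    {T : DGModule.{u, w'} F} {X : DGModule.{u, v₁} F} {t : V →ₗ[F] W →ₗ[F] T}
        (ht : IsTensor t) {g : T →ₗ[F] X}
    (hmem : ∀ (p q : ℤ) (a : V) (b : W), a ∈ V.gr p → b ∈ W.gr q → g (t a b) ∈ X.gr (p + q))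
    (hd : ∀ (p : ℤ) (a : V), a ∈ V.gr p → ∀ b : W,
      g (t (V.d a) b) + p.negOnePow • g (t a (W.d b)) = X.d (g (t a b))) : IsHom g where
  map_mem n y hy := by
    induction hy using ht.induction_gr with
    | zero => rw [map_zero]; exact Submodule.zero_mem _
    | add x y _ _ hx hy => rw [map_add]; exact Submodule.add_mem _ hx hy
    | smul c x _ hx => rw [map_smul]; exact Submodule.smul_mem _ _ hx
    | apply p q a b h ha hb =>
      subst h
      exact hmem p q a b ha hb
  map_d y := by
    induction y using ht.induction with
    | zero => simp
    | add x y hx hy => simp only [map_add, hx, hy]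
    | smul c x hx => simp only [map_smul, hx]
    | apply p q a b ha hb => rw [ht.d_apply ha, map_add, LinearMap.map_intUnits_smul, hd p a ha b]

end Homotopy

/-! ### Tensor products with the cochains of the point and of the interval -/

section PathObject

open OperadData (faceComponent)

variable {F : Type u} [CommRing F] (A : DGModule.{u, w} F)

/-- The vertices of the simplex give morphisms of dg-modules `N^*(Δ^n) ⊗ A → A`. -/
theorem isHom_faceComponent {n : ℕ} (x : Fin (n + 1)) :
    DGModule.IsHom (V := (cochains F n).tensor A) (W := A) (faceComponent A (vertexFace x)) := by
  have hmem : ∀ {p q n' : ℤ} {f : Face n → F} {a : A}, p + q = n' → f ∈ cochainGr F n p →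
      a ∈ A.gr q → f (vertexFace x) • a ∈ A.gr n' := by
    intro p q n' f a h hf ha
    by_cases hp : p = 0
    · subst hp
      rw [zero_add] at h
      subst h
      exact Submodule.smul_mem _ _ ha
    · rw [apply_vertexFace_of_mem hf hp, zero_smul]
      exact Submodule.zero_mem _
  have hd : ∀ {p : ℤ} {f : Face n → F} (a : A), f ∈ cochainGr F n p →
      cochainD F n f (vertexFace x) • a + p.negOnePow • (f (vertexFace x) • A.d a) =
        A.d (f (vertexFace x) • a) := by
    intro p f a hf
    rw [cochainD_vertexFace, zero_smul, zero_add, map_smul]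
    by_cases hp : p = 0
    · subst hp
      rw [Int.negOnePow_zero, one_smul]
    · rw [apply_vertexFace_of_mem hf hp, zero_smul, smul_zero]
  refine (DGModule.isTensor_tensor (cochains F n) A).isHom
    (g := (faceComponent A (vertexFace x) : (cochains F n).tensor A →ₗ[F] A)) ?_ ?_
  · intro p q f a hf ha
    exact (congrArg (· ∈ A.gr (p + q)) (OperadData.faceComponent_tmul (vertexFace x) f a)).mpr
      (hmem rfl hf ha)
  · intro p f hf a
    refine Eq.trans ?_ ((hd a hf).trans
      (congrArg A.d (OperadData.faceComponent_tmul (vertexFace x) f a).symm))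
    exact congrArg₂ (· + ·) (OperadData.faceComponent_tmul (vertexFace x) _ a)
      (congrArg _ (OperadData.faceComponent_tmul (vertexFace x) f _))

theorem pointEquiv_eq : (pointEquiv F A).toLinearMap = faceComponent A (vertexFace 0) :=
  TensorProduct.ext' fun _ _ => rfl

theorem pathD_eq (i : Fin 2) : pathD F A i = faceComponent A (vertexFace (i.succAbove 0)) :=
  TensorProduct.ext' fun f a =>
    congrArg (· • a) (cochainMap_vertexFace (Fin.succAboveOrderEmb i).toOrderHom f 0)

theorem pathS₀_apply (a : A) :
    pathS₀ F A a = TensorProduct.mk F (Face 1 → F) A.carrier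
      (cochainMap F (⟨fun _ => 0, monotone_const⟩ : Fin (1 + 1) →o Fin (0 + 1)) fun _ => 1) a :=
  rfl

theorem pathD_pathS₀ (i : Fin 2) : pathD F A i ∘ₗ pathS₀ F A = LinearMap.id := by
  refine LinearMap.ext fun a => ?_
  rw [LinearMap.comp_apply, pathS₀_apply, pathD_eq]
  refine (OperadData.faceComponent_tmul (vertexFace (i.succAbove 0)) _ a).trans ?_
  rw [cochainMap_vertexFace, one_smul]
  rfl

end PathObject

/-! ### Evaluation at vertices and contraction of the path object -/

section PathObjectTheorem

variable {F : Type u} [CommRing F]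

/-- The augmentation of the Barratt-Eccles operad. -/
def barrattEcclesAugmentation (F : Type u) [CommRing F] (r : ℕ) :
    (NDSeq (Perm (Fin r)) →₀ F) →ₗ[F] F :=
  Finsupp.linearCombination F fun w : NDSeq (Perm (Fin r)) =>
      if w.1.length = 1 then (1 : F) else 0

theorem augmentation_tmul (P : OperadData.{u, v} F) {r : ℕ} (e : NDSeq (Perm (Fin r)) →₀ F)
    (p : P.obj r) :
    augmentation P r (TensorProduct.mk F (NDSeq (Perm (Fin r)) →₀ F) (P.obj r).carrier e p) =
      barrattEcclesAugmentation F r e • p := rfl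

/-- Evaluation at a vertex is a multiplicative character: the operad acts on values through its
augmentation. -/
theorem cochainOp_vertexFace {n r : ℕ} (p : NDSeq (Perm (Fin r)) →₀ F) (f : Fin r → Face n → F)
    (x : Fin (n + 1)) :
    cochainOp F n r p f (vertexFace x) = barrattEcclesAugmentation F r p * vertexForm x f := by
  have hp : p ∈ Finsupp.supported F F Set.univ := by
    rw [Finsupp.supported_univ]; trivial
  induction hp using supported_induction with
  | zero => simp
  | add q q' _ _ hq hq' => rw [map_add, map_add, add_apply, Pi.add_apply, hq, hq', add_mul]
  | smul c q _ hq =>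
    rw [map_smul, map_smul, smul_apply, Pi.smul_apply, hq, smul_eq_mul, smul_eq_mul, mul_assoc]
  | single w _ =>
    rw [cochainOp_single_vertexFace, barrattEcclesAugmentation, Finsupp.linearCombination_single]
    split_ifs <;> simp

open OperadData in
/-- A multiplicative character `c` of a `Q`-algebra `K` gives a reduction of the action of `Q ⊗ P`
on `K ⊗ A` to the action of `P` on `A`. -/
theorem OperadData.IsTensorActionOf.map_character {Q : OperadData.{u, v₁} F}
    {P : OperadData.{u, v₂} F} {R : OperadData.{u, v₃} F} {K : DGModule.{u, w₁} F}
    {A : DGModule.{u, w₂} F} {B : DGModule.{u, w₃} F} {κ : Q.Action K} {α : P.Action A}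
    {τ : R.Action B} {t : ∀ r, Q.obj r →ₗ[F] P.obj r →ₗ[F] R.obj r} {t' : K →ₗ[F] A →ₗ[F] B}
    (ht : IsTensor t) (ht' : DGModule.IsTensor t') (hτ : IsTensorActionOf t t' κ α τ) {r : ℕ}
    {c : K → F} (hc : ∀ (m : ℤ) (k : K), k ∈ K.gr m → m ≠ 0 → c k = 0)
    {ε : Q.obj r → F} (hκ : ∀ e k, c (κ r e k) = ε e * ∏ i, c (k i))
    {g : B →ₗ[F] A} (hg : ∀ k a, g (t' k a) = c k • a)
    {f : R.obj r →ₗ[F] P.obj r} (hf : ∀ e p, f (t r e p) = ε e • p)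
    (z : R.obj r) (y : Fin r → B) : g (τ r z y) = α r (f z) fun i => g (y i) := by
  induction z using (ht.obj r).induction with
  | zero => simp
  | add z z' h h' => rw [map_add, map_add, map_add, add_apply, add_apply, map_add, h, h']
  | smul c z h => rw [map_smul, map_smul, map_smul, smul_apply, smul_apply, map_smul, h]
  | apply de dp e p he hp =>
    refine ht'.eq_of_pure ((τ r _).isMultilinear.linearMap_comp g)
      ((α r _).isMultilinear.comp_linearMap fun _ => g) ?_ y
    intro m l k a hk ha
    rw [hτ e hp hk ha, LinearMap.map_intUnits_smul, hg, hf, hκ]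
    simp only [hg]
    rw [MultilinearMap.map_smul_univ, map_smul, smul_apply, smul_smul, mul_comm]
    -- The Koszul sign disappears since the character vanishes outside degree `0`.
    by_cases h : ∀ i, m i = 0
    · have h3 : koszulExponent dp m l = 0 := by simp [koszulExponent, h]
      rw [h3, Int.negOnePow_zero, one_smul]
    · obtain ⟨i, hi⟩ := not_forall.1 h
      rw [Finset.prod_eq_zero (Finset.mem_univ i) (hc _ _ (hk i) hi), zero_mul, zero_smul,
        smul_zero]

/-- The action of `E ⊗ P` on `N^*(Δ^n) ⊗ A` reduces to the action of `P` on a vertex. -/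
theorem OperadData.IsTensorAction.faceComponent_vertexFace {n : ℕ} {P : OperadData.{u, v} F}
    {A : DGModule.{u, w} F} {α : P.Action A}
    {τ : ((barrattEccles F).tensor P).Action ((cochains F n).tensor A)}
    (hτ : OperadData.IsTensorAction (cochainAction F n) α τ) (x : Fin (n + 1)) {r : ℕ}
    {g : (cochains F n).tensor A →ₗ[F] A} (hg : g = OperadData.faceComponent A (vertexFace x))
    (z : ((barrattEccles F).tensor P).obj r) (y : Fin r → ((cochains F n).tensor A).carrier) :
    g (τ r z y) = α r (augmentation P r z) fun i => g (y i) := by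
  subst hg
  exact OperadData.IsTensorActionOf.map_character
    (OperadData.isTensor_tensor (barrattEccles F) P) (DGModule.isTensor_tensor (cochains F n) A)
    hτ.of (c := fun f : Face n → F => f (vertexFace x))
    (fun m k hk hm => apply_vertexFace_of_mem hk hm x) (ε := barrattEcclesAugmentation F r)
    (fun e k => (cochainOp_vertexFace e k x).trans (congrArg _ (vertexForm_apply x k)))
    (fun k a => OperadData.faceComponent_tmul (vertexFace x) k a)
    (fun e p => augmentation_tmul P e p) z y

section TensorHomotopy

variable {V : DGModule.{u, v} F} {W : DGModule.{u, w} F} {T : DGModule.{u, w'} F}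
  {t : V →ₗ[F] W →ₗ[F] T}

theorem DGModule.IsTensor.homotopy_mem (ht : IsTensor t) {h : V →ₗ[F] V}
    (hh : ∀ n, ∀ x ∈ V.gr n, h x ∈ V.gr (n - 1)) {H : T →ₗ[F] T}
    (hH : ∀ a b, H (t a b) = t (h a) b) (n : ℤ) (x : T) (hx : x ∈ T.gr n) :
    H x ∈ T.gr (n - 1) := by
  induction hx using ht.induction_gr with
  | zero => rw [map_zero]; exact Submodule.zero_mem _
  | add x y _ _ hx hy => rw [map_add]; exact Submodule.add_mem _ hx hy
  | smul c x _ hx => rw [map_smul]; exact Submodule.smul_mem _ _ hx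
  | apply p q a b e ha hb =>
    rw [hH]
    have := ht.apply_mem (hh p a ha) hb
    rwa [show p - 1 + q = n - 1 by omega] at this

theorem DGModule.IsTensor.d_homotopy (ht : IsTensor t) {h g : V →ₗ[F] V}
    (hh : ∀ n, ∀ x ∈ V.gr n, h x ∈ V.gr (n - 1)) (hd : ∀ x, V.d (h x) = g x - x - h (V.d x))
    {H G : T →ₗ[F] T} (hH : ∀ a b, H (t a b) = t (h a) b) (hG : ∀ a b, G (t a b) = t (g a) b)
    (x : T) : T.d (H x) + H (T.d x) = G x - x := by
  induction x using ht.induction with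
  | zero => simp
  | add x y hx hy =>
    simp only [map_add]
    rw [add_add_add_comm, hx, hy]
    abel
  | smul c x hx => simp only [map_smul, ← smul_add, ← smul_sub, hx]
  | apply p q a b ha hb =>
    rw [hH, ht.d_apply (hh p a ha), ht.d_apply ha, map_add, LinearMap.map_intUnits_smul, hH, hH,
      hG, hd, map_sub, map_sub, LinearMap.sub_apply, LinearMap.sub_apply, Int.negOnePow_sub,
      Int.negOnePow_one, mul_neg, mul_one, Units.neg_smul]
    abel

end TensorHomotopy

/-- The contraction of `N^*(Δ^1) ⊗ A` on `N^*(Δ^0) ⊗ A`. -/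
def pathHomotopy (A : DGModule.{u, w} F) : (cochains F 1).tensor A →ₗ[F] (cochains F 1).tensor A :=
  (intervalH F).rTensor A.carrier

theorem pathHomotopy_mem (A : DGModule.{u, w} F) (n : ℤ) (x : (cochains F 1).tensor A)
    (hx : x ∈ ((cochains F 1).tensor A).gr n) :
    pathHomotopy A x ∈ ((cochains F 1).tensor A).gr (n - 1) :=
  (DGModule.isTensor_tensor (cochains F 1) A).homotopy_mem (h := intervalH F)
    (fun _ _ hf => intervalH_mem hf) (fun _ _ => rfl) n x hx

theorem cochainD_intervalH (f : Face 1 → F) :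
    cochainD F 1 (intervalH F f) = intervalP F f - f - intervalH F (cochainD F 1 f) :=
  eq_sub_of_add_eq ((add_comm _ _).trans (LinearMap.congr_fun (intervalD_H (F := F)) f))

theorem intervalP_eq (f : Face 1 → F) : intervalP F f = f (vertexFace 0) • cochainMap F
    (⟨fun _ => 0, monotone_const⟩ : Fin (1 + 1) →o Fin (0 + 1)) fun _ => 1 := by
  refine interval_ext ?_ ?_ ?_
  · rw [(intervalP_apply f).1, Pi.smul_apply, cochainMap_vertexFace, smul_eq_mul, mul_one]
  · rw [(intervalP_apply f).2.1, Pi.smul_apply, cochainMap_vertexFace, smul_eq_mul, mul_one]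
  · rw [(intervalP_apply f).2.2, Pi.smul_apply, cochainMap_edgeFace, smul_zero]

/-- The map `d₁` omits the vertex `1`, hence is the evaluation at the vertex `0`; followed by the
constant cochains, it is the projection `p` of the contraction. -/
theorem pathS₀_pathD_tmul (A : DGModule.{u, w} F) (f : Face 1 → F) (a : A) :
    pathS₀ F A (pathD F A 1 (TensorProduct.mk F (Face 1 → F) A.carrier f a)) =
      TensorProduct.mk F (Face 1 → F) A.carrier (intervalP F f) a := by
  have h1 : pathD F A 1 (TensorProduct.mk F (Face 1 → F) A.carrier f a) =
      f (vertexFace 0) • a := by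
    rw [pathD_eq]
    exact OperadData.faceComponent_tmul (vertexFace 0) f a
  rw [h1, pathS₀_apply, intervalP_eq f]
  exact (TensorProduct.tmul_smul (f (vertexFace 0)) _ a).trans
    (TensorProduct.smul_tmul' (f (vertexFace 0)) _ a)

theorem d_pathHomotopy (A : DGModule.{u, w} F) (x : (cochains F 1).tensor A) :
    ((cochains F 1).tensor A).d (pathHomotopy A x) +
      pathHomotopy A (((cochains F 1).tensor A).d x) = pathS₀ F A (pathD F A 1 x) - x :=
  (DGModule.isTensor_tensor (cochains F 1) A).d_homotopy (h := intervalH F) (g := intervalP F)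
    (fun _ _ hf => intervalH_mem hf) cochainD_intervalH (fun _ _ => rfl)
    (G := pathS₀ F A ∘ₗ pathD F A 1) (pathS₀_pathD_tmul A) x

end PathObjectTheorem

end

/-- Path objects of algebras over an operad `P` such that the augmentation `E ⊗ P → P` has a section
in the category of dg-operads. -/
theorem proposition3p1p9 {F : Type u} [CommRing F]
    (P : OperadData.{u, v} F) (hP : P.IsOperad)
    (σ : ∀ r : ℕ, P.obj r →ₗ[F] ((barrattEccles F).tensor P).obj r)
    (hσ : OperadData.IsOperadHom σ)
    (hsection : ∀ (r : ℕ) (p : P.obj r), augmentation P r (σ r p) = p)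
    (A : DGModule.{u, w} F) (α : P.Action A) (hα : OperadData.IsAlgebra α) :
    ∃ (τ₀ : ((barrattEccles F).tensor P).Action ((cochains F 0).tensor A))
      (τ₁ : ((barrattEccles F).tensor P).Action ((cochains F 1).tensor A)),
      -- `τ₀` and `τ₁` are the tensor product structures, and they are uniquely determined
      (OperadData.IsTensorAction (cochainAction F 0) α τ₀ ∧
        ∀ τ, OperadData.IsTensorAction (cochainAction F 0) α τ → τ = τ₀) ∧
      (OperadData.IsTensorAction (cochainAction F 1) α τ₁ ∧
        ∀ τ, OperadData.IsTensorAction (cochainAction F 1) α τ → τ = τ₁) ∧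
      -- they are structures of algebras over `E ⊗ P`
      OperadData.IsAlgebra τ₀ ∧ OperadData.IsAlgebra τ₁ ∧
      -- `N^*(Δ^0) ⊗ A` is identified with `A` as a `P`-algebra
      OperadData.IsAlgebraHom (τ₀.restrict σ) α (pointEquiv F A).toLinearMap ∧
      -- `N^*(Δ^1) ⊗ A` is a path object of `A`
      OperadData.IsPathObject α (τ₁.restrict σ) (pathS₀ F A) (pathD F A 0) (pathD F A 1) := by
  have h₀ := OperadData.isTensorAction_tensorAction (cochainAction F 0) α
  have h₁ := OperadData.isTensorAction_tensorAction (cochainAction F 1) α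
  have h₀' : OperadData.IsTensorActionOf _ _ _ _ _ := h₀.of
  have h₁' : OperadData.IsTensorActionOf _ _ _ _ _ := h₁.of
  have ht := OperadData.isTensor_tensor (barrattEccles F) P
  have ht₀ := DGModule.isTensor_tensor (cochains F 0) A
  have ht₁ := DGModule.isTensor_tensor (cochains F 1) A
  have halg₁ := h₁'.isAlgebra ht ht₁ hP isAlgebra_cochainAction_interval hα
  -- Evaluation at the vertex reduces `σ p` to its augmentation, which is `p` by the choice of a
  -- section; the same holds for both ends of the interval in `hd`.
  have hpoint : OperadData.IsAlgebraHom
      ((OperadData.tensorAction (cochainAction F 0) α).restrict σ) α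
        (pointEquiv F A).toLinearMap :=
    { hom := by
        rw [pointEquiv_eq]
        exact isHom_faceComponent A 0
      map_apply := fun p a => (h₀.faceComponent_vertexFace 0 (pointEquiv_eq A) (σ _ p) a).trans (by
        rw [hsection]) }
  have hd : ∀ i, OperadData.IsAlgebraHom
      ((OperadData.tensorAction (cochainAction F 1) α).restrict σ) α (pathD F A i) := fun i =>
    { hom := by
        rw [pathD_eq]
        exact isHom_faceComponent A _
      map_apply := fun p a => (h₁.faceComponent_vertexFace _ (pathD_eq A i) (σ _ p) a).trans (by
        rw [hsection]) }
  have hs : OperadData.IsAlgebraHom (OperadData.tensorAction (cochainAction F 0) α)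
      (OperadData.tensorAction (cochainAction F 1) α) (tensorCochainMap F A
        (⟨fun _ => 0, monotone_const⟩ : Fin (1 + 1) →o Fin (0 + 1))) :=
    h₀'.map ht ht₀ ht₁ h₁' (isAlgebraHom_cochainMap_interval_point _) fun _ _ => rfl
  have hone : ∀ {n : ℤ} {a : A}, a ∈ A.gr n →
      (pointEquiv F A).symm a ∈ ((cochains F 0).tensor A).gr n := by
    intro n a ha
    have h1 : ((fun _ => 1 : Face 0 → F) : (cochains F 0).carrier) ∈ (cochains F 0).gr 0 :=
      mem_cochainGr_point fun h => absurd rfl h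
    have := ht₀.apply_mem h1 ha
    rw [zero_add] at this
    exact this
  -- The inverse of the isomorphism of `P`-algebras `hpoint`, followed by the morphism of `E ⊗
  -- P`-algebras `hs`.
  have hs₀ : OperadData.IsAlgebraHom α
      ((OperadData.tensorAction (cochainAction F 1) α).restrict σ) (pathS₀ F A) :=
    { hom :=
        { map_mem := fun n a ha => hs.hom.map_mem n _ (hone ha)
          map_d := fun a => by
            have h1 : (pointEquiv F A).symm (A.d a) =
                ((cochains F 0).tensor A).d ((pointEquiv F A).symm a) := by
              rw [LinearEquiv.symm_apply_eq]
              exact (((hpoint.hom.map_d _).trans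
                (congrArg A.d ((pointEquiv F A).apply_symm_apply a)))).symm
            exact (congrArg _ h1).trans (hs.hom.map_d _) }
      map_apply := fun p a => by
        have h1 : (pointEquiv F A).symm (α _ p a) =
            OperadData.tensorAction (cochainAction F 0) α _ (σ _ p)
              fun i => (pointEquiv F A).symm (a i) := by
          rw [LinearEquiv.symm_apply_eq]
          refine ((hpoint.map_apply p _).trans ?_).symm
          exact congrArg _ (funext fun i => (pointEquiv F A).apply_symm_apply (a i))
        exact (congrArg _ h1).trans (hs.map_apply _ _) }
  have hdd : OperadData.IsAlgebraHom
      ((OperadData.tensorAction (cochainAction F 1) α).restrict σ) (α.prod α)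
        ((pathD F A 0).prod (pathD F A 1)) :=
    { hom :=
        { map_mem := fun n x hx => ⟨(hd 0).hom.map_mem n x hx, (hd 1).hom.map_mem n x hx⟩
          map_d := fun x => Prod.ext ((hd 0).hom.map_d x) ((hd 1).hom.map_d x) }
      map_apply := fun p a => Prod.ext ((hd 0).map_apply p a) ((hd 1).map_apply p a) }
  refine ⟨OperadData.tensorAction (cochainAction F 0) α,
    OperadData.tensorAction (cochainAction F 1) α,
    ⟨h₀, fun τ hτ => h₀'.unique ht ht₀ hτ.of⟩, ⟨h₁, fun τ hτ => h₁'.unique ht ht₁ hτ.of⟩,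
    h₀'.isAlgebra ht ht₀ hP isAlgebra_cochainAction_point hα, halg₁, hpoint, ?_⟩
  exact
    { isAlgebra := halg₁.restrict hσ
      s₀_hom := hs₀
      d₀_hom := hd 0
      d₁_hom := hd 1
      -- The homotopy contracts the interval to the vertex `0`, so the homotopy inverse of `s₀` is
      -- `d₁`.
      s₀_weakEquivalence := DGModule.isWeakEquivalence_of_homotopy hs₀.hom (hd 1).hom
        (pathD_pathS₀ A 1) (pathHomotopy A) (pathHomotopy_mem A) (d_pathHomotopy A)
      d₀d₁_hom := hdd
      d₀d₁_fibration := by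
        refine ⟨hdd.hom, ?_⟩
        rintro n ⟨a, b⟩ ⟨ha, hb⟩
        have hx : ∀ (x : Fin 2) {a : A}, a ∈ A.gr n →
            TensorProduct.mk F (cochains F 1).carrier A.carrier
              (Pi.single (vertexFace x) 1 : Face 1 → F) a ∈ ((cochains F 1).tensor A).gr n := by
          intro x a ha
          have h1 : ((Pi.single (vertexFace x) 1 : Face 1 → F) : (cochains F 1).carrier) ∈
              (cochains F 1).gr 0 :=
            mem_cochainGr_interval (fun h => absurd rfl h) (fun h => absurd rfl h) fun _ => by
              simp [(vertexFace_ne_edgeFace x).symm]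
          have := ht₁.apply_mem h1 ha
          rwa [zero_add] at this
        have hp : ∀ (i x : Fin 2) (a : A), pathD F A i
            (TensorProduct.mk F (cochains F 1).carrier A.carrier
              (Pi.single (vertexFace x) 1 : Face 1 → F) a) =
                if i.succAbove 0 = x then a else 0 := by
          intro i x a
          rw [pathD_eq]
          refine (OperadData.faceComponent_tmul (vertexFace (i.succAbove 0)) _ a).trans ?_
          split_ifs with h
          · rw [h, Pi.single_eq_same, one_smul]
          · have : vertexFace (i.succAbove 0) ≠ vertexFace x := fun h' =>
              h (Finset.singleton_injective (congrArg Subtype.val h'))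
            rw [Pi.single_eq_of_ne this, zero_smul]
        -- The preimage of `(a, b)` is the indicator of the vertex `1` tensored with `a`, plus the
        -- indicator of the vertex `0` tensored with `b`, as `d₀` is the evaluation at the vertex
        -- `1` and `d₁` at the vertex `0`.
        refine ⟨_, Submodule.add_mem _ (hx 1 ha) (hx 0 hb), Prod.ext ?_ ?_⟩
        · refine (map_add (pathD F A 0) _ _).trans ?_
          rw [hp, hp]
          simp
        · refine (map_add (pathD F A 1) _ _).trans ?_
          rw [hp, hp]
          simp
      d₀_s₀ := pathD_pathS₀ A 0
      d₁_s₀ := pathD_pathS₀ A 1 }
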